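/- Let $G$ be a connected Lie group with Lie algebra $\mathfrak g$ acting smoothly on a (Hausdorff, paracompact) symplectic manifold $(M,\omega)$ by symplectomorphisms. For $\xi\in\mathfrak g$ let $\underline\xi_x=\frac{d}{dt}\big|_{t=0}\exp(-t\xi)x$ be its fundamental vector field. For $f\in C^\infty(M)$ let $v_f$ be the Hamiltonian vector field, $df=-\iota_{v_f}\omega$, and let $\{f,h\}=\omega(v_f,v_h)$. Let $\mu:M\to\mathfrak g^*$ be a moment map: $\mu$ is smooth, $d\mu_\xi=-\iota_{\underline\xi}\,\omega$ for $\mu_\xi=\langle\mu,\xi\rangle$ and all $\xi\in\mathfrak g$, and $\mu$ is equivariant for the coadjoint action. Put $N=\mu^{-1}(0)$ and - $I_\mu$: the ideal of $C^\infty(M)$ generated by the $\mu_\xi$, $\xi\in\mathfrak g$; $\;I_N=\{f : f|_N=0\}$; - $\mathcal N(I_\mu)=\{f:\{f,I_\mu\}\subset I_\mu\}$; $\;F_N=\{f:\{f,I_N\}\subset I_N\}$; $\;\mathcal Q=\{f:\{f,C^\infty(M)\}\subset I_N\}$; - $\mathfrak X_{\mathfrak g}(M)$: the $C^\infty(M)$-module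 of vector fields generated by the $\underline\xi$; $\;I_{\mathfrak X}(N)$: the vector fields $X$ with $X\,C^\infty(M)\subset I_N$. The Śniatycki–Weinstein (ŚW) reduction is the algebra $(C^\infty(M)/I_\mu)^G$ with the bracket $\{[f],[h]\}=[\{f,h\}]$. The $L_\infty$-reduction is the algebra $L_{[N]}/I_{L_\infty}(N)$ with the bracket $\{[f],[h]\}=[\{f,h\}]$, where $L_{[N]}$ consists of the $f\in C^\infty(M)$ such that $v_fI_N\subset I_N$ and, for all $\xi\in\mathfrak g$, $\underline\xi f\in I_N$ and $[v_f,\underline\xi]\in\mathfrak X_{\mathfrak g}(M)+I_{\mathfrak X}(N)$, and where $I_{L_\infty}(N)$ consists of the $f\in L_{[N]}\cap I_N$ with $v_f\in\mathfrak X_{\mathfrak g}(M)+I_{\mathfrak X}(N)$. Both are well-defined Poisson algebras, and: 1. If $\mathcal N(I_\mu)\subset F_N$, then there is a canonical morphism of Poisson algebras $[f]\mapsto[f]$ from the ŚW reduction to the $L_\infty$-reduction. 2. If $I_N\cap\mathcal Q\subset I_\mu$, then there is a canonical injective morphism of Poisson algebras $[f]\mapsto[f]$ from the $L_\infty$-reduction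 to the ŚW reduction. 3. If $I_\mu=I_N$, then $[f]\mapsto[f]$ is an isomorphism of Poisson algebras from the ŚW reduction to the $L_\infty$-reduction. -/

import Mathlib

open scoped Manifold ContDiff

noncomputable section

namespace ObservableReduction

/-! ### Poisson structures on commutative algebras -/

/-- A Poisson bracket on a commutative real algebra: a Lie bracket that is a derivation in its
second (hence, by skew symmetry, in each) argument. -/
structure PoissonBracket (A : Type*) [CommRing A] [Algebra ℝ A] where
  /-- the bracket `{a, b}` -/
  bracket : A →ₗ[ℝ] A →ₗ[ℝ] A
  self_eq_zero : ∀ a, bracket a a = 0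
  jacobi : ∀ a b c, bracket a (bracket b c) + bracket b (bracket c a) + bracket c (bracket a b) = 0
  leibniz : ∀ a b c, bracket a (b * c) = bracket a b * c + b * bracket a c

/-- A morphism of Poisson algebras: a morphism of algebras preserving the brackets. -/
def IsPoissonMorphism {A B : Type*} [CommRing A] [Algebra ℝ A] [CommRing B] [Algebra ℝ B]
    (P : PoissonBracket A) (Q : PoissonBracket B) (φ : A →ₐ[ℝ] B) : Prop :=
  ∀ a b, φ (P.bracket a b) = Q.bracket (φ a) (φ b)

/-! ### Smooth functions, vector fields, symplectic forms -/

section Manifold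

variable (E : Type*) [NormedAddCommGroup E] [NormedSpace ℝ E]
  (M : Type*) [TopologicalSpace M] [ChartedSpace E M]

/-- The algebra `C^∞(M)` of smooth real functions. -/
abbrev SmoothFun : Type _ := C^∞⟮𝓘(ℝ, E), M; ℝ⟯

/-- The Lie algebra and `C^∞(M)`-module `𝔛(M)` of smooth vector fields, as derivations of
`C^∞(M)`; the Lie bracket is the commutator. -/
abbrev VField : Type _ := Derivation ℝ (SmoothFun E M) (SmoothFun E M)

/-- A symplectic form on `M`. A differential 2-form is an alternating `C^∞(M)`-bilinear form on
`𝔛(M)`. Closedness is the vanishing of `dω(X, Y, Z)`, written with the invariant formula for the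
exterior derivative; nondegeneracy says that `X ↦ ι_X Ω` is an isomorphism from vector fields to
1-forms. -/
structure SymplecticForm where
  /-- the form `Ω(X, Y)` -/
  form : VField E M →ₗ[SmoothFun E M] VField E M →ₗ[SmoothFun E M] SmoothFun E M
  alternating : ∀ X, form X X = 0
  closed : ∀ X Y Z : VField E M,
    X (form Y Z) + Y (form Z X) + Z (form X Y)
      - form ⁅X, Y⁆ Z - form ⁅Y, Z⁆ X - form ⁅Z, X⁆ Y = 0
  nondegenerate : Function.Bijective form

variable {E M}

/-- The differential `df`, as the 1-form `X ↦ X f`. -/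
def differential (f : SmoothFun E M) : VField E M →ₗ[SmoothFun E M] SmoothFun E M where
  toFun X := X f
  map_add' _ _ := rfl
  map_smul' _ _ := rfl

theorem VField.add_lie (X Y Z : VField E M) : ⁅X + Y, Z⁆ = ⁅X, Z⁆ + ⁅Y, Z⁆ := by
  ext1 k
  simp only [Derivation.commutator_apply, Derivation.add_apply, map_add]
  ring

theorem VField.zero_lie (Z : VField E M) : ⁅(0 : VField E M), Z⁆ = 0 := by
  ext1 k
  simp only [Derivation.commutator_apply, Derivation.zero_apply, map_zero, sub_zero]

namespace SymplecticForm

variable (Ω : SymplecticForm E M)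

/-- The Hamiltonian vector field `v_f`, the unique solution of `df = -ι_{v_f} Ω`. -/
def hamVF (f : SmoothFun E M) : VField E M :=
  (LinearEquiv.ofBijective Ω.form Ω.nondegenerate).symm (-differential f)

theorem form_hamVF (f : SmoothFun E M) : Ω.form (Ω.hamVF f) = -differential f :=
  (LinearEquiv.ofBijective Ω.form Ω.nondegenerate).apply_symm_apply _

theorem form_hamVF_apply (f : SmoothFun E M) (X : VField E M) :
    Ω.form (Ω.hamVF f) X = -X f := by
  rw [form_hamVF]; rfl

theorem eq_hamVF {f : SmoothFun E M} {X : VField E M} (h : ∀ Y, Ω.form X Y = -Y f) :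
    X = Ω.hamVF f :=
  Ω.nondegenerate.1 (LinearMap.ext fun Y => (h Y).trans (Ω.form_hamVF_apply f Y).symm)

/-- The Poisson bracket `{f, h} = Ω(v_f, v_h)` of `C^∞(M, Ω)`. -/
def bracket (f h : SmoothFun E M) : SmoothFun E M := Ω.form (Ω.hamVF f) (Ω.hamVF h)

theorem hamVF_add (f h : SmoothFun E M) : Ω.hamVF (f + h) = Ω.hamVF f + Ω.hamVF h := by
  refine (Ω.eq_hamVF fun Y => ?_).symm
  rw [map_add, LinearMap.add_apply, form_hamVF_apply, form_hamVF_apply, map_add, neg_add]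

theorem hamVF_mul (f h : SmoothFun E M) :
    Ω.hamVF (f * h) = f • Ω.hamVF h + h • Ω.hamVF f := by
  refine (Ω.eq_hamVF fun Y => ?_).symm
  rw [map_add, LinearMap.add_apply, map_smul, map_smul, LinearMap.smul_apply,
    LinearMap.smul_apply, form_hamVF_apply, form_hamVF_apply, Derivation.leibniz, smul_neg,
    smul_neg, neg_add]

theorem hamVF_algebraMap (c : ℝ) : Ω.hamVF (algebraMap ℝ (SmoothFun E M) c) = 0 := by
  refine (Ω.eq_hamVF fun Y => ?_).symm
  rw [map_zero, LinearMap.zero_apply, Derivation.map_algebraMap, neg_zero]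

/-- The Lie algebra normalizer `𝒩(S) = {f | {f, S} ⊆ S}` of a subset `S` of `C^∞(M, Ω)`. -/
def normalizer (S : Set (SmoothFun E M)) : Set (SmoothFun E M) :=
  {f | ∀ h ∈ S, Ω.bracket f h ∈ S}

end SymplecticForm

/-- The constraint ideal `I_N` of smooth functions vanishing on `N`. -/
def constraintIdeal (N : Set M) : Ideal (SmoothFun E M) where
  carrier := {f | ∀ x ∈ N, f x = 0}
  zero_mem' _ _ := rfl
  add_mem' {f h} hf hh x hx := by
    rw [ContMDiffMap.coe_add, Pi.add_apply, hf x hx, hh x hx, add_zero]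
  smul_mem' c f hf x hx := by
    rw [smul_eq_mul, ContMDiffMap.coe_mul, Pi.mul_apply, hf x hx, mul_zero]

/-- The first class functions `F_N = {f | {f, I_N} ⊆ I_N}`. -/
def firstClass (Ω : SymplecticForm E M) (N : Set M) : Set (SmoothFun E M) :=
  {f | ∀ h ∈ constraintIdeal (E := E) N, Ω.bracket f h ∈ constraintIdeal (E := E) N}

/-- The Casimir functions along `N`, `𝒬 = {f | {f, C^∞(M)} ⊆ I_N}`. -/
def casimir (Ω : SymplecticForm E M) (N : Set M) : Set (SmoothFun E M) :=
  {f | ∀ h, Ω.bracket f h ∈ constraintIdeal (E := E) N}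

/-- The `C^∞(M)`-module `I_𝔛(N)` of vector fields vanishing along `N`. -/
def vanishingVF (N : Set M) : Submodule (SmoothFun E M) (VField E M) where
  carrier := {X | ∀ f, X f ∈ constraintIdeal (E := E) N}
  zero_mem' _ := Submodule.zero_mem _
  add_mem' hX hY f := Submodule.add_mem _ (hX f) (hY f)
  smul_mem' c _ hX f := Submodule.smul_mem _ c (hX f)

end Manifold

/-! ### Smooth group actions and moment maps -/

section Action

variable {EG : Type*} [NormedAddCommGroup EG] [NormedSpace ℝ EG]
  {G : Type*} [TopologicalSpace G] [ChartedSpace EG G] [Group G]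
  {E : Type*} [NormedAddCommGroup E] [NormedSpace ℝ E]
  {M : Type*} [TopologicalSpace M] [ChartedSpace E M]
  [MulAction G M]

/-- The adjoint representation: `Ad g` is the derivative at `1` of the conjugation by `g`. -/
def adjoint (g : G) (ξ : GroupLieAlgebra 𝓘(ℝ, EG) G) : GroupLieAlgebra 𝓘(ℝ, EG) G :=
  mfderiv 𝓘(ℝ, EG) 𝓘(ℝ, EG) (fun h : G => g * h * g⁻¹) 1 ξ

/-- The value at `x` of the derivative of `f` along the fundamental vector field of `ξ`:
`d/dt f(exp(-tξ) x)` at `t = 0`, that is, minus the derivative at `1` of `g ↦ f(g x)` along `ξ`. -/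
def fundamentalDeriv (ξ : GroupLieAlgebra 𝓘(ℝ, EG) G) (f : SmoothFun E M) (x : M) : ℝ :=
  -(mfderiv 𝓘(ℝ, EG) 𝓘(ℝ, ℝ) (fun g : G => f (g • x)) 1 ξ : ℝ)

variable [ContMDiffSMul 𝓘(ℝ, EG) 𝓘(ℝ, E) ∞ G M]

variable (EG) in
/-- The left action of `G` on `C^∞(M)`, `(g · f)(x) = f(g⁻¹ x)`. -/
def translate (g : G) : SmoothFun E M →ₐ[ℝ] SmoothFun E M where
  toFun f := ⟨fun x => f (g⁻¹ • x), f.contMDiff.comp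
    ((contMDiff_smul (I := 𝓘(ℝ, EG)) (I' := 𝓘(ℝ, E)) (n := ∞) (G := G) (M := M)).comp
      (contMDiff_const.prodMk contMDiff_id))⟩
  map_one' := rfl
  map_mul' _ _ := rfl
  map_zero' := rfl
  map_add' _ _ := rfl
  commutes' _ := rfl

theorem translate_apply (g : G) (f : SmoothFun E M) (x : M) :
    translate EG g f x = f (g⁻¹ • x) := rfl

theorem translate_translate_inv (g : G) (f : SmoothFun E M) :
    translate EG g (translate EG g⁻¹ f) = f := by
  ext x
  rw [translate_apply, translate_apply, inv_inv, smul_inv_smul]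

variable (EG) in
/-- The push-forward of vector fields along the action of `g`,
`(g_* X) f = g · (X (g⁻¹ · f))`. -/
def pushforward (g : G) (X : VField E M) : VField E M :=
  Derivation.mk' ((translate EG g).toLinearMap ∘ₗ (X : SmoothFun E M →ₗ[ℝ] SmoothFun E M) ∘ₗ
    (translate EG g⁻¹).toLinearMap) fun f h => by
      simp only [LinearMap.comp_apply, AlgHom.toLinearMap_apply, Derivation.coeFn_coe, map_mul,
        Derivation.leibniz, map_add, smul_eq_mul, translate_translate_inv]

variable (EG G) in
/-- The action of `G` preserves the form: `g^* ω = ω` for every `g`. -/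
def IsSymplecticAction (Ω : SymplecticForm E M) : Prop :=
  ∀ (g : G) (X Y : VField E M),
    Ω.form (pushforward EG g X) (pushforward EG g Y) = translate EG g (Ω.form X Y)

theorem contMDiff_orbit (f : SmoothFun E M) (x : M) :
    ContMDiff 𝓘(ℝ, EG) 𝓘(ℝ, ℝ) ∞ (fun g : G => f (g • x)) :=
  f.contMDiff.comp
    ((contMDiff_smul (I := 𝓘(ℝ, EG)) (I' := 𝓘(ℝ, E)) (n := ∞) (G := G) (M := M)).comp
      (contMDiff_id.prodMk contMDiff_const))

theorem mdifferentiableAt_orbit (f : SmoothFun E M) (x : M) (g : G) :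
    MDifferentiableAt 𝓘(ℝ, EG) 𝓘(ℝ, ℝ) (fun g : G => f (g • x)) g :=
  (contMDiff_orbit f x).mdifferentiableAt (by simp)

variable [LieGroup 𝓘(ℝ, EG) ∞ G] [IsManifold 𝓘(ℝ, E) ∞ M]

theorem contMDiff_fundamentalDeriv (ξ : GroupLieAlgebra 𝓘(ℝ, EG) G) (f : SmoothFun E M) :
    ContMDiff 𝓘(ℝ, E) 𝓘(ℝ, ℝ) ∞ (fundamentalDeriv ξ f) := by
  intro x₀
  have hF : ContMDiff (𝓘(ℝ, E).prod 𝓘(ℝ, EG)) 𝓘(ℝ, ℝ) ∞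
      (Function.uncurry fun (x : M) (g : G) => f (g • x)) :=
    f.contMDiff.comp
      ((contMDiff_smul (I := 𝓘(ℝ, EG)) (I' := 𝓘(ℝ, E)) (n := ∞) (G := G) (M := M)).comp
        (contMDiff_snd.prodMk contMDiff_fst))
  have h := ContMDiffAt.mfderiv (m := ∞) (n := ∞) (x₀ := x₀)
    (fun (x : M) (g : G) => f (g • x)) (fun _ => (1 : G)) (hF _) contMDiffAt_const (by simp)
  let c : EG := ξ
  have h2 := (h.clm_apply (contMDiffAt_const (c := c))).neg
  refine h2.congr_of_eventuallyEq (Filter.Eventually.of_forall fun x => ?_)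
  have h3 : ∀ D : M → EG →L[ℝ] ℝ, inTangentCoordinates 𝓘(ℝ, EG) 𝓘(ℝ, ℝ) (fun _ : M => (1 : G))
      (fun x : M => f ((1 : G) • x)) D x₀ x c = D x c := fun D => by
    rw [inTangentCoordinates_eq (I := 𝓘(ℝ, EG)) (I' := 𝓘(ℝ, ℝ)) (fun _ : M => (1 : G))
      (fun x : M => f ((1 : G) • x)) D (mem_chart_source _ _) (by rw [chartAt_self_eq]; trivial),
      ContinuousLinearMap.comp_apply, ContinuousLinearMap.comp_apply,
      (tangentBundleCore 𝓘(ℝ, EG) G).coordChange_self _ _ (mem_chart_source _ _),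
      tangentBundleCore_coordChange_model_space]
    rfl
  exact congrArg Neg.neg (h3 (fun x => mfderiv 𝓘(ℝ, EG) 𝓘(ℝ, ℝ) (fun g : G => f (g • x)) 1)).symm

/-- The fundamental vector field `ξ_M`, with `ξ_M(x) = d/dt exp(-tξ) x` at `t = 0`. -/
def fundamentalVF (ξ : GroupLieAlgebra 𝓘(ℝ, EG) G) : VField E M :=
  Derivation.mk'
    { toFun := fun f => ⟨fundamentalDeriv ξ f, contMDiff_fundamentalDeriv ξ f⟩
      map_add' := fun f h => ContMDiffMap.ext fun x => by
        have := ((mdifferentiableAt_orbit (EG := EG) f x (1 : G)).hasMFDerivAt.add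
          (mdifferentiableAt_orbit (EG := EG) h x 1).hasMFDerivAt).mfderiv
        have h2 := congrArg Neg.neg (DFunLike.congr_fun this ξ)
        exact h2.trans (neg_add _ _)
      map_smul' := fun c f => ContMDiffMap.ext fun x => by
        have := ((mdifferentiableAt_orbit (EG := EG) f x (1 : G)).hasMFDerivAt.const_smul c).mfderiv
        have h2 := congrArg Neg.neg (DFunLike.congr_fun this ξ)
        exact h2.trans (smul_neg c _).symm }
    fun f h => ContMDiffMap.ext fun x => by
      have := ((mdifferentiableAt_orbit (EG := EG) f x (1 : G)).hasMFDerivAt.mul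
          (mdifferentiableAt_orbit (EG := EG) h x 1).hasMFDerivAt).mfderiv
      have h2 := congrArg Neg.neg (DFunLike.congr_fun this ξ)
      have h3 : ∀ a b p q : ℝ, -(a * q + b * p) = a * -q + b * -p := fun a b p q => by ring
      rw [one_smul] at h2
      exact h2.trans (h3 (f x) (h x) _ _)

theorem fundamentalVF_apply (ξ : GroupLieAlgebra 𝓘(ℝ, EG) G) (f : SmoothFun E M) (x : M) :
    fundamentalVF ξ f x =
      -(mfderiv 𝓘(ℝ, EG) 𝓘(ℝ, ℝ) (fun g : G => f (g • x)) 1 ξ : ℝ) := rfl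

variable (EG G) in
/-- The `C^∞(M)`-module `𝔛_𝔤(M)` generated by the fundamental vector fields. -/
def fundamentalSubmodule : Submodule (SmoothFun E M) (VField E M) :=
  Submodule.span _ (Set.range fun ξ : GroupLieAlgebra 𝓘(ℝ, EG) G => fundamentalVF ξ)

variable (EG G) in
/-- A moment map `μ : M → 𝔤^*`: smooth, with `dμ_ξ = -ι_{ξ_M} ω` for all `ξ`, and equivariant for
the coadjoint action `(g · λ)(ξ) = λ(Ad_{g⁻¹} ξ)`. Smoothness into the finite-dimensional space
`𝔤^*` is smoothness of all the components `μ_ξ = ⟨μ, ξ⟩`. -/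
structure MomentMap (Ω : SymplecticForm E M) where
  /-- the map `M → 𝔤^*` -/
  toFun : M → Module.Dual ℝ (GroupLieAlgebra 𝓘(ℝ, EG) G)
  smooth : ∀ ξ, ContMDiff 𝓘(ℝ, E) 𝓘(ℝ, ℝ) ∞ fun x => toFun x ξ
  differential_eq : ∀ ξ (X : VField E M),
    X (⟨fun x => toFun x ξ, smooth ξ⟩ : SmoothFun E M) = -Ω.form (fundamentalVF ξ) X
  equivariant : ∀ (g : G) (x : M) (ξ : GroupLieAlgebra 𝓘(ℝ, EG) G),
    toFun (g • x) ξ = toFun x (adjoint g⁻¹ ξ)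

namespace MomentMap

variable {Ω : SymplecticForm E M} (μ : MomentMap EG G Ω)

/-- The momentum `μ_ξ ∈ C^∞(M)`. -/
def momentum (ξ : GroupLieAlgebra 𝓘(ℝ, EG) G) : SmoothFun E M :=
  ⟨fun x => μ.toFun x ξ, μ.smooth ξ⟩

/-- The constraint set `N = μ⁻¹(0)`. -/
def zeroLevel : Set M := {x | μ.toFun x = 0}

/-- The momentum ideal `I_μ`, generated by the momenta. -/
def momentumIdeal : Ideal (SmoothFun E M) := Ideal.span (Set.range μ.momentum)

theorem translate_momentum (g : G) (ξ : GroupLieAlgebra 𝓘(ℝ, EG) G) :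
    translate EG g (μ.momentum ξ) = μ.momentum (adjoint g ξ) := by
  ext x
  rw [translate_apply]
  exact (μ.equivariant g⁻¹ x ξ).trans (by rw [inv_inv]; rfl)

theorem momentumIdeal_le_comap (g : G) :
    μ.momentumIdeal ≤ μ.momentumIdeal.comap (translate EG g : SmoothFun E M →ₐ[ℝ] _) := by
  refine Ideal.span_le.2 ?_
  rintro _ ⟨ξ, rfl⟩
  change translate EG g (μ.momentum ξ) ∈ μ.momentumIdeal
  rw [translate_momentum]
  exact Ideal.subset_span ⟨_, rfl⟩

/-! ### The Śniatycki–Weinstein reduction -/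

/-- The action of `G` on `C^∞(M) / I_μ` induced by the action on `C^∞(M)`. -/
def quotientAction (g : G) :
    (SmoothFun E M ⧸ μ.momentumIdeal) →ₐ[ℝ] (SmoothFun E M ⧸ μ.momentumIdeal) :=
  Ideal.quotientMapₐ μ.momentumIdeal (translate EG g) (μ.momentumIdeal_le_comap g)

/-- The algebra `(C^∞(M) / I_μ)^G` underlying the Śniatycki–Weinstein reduction. -/
def swReduction : Subalgebra ℝ (SmoothFun E M ⧸ μ.momentumIdeal) where
  carrier := {q | ∀ g, μ.quotientAction g q = q}
  mul_mem' ha hb g := by rw [map_mul, ha g, hb g]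
  add_mem' ha hb g := by rw [map_add, ha g, hb g]
  algebraMap_mem' c g := AlgHom.commutes _ c

/-- The class of `f` in `C^∞(M) / I_μ`. -/
def swClass (f : SmoothFun E M) : SmoothFun E M ⧸ μ.momentumIdeal :=
  Ideal.Quotient.mk μ.momentumIdeal f

/-- A Poisson bracket on `(C^∞(M) / I_μ)^G` is the one of the Śniatycki–Weinstein reduction when it
is the push-forward of the bracket of `C^∞(M, ω)`: `{[f], [h]} = [{f, h}]` for all `f, h` with
invariant classes (the class `[{f, h}]` being invariant as well). -/
def IsSWBracket (P : PoissonBracket μ.swReduction) : Prop :=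
  ∀ (f h : SmoothFun E M) (hf : μ.swClass f ∈ μ.swReduction) (hh : μ.swClass h ∈ μ.swReduction),
    ((P.bracket ⟨μ.swClass f, hf⟩ ⟨μ.swClass h, hh⟩ : μ.swReduction) :
      SmoothFun E M ⧸ μ.momentumIdeal) = μ.swClass (Ω.bracket f h)

end MomentMap

/-! ### The `L_∞`-reduction -/

variable (EG G) in
/-- The module `𝔛_𝔤(M) + I_𝔛(N)` of the vector fields that are in `𝔛_𝔤(M)` along `N`. -/
def verticalVF (N : Set M) : Submodule (SmoothFun E M) (VField E M) :=
  fundamentalSubmodule EG G ⊔ vanishingVF N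

variable (EG G) in
/-- The algebra `L_∞(M, ω)_[N]` of reducible observables: the functions `f` that are reducible as
a form (`ξ_M f` vanishes on `N` for all `ξ`) and whose Hamiltonian vector field `v_f` is reducible
(`v_f` is tangent to `N`, and `[v_f, ξ_M]` is in `𝔛_𝔤(M)` along `N` for all `ξ`). -/
def reducibleObservables (Ω : SymplecticForm E M) (N : Set M) :
    Subalgebra ℝ (SmoothFun E M) where
  carrier := {f |
    (∀ ξ : GroupLieAlgebra 𝓘(ℝ, EG) G, fundamentalVF ξ f ∈ constraintIdeal (E := E) N) ∧
    (∀ h ∈ constraintIdeal (E := E) N, Ω.hamVF f h ∈ constraintIdeal (E := E) N) ∧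
    (∀ ξ : GroupLieAlgebra 𝓘(ℝ, EG) G, ⁅Ω.hamVF f, fundamentalVF ξ⁆ ∈ verticalVF EG G N)}
  mul_mem' := by
    rintro f h ⟨f1, f2, f3⟩ ⟨h1, h2, h3⟩
    have key : ∀ (a b : SmoothFun E M) (X : VField E M),
        X a ∈ constraintIdeal (E := E) N → ⁅Ω.hamVF b, X⁆ ∈ verticalVF EG G N →
        ⁅a • Ω.hamVF b, X⁆ ∈ verticalVF EG G N := by
      intro a b X ha hb
      have e : ⁅a • Ω.hamVF b, X⁆ = a • ⁅Ω.hamVF b, X⁆ + -(X a • Ω.hamVF b) := by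
        ext1 k
        simp only [Derivation.commutator_apply, Derivation.smul_apply, Derivation.add_apply,
          Derivation.neg_apply, smul_eq_mul, Derivation.leibniz]
        ring
      rw [e]
      refine Submodule.add_mem _ (Submodule.smul_mem _ _ hb) (Submodule.neg_mem _ ?_)
      exact Submodule.mem_sup_right fun k => Ideal.mul_mem_right _ _ ha
    refine ⟨fun ξ => ?_, fun k hk => ?_, fun ξ => ?_⟩
    · rw [Derivation.leibniz]
      exact Submodule.add_mem _ (Ideal.mul_mem_left _ _ (h1 ξ)) (Ideal.mul_mem_left _ _ (f1 ξ))
    · rw [Ω.hamVF_mul]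
      exact Submodule.add_mem _ (Ideal.mul_mem_left _ _ (h2 k hk)) (Ideal.mul_mem_left _ _ (f2 k hk))
    · rw [Ω.hamVF_mul, VField.add_lie]
      exact Submodule.add_mem _ (key f h _ (f1 ξ) (h3 ξ)) (key h f _ (h1 ξ) (f3 ξ))
  add_mem' := by
    rintro f h ⟨f1, f2, f3⟩ ⟨h1, h2, h3⟩
    refine ⟨fun ξ => ?_, fun k hk => ?_, fun ξ => ?_⟩
    · rw [map_add]
      exact Submodule.add_mem _ (f1 ξ) (h1 ξ)
    · rw [Ω.hamVF_add]
      exact Submodule.add_mem _ (f2 k hk) (h2 k hk)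
    · rw [Ω.hamVF_add, VField.add_lie]
      exact Submodule.add_mem _ (f3 ξ) (h3 ξ)
  algebraMap_mem' c := by
    refine ⟨fun ξ => ?_, fun k _ => ?_, fun ξ => ?_⟩
    · rw [Derivation.map_algebraMap]
      exact Submodule.zero_mem _
    · rw [Ω.hamVF_algebraMap]
      exact Submodule.zero_mem _
    · rw [Ω.hamVF_algebraMap, VField.zero_lie]
      exact Submodule.zero_mem _

variable (EG G) in
/-- The vanishing ideal `I_{L_∞}(N)` of `L_∞(M, ω)_[N]`: the reducible observables `f` that vanish
on `N` and whose Hamiltonian vector field is in `𝔛_𝔤(M)` along `N`. -/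
def vanishingObservables (Ω : SymplecticForm E M) (N : Set M) :
    Ideal (reducibleObservables EG G Ω N) where
  carrier := {f | (f : SmoothFun E M) ∈ constraintIdeal (E := E) N ∧
    Ω.hamVF (f : SmoothFun E M) ∈ verticalVF EG G N}
  zero_mem' := by
    refine ⟨Submodule.zero_mem _, ?_⟩
    have h := Ω.hamVF_algebraMap 0
    rw [map_zero] at h
    exact (congrArg (· ∈ verticalVF EG G N) h).mpr (Submodule.zero_mem _)
  add_mem' := by
    rintro f h ⟨f1, f2⟩ ⟨h1, h2⟩
    refine ⟨Submodule.add_mem _ f1 h1, ?_⟩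
    change Ω.hamVF ((f : SmoothFun E M) + h) ∈ _
    rw [Ω.hamVF_add]
    exact Submodule.add_mem _ f2 h2
  smul_mem' := by
    rintro c f ⟨f1, f2⟩
    refine ⟨Ideal.mul_mem_left _ _ f1, ?_⟩
    change Ω.hamVF ((c : SmoothFun E M) * f) ∈ _
    rw [Ω.hamVF_mul]
    refine Submodule.add_mem _ (Submodule.smul_mem _ _ f2) (Submodule.mem_sup_right fun k => ?_)
    exact Ideal.mul_mem_right _ _ f1

variable (EG G) in
/-- The algebra `L_∞(M, ω)_[N] / I_{L_∞}(N)` underlying the `L_∞`-reduction along `N`. -/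
abbrev LinftyReduction (Ω : SymplecticForm E M) (N : Set M) : Type _ :=
  reducibleObservables EG G Ω N ⧸ vanishingObservables EG G Ω N

/-- The class in the `L_∞`-reduction of a reducible observable. -/
def linftyClass {Ω : SymplecticForm E M} {N : Set M} (f : reducibleObservables EG G Ω N) :
    LinftyReduction EG G Ω N :=
  Ideal.Quotient.mk _ f

/-- A Poisson bracket on `L_∞(M, ω)_[N] / I_{L_∞}(N)` is the one of the `L_∞`-reduction when it is
induced by the bracket of `C^∞(M, ω)`: the bracket `{f, h}` of two reducible observables is a
reducible observable, and `{[f], [h]} = [{f, h}]`. -/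
def IsLinftyBracket {Ω : SymplecticForm E M} {N : Set M}
    (P : PoissonBracket (LinftyReduction EG G Ω N)) : Prop :=
  ∀ f h : reducibleObservables EG G Ω N,
    ∃ hk : Ω.bracket (f : SmoothFun E M) (h : SmoothFun E M) ∈ reducibleObservables EG G Ω N,
      P.bracket (linftyClass f) (linftyClass h) = linftyClass ⟨_, hk⟩

end Action

end ObservableReduction

end

open ObservableReduction

/-! The heart of the matter is `MomentMap.swClass_mem_iff`: for connected `G`, the class of `f`
modulo I_μ is `G`-invariant iff ξ_M f ∈ I_μ for all ξ. Both directions need analysis, because I_μ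
need not be closed in C^∞(M), so limits and integrals of its elements may leave it. The remedy is to
work with coefficients: f ∈ I_μ iff f = ⟨μ, a⟩ for a smooth 𝔤-valued `a` (`mem_momentumIdeal_iff`),
and this is a local condition because the admissible values of `a` at a point form an affine space
(`mem_momentumIdeal_of_local`).

From group to Lie algebra: g ↦ g·h − h is a cocycle with values in I_μ, with no control on its
coefficients. A Baire argument makes the coefficients small for a set of g dense near 1
(`eventually_mem_closure`), and a successive approximation as in the open mapping theorem makes them
small for all g near 1 (`eventually_hasBoundedLift`). Along successive square roots s_n of a group
element, the cocycle doubles up to an error of relative size 2^(-n), so the coefficients of 2^n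
F(s_n) converge with all derivatives along a subsequence, and the derivative ξ_M h has smooth
coefficients (`exists_derivative_eq`).

From Lie algebra to group: f(gx) − f(x) is an integral along a path from 1 to g. Equivariance of μ
turns ⟨μ(γ(t)x), ·⟩ into ⟨μ(x), Ad ·⟩, so μ(x) leaves the integral and what remains is a smooth
coefficient (`translate_inv_sub_mem_of_path`). The elements g obtained in this way contain a
neighbourhood of 1, hence generate `G`.

The rest is algebra with v_{μ_ξ} = ξ_M and v_{{f,h}} = [v_f, v_h]. Modulo fields vanishing on N, the
vertical fields are exactly the v_i with i ∈ I_μ, and v_{ξ_M f} = −[v_f, ξ_M]. So invariance modulo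
I_μ gives the bracket condition in L_[N]. Conversely, for f ∈ L_[N] the function ξ_M f differs from
an element of I_μ by one of I_N ∩ 𝒬. The two hypotheses compare the algebras of representatives
(`invariantClasses_le`, `le_invariantClasses`), and the same two facts compare the kernels. -/

namespace ObservableReduction

open Set Filter Topology Metric

/-! ### Seminorms on spaces of smooth functions -/

section Jets

variable {E : Type*} [NormedAddCommGroup E] [NormedSpace ℝ E]
  {V : Type*} [NormedAddCommGroup V] [NormedSpace ℝ V]

/-- The derivatives of `a` of order at most `n` are bounded by `K` on the set `s`. -/
def JetBound (n : ℕ) (s : Set E) (a : E → V) (K : ℝ) : Prop :=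
  ∀ i ≤ n, ∀ y ∈ s, ‖iteratedFDeriv ℝ i a y‖ ≤ K

theorem JetBound.mono {n n' : ℕ} {s s' : Set E} {a : E → V} {K K' : ℝ} (h : JetBound n s a K)
    (hn : n' ≤ n) (hs : s' ⊆ s) (hK : K ≤ K') : JetBound n' s' a K' :=
  fun i hi y hy => (h i (hi.trans hn) y (hs hy)).trans hK

theorem contDiffAt_of_contDiffOn {s : Set E} (hs : IsOpen s) {a : E → V} (ha : ContDiffOn ℝ ∞ a s)
    {y : E} (hy : y ∈ s) (i : ℕ) : ContDiffAt ℝ i a y :=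
  ((ha.contDiffAt (hs.mem_nhds hy)).of_le (by exact_mod_cast le_top))

theorem JetBound.add {n : ℕ} {s : Set E} (hs : IsOpen s) {a b : E → V} {K L : ℝ}
    (ha : ContDiffOn ℝ ∞ a s) (hb : ContDiffOn ℝ ∞ b s)
    (h : JetBound n s a K) (h' : JetBound n s b L) : JetBound n s (a + b) (K + L) := by
  intro i hi y hy
  rw [iteratedFDeriv_add_apply (contDiffAt_of_contDiffOn hs ha hy i)
    (contDiffAt_of_contDiffOn hs hb hy i)]
  exact (norm_add_le _ _).trans (add_le_add (h i hi y hy) (h' i hi y hy))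

theorem JetBound.const_smul {n : ℕ} {s : Set E} (hs : IsOpen s) {a : E → V} {K : ℝ}
    (ha : ContDiffOn ℝ ∞ a s) (h : JetBound n s a K) (t : ℝ) :
    JetBound n s (t • a) (|t| * K) := by
  intro i hi y hy
  rw [iteratedFDeriv_const_smul_apply (contDiffAt_of_contDiffOn hs ha hy i), norm_smul,
    Real.norm_eq_abs]
  exact mul_le_mul_of_nonneg_left (h i hi y hy) (abs_nonneg t)

/-- Makes the values of jets range in proper, hence separable, spaces, as the covering by countably
many classes requires. -/
theorem finiteDimensional_continuousMultilinearMap [FiniteDimensional ℝ E] [FiniteDimensional ℝ V]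
    (i : ℕ) : FiniteDimensional ℝ (E [×i]→L[ℝ] V) :=
  FiniteDimensional.of_injective
    (ContinuousMultilinearMap.toMultilinearMapLinear :
      (E [×i]→L[ℝ] V) →ₗ[ℝ] MultilinearMap ℝ (fun _ : Fin i => E) V)
    ContinuousMultilinearMap.toMultilinearMap_injective

variable [CompleteSpace V]

/-- Termwise differentiation, by induction on the order. Differentiating the series of `i`-th
derivatives uses a summable bound on the `(i + 1)`-st, whence `p + 1` in the hypothesis. -/
theorem iteratedFDeriv_tsum_of_isPreconnected {s : Set E} (hs : IsOpen s) (hc : IsPreconnected s)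
    {a : ℕ → E → V} (ha : ∀ k, ContDiffOn ℝ ∞ (a k) s) {u : ℕ → ℝ} (hu : Summable u) {p : ℕ}
    (hb : ∀ k, JetBound (p + 1) s (a k) (u k)) :
    ∀ i ≤ p, ∀ y ∈ s,
      iteratedFDeriv ℝ i (fun z => ∑' k, a k z) y = ∑' k, iteratedFDeriv ℝ i (a k) y ∧
      DifferentiableAt ℝ (iteratedFDeriv ℝ i (fun z => ∑' k, a k z)) y := by
  have hsum : ∀ i ≤ p + 1, ∀ y ∈ s, Summable fun k => iteratedFDeriv ℝ i (a k) y :=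
    fun i hi y hy => Summable.of_norm_bounded hu fun k => hb k i hi y hy
  have hd : ∀ i ≤ p, ∀ y ∈ s, HasFDerivAt (fun z => ∑' k, iteratedFDeriv ℝ i (a k) z)
      (∑' k, fderiv ℝ (iteratedFDeriv ℝ i (a k)) y) y := by
    intro i hi y hy
    refine hasFDerivAt_tsum_of_isPreconnected hu hs hc (fun k z hz => ?_) (fun k z hz => ?_) hy
      (hsum i (by omega) y hy) hy
    · exact (((ha k).contDiffAt (hs.mem_nhds hz)).differentiableAt_iteratedFDeriv
        (by exact_mod_cast ENat.natCast_lt_top i)).hasFDerivAt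
    · rw [norm_fderiv_iteratedFDeriv]
      exact hb k (i + 1) (by omega) z hz
  have key : ∀ i ≤ p, ∀ y ∈ s,
      iteratedFDeriv ℝ i (fun z => ∑' k, a k z) y = ∑' k, iteratedFDeriv ℝ i (a k) y := by
    intro i
    induction i with
    | zero =>
      intro _ y _
      simp only [iteratedFDeriv_zero_eq_comp, Function.comp_apply]
      exact (continuousMultilinearCurryFin0 ℝ E V).symm.toContinuousLinearEquiv.map_tsum
    | succ i ih =>
      intro hi y hy
      simp only [iteratedFDeriv_succ_eq_comp_left, Function.comp_apply]
      have e : iteratedFDeriv ℝ i (fun z => ∑' k, a k z) =ᶠ[𝓝 y]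
          fun z => ∑' k, iteratedFDeriv ℝ i (a k) z :=
        Filter.eventuallyEq_of_mem (hs.mem_nhds hy) fun z hz => ih (by omega) z hz
      rw [e.fderiv_eq, (hd i (by omega) y hy).fderiv]
      exact (continuousMultilinearCurryLeftEquiv ℝ (fun _ : Fin (i + 1) => E)
        V).symm.toContinuousLinearEquiv.map_tsum
  intro i hi y hy
  refine ⟨key i hi y hy, ?_⟩
  have e : iteratedFDeriv ℝ i (fun z => ∑' k, a k z) =ᶠ[𝓝 y]
      fun z => ∑' k, iteratedFDeriv ℝ i (a k) z :=
    Filter.eventuallyEq_of_mem (hs.mem_nhds hy) fun z hz => key i hi z hz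
  exact ((hd i hi y hy).congr_of_eventuallyEq e).differentiableAt

/-- A series of smooth functions whose terms decay in ever stronger seminorms is smooth. -/
theorem exists_hasSum_of_jetBound {s : Set E} (hs : IsOpen s) (hc : IsPreconnected s)
    {a : ℕ → E → V} (ha : ∀ k, ContDiffOn ℝ ∞ (a k) s) {u : ℕ → ℝ} (hu : Summable u) {N : ℕ}
    (hb : ∀ k, JetBound (N + 1 + k) s (a k) (u k)) :
    ∃ A : E → V, ContDiffOn ℝ ∞ A s ∧ JetBound N s A (∑' k, u k) ∧
      ∀ y ∈ s, HasSum (fun k => a k y) (A y) := by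
  have hsum : ∀ y ∈ s, Summable fun k => a k y := fun y hy =>
    Summable.of_norm_bounded hu fun k => by
      simpa using hb k 0 (by omega) y hy
  refine ⟨fun z => ∑' k, a k z, ?_, ?_, fun y hy => (hsum y hy).hasSum⟩
  · refine contDiffOn_infty.2 fun p => ?_
    -- The term of index `k` is controlled only to order `N + 1 + k`. Terms of index at least `p`
    -- are controlled to order `p + 1`; the others form a finite smooth sum.
    have h1 : ContDiffOn ℝ p (fun z => ∑' k, a (k + p) z) s := by
      refine contDiffOn_of_differentiableOn (n := (p : ℕ∞)) fun i hi => ?_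
      have hi' : i ≤ p := by exact_mod_cast hi
      have h2 := iteratedFDeriv_tsum_of_isPreconnected hs hc (a := fun k => a (k + p))
        (fun k => ha _) ((summable_nat_add_iff p).2 hu)
        (p := p) (fun k => (hb (k + p)).mono (by omega) subset_rfl le_rfl) i hi'
      have h3 : DifferentiableOn ℝ (iteratedFDeriv ℝ i fun z => ∑' k, a (k + p) z) s :=
        fun y hy => (h2 y hy).2.differentiableWithinAt
      exact h3.congr fun y hy => iteratedFDerivWithin_of_isOpen i hs hy
    have h2 : ContDiffOn ℝ p (fun z => ∑ k ∈ Finset.range p, a k z) s :=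
      ContDiffOn.sum fun k _ => (ha k).of_le (by exact_mod_cast le_top)
    refine (h2.add h1).congr fun y hy => ?_
    exact ((hsum y hy).sum_add_tsum_nat_add p).symm
  · intro i hi y hy
    rw [(iteratedFDeriv_tsum_of_isPreconnected hs hc ha hu (p := N)
      (fun k => (hb k).mono (by omega) subset_rfl le_rfl) i hi y hy).1]
    exact tsum_of_norm_bounded hu.hasSum fun k => hb k i (by omega) y hy

end Jets

/-- Spaces of smooth functions are separable: they are covered by countably many small balls of any
of their seminorms. -/
theorem exists_countable_classes {E : Type*} [NormedAddCommGroup E] [NormedSpace ℝ E]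
    [FiniteDimensional ℝ E] {V : Type*} [NormedAddCommGroup V] [NormedSpace ℝ V]
    [FiniteDimensional ℝ V] (n : ℕ) {s K : Set E} (hs : IsOpen s) (hK : IsCompact K) (hKs : K ⊆ s)
    {δ : ℝ} (hδ : 0 < δ) :
    ∃ cls : (E → V) → ℕ, ∀ a b, ContDiffOn ℝ ∞ a s → ContDiffOn ℝ ∞ b s → cls a = cls b →
      JetBound n K (a - b) δ := by
  classical
  have := fun i => finiteDimensional_continuousMultilinearMap (E := E) (V := V) i
  have : CompactSpace K := isCompact_iff_compactSpace.1 hK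
  have : ProperSpace E := FiniteDimensional.proper_real E
  have := fun i => FiniteDimensional.proper_real (E [×i]→L[ℝ] V)
  let Y := ∀ i : Fin (n + 1), C(K, E [×i]→L[ℝ] V)
  have : TopologicalSpace.SeparableSpace Y := inferInstance
  have hcont : ∀ a : E → V, ContDiffOn ℝ ∞ a s → ∀ i : ℕ,
      Continuous fun y : K => iteratedFDeriv ℝ i a y := by
    intro a ha i
    have h := ha.continuousOn_iteratedFDerivWithin (m := i)
      (by exact_mod_cast le_top) hs.uniqueDiffOn
    refine continuousOn_iff_continuous_domRestrict.1 ((h.mono hKs).congr fun y hy => ?_)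
    exact (iteratedFDerivWithin_of_isOpen i hs (hKs hy)).symm
  -- The jet map into a separable metric space. The class of `a` will be the index of a point of a
  -- dense sequence within `δ / 2` of its jet; the value 0 on nonsmooth functions plays no role.
  let J : (E → V) → Y := fun a => if ha : ContDiffOn ℝ ∞ a s then
    fun i => ⟨fun y => iteratedFDeriv ℝ i a y, hcont a ha i⟩ else 0
  have hex : ∀ a, ∃ k : ℕ, dist (J a) (TopologicalSpace.denseSeq Y k) < δ / 2 := by
    intro a
    obtain ⟨_, h, ⟨k, rfl⟩⟩ := (TopologicalSpace.denseRange_denseSeq Y).inter_open_nonempty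
      (ball (J a) (δ / 2)) isOpen_ball ⟨J a, mem_ball_self (by linarith)⟩
    exact ⟨k, by rwa [dist_comm]⟩
  choose cls hcls using hex
  refine ⟨cls, fun a b ha hb hab i hi y hy => ?_⟩
  have h1 : dist (J a) (J b) < δ := by
    have h2 := hcls b
    rw [← hab] at h2
    exact (dist_triangle_right _ _ _).trans_lt (by linarith [hcls a])
  have h2 := (dist_le_pi_dist (J a) (J b) ⟨i, by omega⟩).trans h1.le
  have h3 := (ContinuousMap.dist_apply_le_dist (f := J a ⟨i, by omega⟩) (g := J b ⟨i, by omega⟩)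
    ⟨y, hy⟩).trans h2
  simp only [J, dif_pos ha, dif_pos hb] at h3
  rw [sub_eq_add_neg, iteratedFDeriv_add_apply (contDiffAt_of_contDiffOn hs ha (hKs hy) i)
    (show ContDiffAt ℝ i (-b) y from (contDiffAt_of_contDiffOn hs hb (hKs hy) i).neg),
    iteratedFDeriv_neg_apply, ← sub_eq_add_neg,
    ← dist_eq_norm]
  exact h3

/-! ### Cocycles with values in a finitely generated ideal -/

section Cocycle

variable {G : Type*} [Group G] [TopologicalSpace G]
  {E : Type*} [NormedAddCommGroup E] [NormedSpace ℝ E]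
  {V : Type*} [NormedAddCommGroup V] [NormedSpace ℝ V]

/-- `F` is a cocycle for a local action `ψ` of `G` on the ball of radius `R`, with values in the
functions `y ↦ m y (a y)`, and `act` is a lift of the action to the coefficients `a` that is
locally equicontinuous on smooth functions. -/
structure IsLocalCocycle (c : E) (R : ℝ) (m : E → V →L[ℝ] ℝ) (ψ : G → E → E)
    (act : G → (E → V) → E → V) (F : G → E → ℝ) : Prop where
  one : ∀ y ∈ ball c R, F 1 y = 0
  continuous : ∀ y ∈ ball c R, Continuous fun g => F g y
  exists_eq : ∀ g, ∃ a, ContDiffOn ℝ ∞ a (ball c R) ∧ ∀ y ∈ ball c R, F g y = m y (a y)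
  local_action : ∀ r r', r < r' → r' ≤ R → ∀ᶠ g in 𝓝 (1 : G), ∀ y ∈ ball c r,
    ψ g y ∈ ball c r' ∧ (∀ k, F (g * k) y = F g y + F k (ψ g y)) ∧
      ∀ a, m y (act g a y) = m (ψ g y) (a (ψ g y))
  act_bound : ∀ r r', r < r' → r' ≤ R → ∃ W ∈ 𝓝 (1 : G), ∀ n, ∃ C > 0, ∀ g ∈ W, ∀ a,
    ContDiffOn ℝ ∞ a (ball c r') → ContDiffOn ℝ ∞ (act g a) (ball c r) ∧
      ∀ K ≥ 0, JetBound n (ball c r') a K → JetBound n (ball c r) (act g a) (C * K)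

/-- `f` is, on the ball of radius `r`, of the form `m y (a y)` with the derivatives of `a` up to
the order `n` bounded by `K`. -/
def HasBoundedLift (m : E → V →L[ℝ] ℝ) (n : ℕ) (s : Set E) (f : E → ℝ) (K : ℝ) : Prop :=
  ∃ a, ContDiffOn ℝ ∞ a s ∧ JetBound n s a K ∧ ∀ y ∈ s, f y = m y (a y)

theorem HasBoundedLift.mono {m : E → V →L[ℝ] ℝ} {n n' : ℕ} {s s' : Set E} {f : E → ℝ} {K K' : ℝ}
    (h : HasBoundedLift m n s f K) (hn : n' ≤ n) (hs : s' ⊆ s) (hK : K ≤ K') :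
    HasBoundedLift m n' s' f K' := by
  obtain ⟨a, h1, h2, h3⟩ := h
  exact ⟨a, h1.mono hs, h2.mono hn hs hK, fun y hy => h3 y (hs hy)⟩

theorem HasBoundedLift.add {m : E → V →L[ℝ] ℝ} {n : ℕ} {s : Set E} (hs : IsOpen s) {f f' : E → ℝ}
    {K K' : ℝ} (h : HasBoundedLift m n s f K) (h' : HasBoundedLift m n s f' K') :
    HasBoundedLift m n s (f + f') (K + K') := by
  obtain ⟨a, h1, h2, h3⟩ := h
  obtain ⟨b, k1, k2, k3⟩ := h'
  exact ⟨a + b, h1.add k1, h2.add hs h1 k1 k2, fun y hy => by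
    rw [Pi.add_apply, Pi.add_apply, map_add, h3 y hy, k3 y hy]⟩

theorem HasBoundedLift.const_smul {m : E → V →L[ℝ] ℝ} {n : ℕ} {s : Set E} (hs : IsOpen s)
    {f : E → ℝ} {K : ℝ} (h : HasBoundedLift m n s f K) (t : ℝ) :
    HasBoundedLift m n s (t • f) (|t| * K) := by
  obtain ⟨a, h1, h2, h3⟩ := h
  exact ⟨t • a, h1.const_smul t, h2.const_smul hs h1 t, fun y hy => by
    rw [Pi.smul_apply, Pi.smul_apply, map_smul, h3 y hy]⟩

namespace IsLocalCocycle

variable {c : E} {R : ℝ} {m : E → V →L[ℝ] ℝ} {ψ : G → E → E}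
    {act : G → (E → V) → E → V} {F : G → E → ℝ}

/-- Baire category. Sort the group elements into countably many classes according to their
coefficients, two members of a class having coefficients that are close. The closure of some class
has interior, and for `t`, `g₀` in that class F(g₀⁻¹t) = g₀⁻¹·(F(t) − F(g₀)) has small coefficients.
-/
theorem eventually_mem_closure [IsTopologicalGroup G] [BaireSpace G]
    [FiniteDimensional ℝ E] [FiniteDimensional ℝ V]
    (h : IsLocalCocycle c R m ψ act F) {r : ℝ} (hr : r < R) (n : ℕ) {δ : ℝ} (hδ : 0 < δ) :
    ∀ᶠ g in 𝓝 (1 : G), g ∈ closure {g | HasBoundedLift m n (ball c r) (F g) δ} := by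
  have : ProperSpace E := FiniteDimensional.proper_real E
  set r₁ := (r + R) / 2 with hr₁
  have h1 : r < r₁ := by rw [hr₁]; linarith
  have h2 : r₁ < R := by rw [hr₁]; linarith
  obtain ⟨W, hW, hWC⟩ := h.act_bound r r₁ h1 h2.le
  obtain ⟨C, hC, hC'⟩ := hWC n
  have hloc := h.local_action r r₁ h1 h2.le
  choose a ha ha' using h.exists_eq
  obtain ⟨cls, hcls⟩ := exists_countable_classes (V := V) n (isOpen_ball (x := c) (ε := R))
    (isCompact_closedBall c r₁) (closedBall_subset_ball h2) (div_pos hδ hC)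
  have hinv : ∀ᶠ g in 𝓝 (1 : G), g⁻¹ ∈ W ∧ ∀ y ∈ ball c r,
      ψ g⁻¹ y ∈ ball c r₁ ∧ (∀ k, F (g⁻¹ * k) y = F g⁻¹ y + F k (ψ g⁻¹ y)) ∧
      ∀ a, m y (act g⁻¹ a y) = m (ψ g⁻¹ y) (a (ψ g⁻¹ y)) := by
    have ht : Tendsto (fun g : G => g⁻¹) (𝓝 1) (𝓝 1) := by
      simpa using (continuous_inv (G := G)).tendsto 1
    exact ht.eventually (Filter.Eventually.and hW hloc)
  obtain ⟨U, hU, hUo, hU1⟩ := eventually_nhds_iff.1 hinv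
  let T : ℕ → Set G := fun j => {g | g ∈ U ∧ cls (a g) = j}
  -- The bounds on the action hold only on `U`; its complement is added so that the closed sets
  -- cover all of `G`.
  let f : Option ℕ → Set G := fun o => o.elim Uᶜ fun j => closure (T j)
  have hd : Dense (⋃ o, interior (f o)) := by
    refine dense_iUnion_interior_of_closed (fun o => ?_) ?_
    · cases o
      · exact hUo.isClosed_compl
      · exact isClosed_closure
    · refine eq_univ_of_forall fun g => mem_iUnion.2 ?_
      by_cases hg : g ∈ U
      · exact ⟨some (cls (a g)), subset_closure ⟨hg, rfl⟩⟩
      · exact ⟨none, hg⟩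
  obtain ⟨g₁, hg₁, hg₁'⟩ := hd.inter_open_nonempty U hUo ⟨1, hU1⟩
  obtain ⟨o, ho⟩ := mem_iUnion.1 hg₁'
  cases o with
  | none => exact absurd hg₁ (interior_subset ho)
  | some j =>
    obtain ⟨g₀, hg₀, hg₀T⟩ := mem_closure_iff.1 (interior_subset ho) _ isOpen_interior ho
    have hev : ∀ᶠ g in 𝓝 (1 : G), g₀ * g ∈ interior (closure (T j)) := by
      have ht : Tendsto (fun g : G => g₀ * g) (𝓝 1) (𝓝 g₀) := by
        simpa using (continuous_const_mul g₀).tendsto 1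
      exact ht.eventually (isOpen_interior.mem_nhds hg₀)
    filter_upwards [hev] with g hg
    have hmaps : MapsTo (fun t : G => g₀⁻¹ * t) (T j)
        {g | HasBoundedLift m n (ball c r) (F g) δ} := by
      rintro t ⟨htU, htj⟩
      obtain ⟨hw, hy⟩ := hU g₀ hg₀T.1
      have hab := hcls (a t) (a g₀) (ha t) (ha g₀) (htj.trans hg₀T.2.symm)
      have hsm : ContDiffOn ℝ ∞ (a t - a g₀) (ball c r₁) :=
        ((ha t).sub (ha g₀)).mono (ball_subset_ball h2.le)
      obtain ⟨k1, k2⟩ := hC' _ hw _ hsm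
      refine ⟨_, k1, (k2 _ (div_pos hδ hC).le (hab.mono le_rfl ball_subset_closedBall le_rfl)).mono
        le_rfl subset_rfl (mul_div_cancel₀ δ hC.ne').le, fun y hy' => ?_⟩
      obtain ⟨l1, l2, l3⟩ := hy y hy'
      -- The cocycle identity at g₀⁻¹g₀ = 1 expresses F(g₀⁻¹) through F(g₀).
      have l4 := l2 g₀
      rw [inv_mul_cancel, h.one y (ball_subset_ball (h1.trans h2).le hy')] at l4
      have l5 := ball_subset_ball h2.le l1
      rw [l3, l2 t, Pi.sub_apply, map_sub, ← ha' t _ l5, ← ha' g₀ _ l5]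
      linarith
    have := map_mem_closure (continuous_const_mul g₀⁻¹) (interior_subset hg) hmaps
    rwa [inv_mul_cancel_left] at this

/-- Removes the closure by successive approximation: g is an infinite product s₀s₁s₂⋯ of elements
with rapidly decreasing coefficients, and F(g) is the sum of the translates of the F(s_k) by the
partial products. -/
theorem eventually_hasBoundedLift [IsTopologicalGroup G] [BaireSpace G] [FirstCountableTopology G]
    [T2Space G] [FiniteDimensional ℝ E] [FiniteDimensional ℝ V]
    (h : IsLocalCocycle c R m ψ act F) {r : ℝ} (hr : r < R) (N : ℕ) {δ : ℝ} (hδ : 0 < δ) :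
    ∀ᶠ g in 𝓝 (1 : G), HasBoundedLift m N (ball c r) (F g) δ := by
  have : CompleteSpace V := FiniteDimensional.complete ℝ V
  set r₁ := (r + R) / 2 with hr₁
  have h1 : r < r₁ := by rw [hr₁]; linarith
  have h2 : r₁ < R := by rw [hr₁]; linarith
  obtain ⟨W, hW, hWC⟩ := h.act_bound r r₁ h1 h2.le
  choose C hC hC' using hWC
  obtain ⟨V₁, hV₁, hV₁'⟩ : ∃ V₁ ∈ 𝓝 (1 : G), ∀ g ∈ V₁, ∀ t ∈ V₁, g * t⁻¹ ∈ W ∧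
      ∀ y ∈ ball c r, ψ (g * t⁻¹) y ∈ ball c r₁ ∧
        (∀ k, F (g * t⁻¹ * k) y = F (g * t⁻¹) y + F k (ψ (g * t⁻¹) y)) ∧
        ∀ a, m y (act (g * t⁻¹) a y) = m (ψ (g * t⁻¹) y) (a (ψ (g * t⁻¹) y)) := by
    have ht : Tendsto (fun p : G × G => p.1 * p.2⁻¹) (𝓝 1 ×ˢ 𝓝 1) (𝓝 1) := by
      have : Continuous fun p : G × G => p.1 * p.2⁻¹ := by fun_prop
      have := this.tendsto (1, 1)
      rwa [nhds_prod_eq, inv_one, mul_one] at this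
    have h3 := ht.eventually (Filter.Eventually.and hW (h.local_action r r₁ h1 h2.le))
    obtain ⟨s, hs, hs'⟩ := mem_prod_self_iff.1 h3
    exact ⟨s, hs, fun g hg t ht => hs' (mk_mem_prod hg ht)⟩
  obtain ⟨B, hB⟩ := (𝓝 (1 : G)).exists_antitone_basis
  -- The radii sum to `δ`, the division by `C` absorbs the translation by a partial product, and the
  -- growing order of the jets makes the sum of coefficients smooth.
  let D : ℕ → Set G := fun k =>
    {g | HasBoundedLift m (N + 1 + k) (ball c r₁) (F g) (δ / 2 / 2 ^ k / C (N + 1 + k))}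
  -- Inclusion in `V₁` keeps the partial products in `W`; inclusion in `B k` makes the remainders
  -- tend to 1.
  have hO : ∀ k, ∃ O : Set G, IsOpen O ∧ 1 ∈ O ∧ O ⊆ closure (D k) ∧ O ⊆ V₁ ∧ O ⊆ B k := by
    intro k
    have h3 := h.eventually_mem_closure h2 (N + 1 + k)
      (δ := δ / 2 / 2 ^ k / C (N + 1 + k)) (by have := hC (N + 1 + k); positivity)
    obtain ⟨O, hO, hOo, hO1⟩ := mem_nhds_iff.1
      (inter_mem (inter_mem h3 hV₁) (hB.1.mem_of_mem (i := k) trivial))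
    exact ⟨O, hOo, hO1, fun g hg => (hO hg).1.1, fun g hg => (hO hg).1.2, fun g hg => (hO hg).2⟩
  choose O hOo hO1 hOD hOV hOB using hO
  have hstep : ∀ k (τ : G), ∃ s, τ ∈ O k → s ∈ D k ∧ s⁻¹ * τ ∈ O (k + 1) := by
    intro k τ
    by_cases hτ : τ ∈ O k
    · have ho : IsOpen {s : G | s⁻¹ * τ ∈ O (k + 1)} := (hOo (k + 1)).preimage (by fun_prop)
      obtain ⟨s, hs, hsD⟩ := mem_closure_iff.1 (hOD k hτ) _ ho
        (show τ⁻¹ * τ ∈ O (k + 1) by rw [inv_mul_cancel]; exact hO1 _)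
      exact ⟨s, fun _ => ⟨hsD, hs⟩⟩
    · exact ⟨1, fun h => absurd h hτ⟩
  choose s hs using hstep
  filter_upwards [(hOo 0).mem_nhds (hO1 0)] with g hg
  -- The remainders: g = s₀⋯s_{k-1} τ_k, so that the partial product is `σ k` = g τ_k⁻¹.
  let τ : ℕ → G := fun k => Nat.rec g (fun k t => (s k t)⁻¹ * t) k
  have hτs : ∀ k, τ (k + 1) = (s k (τ k))⁻¹ * τ k := fun k => rfl
  have hτ : ∀ k, τ k ∈ O k := by
    intro k
    induction k with
    | zero => exact hg
    | succ k ih => rw [hτs]; exact (hs k _ ih).2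
  have hτ1 : Tendsto τ atTop (𝓝 1) := hB.tendsto fun k => hOB k (hτ k)
  choose a ha hab haF using fun k => (hs k _ (hτ k)).1
  let σ : ℕ → G := fun k => g * (τ k)⁻¹
  have hσs : ∀ k, σ (k + 1) = σ k * s k (τ k) := fun k => by
    simp only [σ, hτs]; group
  have hσ := fun k => hV₁' g (hOV 0 hg) (τ k) (hOV k (hτ k))
  have hb := fun k => hC' (N + 1 + k) (σ k) (hσ k).1 (a k) (ha k)
  have hu : HasSum (fun k : ℕ => δ / 2 / 2 ^ k) δ := hasSum_geometric_two' δ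
  obtain ⟨A, hA, hAb, hAs⟩ := exists_hasSum_of_jetBound (N := N) (isOpen_ball (x := c) (ε := r))
    (convex_ball c r).isPreconnected (fun k => (hb k).1) hu.summable fun k =>
      ((hb k).2 _ (by have := hC (N + 1 + k); positivity) (hab k)).mono le_rfl subset_rfl
        (mul_div_cancel₀ _ (hC (N + 1 + k)).ne').le
  refine ⟨A, hA, hu.tsum_eq ▸ hAb, fun y hy => ?_⟩
  have hyR := ball_subset_ball (h1.trans h2).le hy
  have hF : ∀ k, F (σ k) y = ∑ j ∈ Finset.range k, m y (act (σ j) (a j) y) := by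
    intro k
    induction k with
    | zero =>
      have : σ 0 = 1 := mul_inv_cancel g
      rw [this, Finset.sum_range_zero, h.one y hyR]
    | succ k ih =>
      obtain ⟨l1, l2, l3⟩ := (hσ k).2 y hy
      rw [Finset.sum_range_succ, ← ih, hσs]
      exact (l2 _).trans (congrArg _ ((haF k _ l1).trans (l3 (a k)).symm))
  have hlim : Tendsto (fun k => F (σ k) y) atTop (𝓝 (F g y)) := by
    have : Tendsto σ atTop (𝓝 g) := by
      simpa using tendsto_const_nhds.mul hτ1.inv
    exact ((h.continuous y hyR).tendsto g).comp this
  refine tendsto_nhds_unique hlim ?_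
  have := ((hAs y hy).map (m y) (m y).continuous).tendsto_sum_nat
  exact this.congr fun k => (hF k).symm

/-- The derivative of a cocycle along a sequence of iterated square roots has smooth
coefficients. -/
theorem exists_derivative_eq [IsTopologicalGroup G] [BaireSpace G] [FirstCountableTopology G]
    [T2Space G] [FiniteDimensional ℝ E] [FiniteDimensional ℝ V]
    (h : IsLocalCocycle c R m ψ act F) {s : ℕ → G} (hs : ∀ n, s (n + 1) * s (n + 1) = s n)
    (hs1 : Tendsto s atTop (𝓝 1))
    (hdiff : ∀ r r', r < r' → r' ≤ R → ∀ N, ∃ C > 0, ∀ᶠ n in atTop, ∀ a,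
      ContDiffOn ℝ ∞ a (ball c r') → ∀ K ≥ 0, JetBound (N + 1) (ball c r') a K →
        ContDiffOn ℝ ∞ (act (s n) a - a) (ball c r) ∧
        JetBound N (ball c r) (act (s n) a - a) (C * (1 / 2) ^ n * K))
    {D : E → ℝ} (hD : ∀ y ∈ ball c R, Tendsto (fun n => 2 ^ n * F (s n) y) atTop (𝓝 (D y)))
    {r : ℝ} (hr : r < R) :
    ∃ a, ContDiffOn ℝ ∞ a (ball c r) ∧ ∀ y ∈ ball c r, D y = m y (a y) := by
  have : CompleteSpace V := FiniteDimensional.complete ℝ V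
  obtain ⟨r₁, hr₁, hr₁'⟩ := exists_between hr
  obtain ⟨r₂, hr₂, hr₂'⟩ := exists_between hr₁'
  let Δ : ℕ → E → ℝ := fun n y => F (s n) (ψ (s n) y) - F (s n) y
  -- Since s_n is the square of s_{n+1}, this says F(s_n) = 2F(s_{n+1}) + Δ_{n+1}.
  have hsq : ∀ {ρ ρ' : ℝ}, ρ < ρ' → ρ' ≤ R → ∀ᶠ n in atTop, ∀ y ∈ ball c ρ,
      F (s n) y = F (s (n + 1)) y + F (s (n + 1)) (ψ (s (n + 1)) y) := by
    intro ρ ρ' h1 h2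
    have h3 := (hs1.comp (tendsto_add_atTop_nat 1)).eventually (h.local_action ρ ρ' h1 h2)
    filter_upwards [h3] with n hn y hy
    have h4 := (hn y hy).2.1 (s (n + 1))
    simp only [Function.comp_apply] at h4
    rw [hs] at h4
    exact h4
  -- The coefficients of `Δ n` are `act (s n) a - a`: a factor of order 2^(-n) is gained and one
  -- derivative is lost.
  have hΔ : ∀ {ρ ρ' : ℝ}, ρ < ρ' → ρ' ≤ R → ∀ N, ∃ C > 0, ∀ᶠ n in atTop, ∀ K ≥ 0,
      HasBoundedLift m (N + 1) (ball c ρ') (F (s n)) K →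
      HasBoundedLift m N (ball c ρ) (Δ n) (C * (1 / 2) ^ n * K) := by
    intro ρ ρ' h1 h2 N
    obtain ⟨C, hC, hC'⟩ := hdiff ρ ρ' h1 h2 N
    refine ⟨C, hC, ?_⟩
    filter_upwards [hC', hs1.eventually (h.local_action ρ ρ' h1 h2)] with n hn hl K hK
    rintro ⟨a, ha, hab, haF⟩
    obtain ⟨k1, k2⟩ := hn a ha K hK hab
    refine ⟨_, k1, k2, fun y hy => ?_⟩
    obtain ⟨l1, l2, l3⟩ := hl y hy
    rw [Pi.sub_apply, map_sub, l3, ← haF _ l1, ← haF _ (ball_subset_ball h1.le hy)]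
  -- the cocycle decays geometrically
  have claim1 : ∀ N, ∃ C > 0, ∀ᶠ n in atTop,
      HasBoundedLift m N (ball c r₁) (F (s n)) (C * (2 / 3) ^ n) := by
    intro N
    obtain ⟨C₁, hC₁, hC₁'⟩ := hΔ hr₂ hr₂'.le N
    -- `Δ` is estimated from the uniform bound 1 at order `N + 1`, not from the induction
    -- hypothesis, so the loss of a derivative and of radius occurs only once.
    have hbd := hs1.eventually (h.eventually_hasBoundedLift hr₂' (N + 1) one_pos)
    obtain ⟨n₀, hn₀⟩ := eventually_atTop.1 (hC₁'.and (hbd.and (hsq hr₂ hr₂'.le)))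
    -- The second summand reproduces the bound 1 at `n₀`; the first leaves room for the error when
    -- the halving factor 1/2 is weakened to 2/3.
    refine ⟨3 * C₁ + (3 / 2) ^ n₀, by positivity, eventually_atTop.2 ⟨n₀, fun n hn => ?_⟩⟩
    induction n, hn using Nat.le_induction with
    | base =>
      refine ((hn₀ n₀ le_rfl).2.1).mono (by omega) (ball_subset_ball hr₂.le) ?_
      have h1 : ((3 : ℝ) / 2) ^ n₀ * (2 / 3) ^ n₀ = 1 := by rw [← mul_pow]; norm_num
      have h2 : 0 < 3 * C₁ * (2 / 3) ^ n₀ := by positivity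
      rw [add_mul]; linarith
    | succ n hn ih =>
      have e1 := (hn₀ (n + 1) (by omega)).1 1 zero_le_one (hn₀ (n + 1) (by omega)).2.1
      have e2 := (ih.const_smul isOpen_ball (1 / 2)).add isOpen_ball
        (e1.const_smul isOpen_ball (-(1 / 2)))
      obtain ⟨a, ha, hab, haF⟩ := e2
      refine ⟨a, ha, hab.mono le_rfl subset_rfl ?_, fun y hy => ?_⟩
      · have h3 : ((1 : ℝ) / 2) ^ n ≤ (2 / 3) ^ n :=
          pow_le_pow_left₀ (by norm_num) (by norm_num) n
        have h4 : (0 : ℝ) ≤ (3 / 2) ^ n₀ * (2 / 3) ^ n := by positivity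
        have h5 := mul_le_mul_of_nonneg_left h3 hC₁.le
        have h6 : (0 : ℝ) ≤ C₁ * (2 / 3) ^ n := by positivity
        rw [abs_neg, abs_of_pos (by norm_num : (0 : ℝ) < 1 / 2), pow_succ, pow_succ]
        linarith
      · rw [← haF y hy]
        have := (hn₀ n hn).2.2 y hy
        simp only [Pi.add_apply, Pi.smul_apply, smul_eq_mul, Δ]
        linarith
  let H : ℕ → E → ℝ := fun n y => 2 ^ n * F (s n) y
  -- H_{n+1} − H_n = −2^n Δ_{n+1}: the factor 2^n cancels the gain in `hΔ`, and the decay from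
  -- `claim1` remains.
  have claim2 : ∀ N, ∃ C > 0, ∀ᶠ n in atTop,
      HasBoundedLift m N (ball c r) (H (n + 1) - H n) (C * (2 / 3) ^ n) := by
    intro N
    obtain ⟨C₁, hC₁, hC₁'⟩ := hΔ hr₁ hr₁'.le N
    obtain ⟨C₂, hC₂, hC₂'⟩ := claim1 (N + 1)
    refine ⟨C₁ * C₂, by positivity, ?_⟩
    have t1 := tendsto_add_atTop_nat 1
    filter_upwards [t1.eventually hC₁', t1.eventually hC₂', hsq hr₁ hr₁'.le] with n h1 h2 h3
    obtain ⟨a, ha, hab, haF⟩ :=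
      ((h1 _ (by positivity) h2).const_smul isOpen_ball (-(2 ^ n)))
    refine ⟨a, ha, hab.mono le_rfl subset_rfl ?_, fun y hy => ?_⟩
    · rw [abs_neg, abs_of_pos (by positivity), pow_succ, pow_succ]
      have h4 : (2 : ℝ) ^ n * (1 / 2) ^ n = 1 := by rw [← mul_pow]; norm_num
      have h5 : (2 : ℝ) ^ n * (C₁ * ((1 / 2) ^ n * (1 / 2)) * (C₂ * ((2 / 3) ^ n * (2 / 3)))) =
        (2 ^ n * (1 / 2) ^ n) * (C₁ * C₂ * (2 / 3) ^ n * (1 / 3)) := by ring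
      rw [h5, h4]
      have : 0 < C₁ * C₂ * (2 / 3) ^ n := by positivity
      linarith
    · rw [← haF y hy]
      simp only [Pi.sub_apply, Pi.smul_apply, smul_eq_mul, Δ, H]
      rw [h3 y hy, pow_succ]
      ring
  have claim3 : ∀ N, ∀ ε > 0, ∃ n₀, ∀ n ≥ n₀, ∀ k,
      HasBoundedLift m N (ball c r) (H (n + k) - H n) ε := by
    intro N ε hε
    obtain ⟨C, hC, hC'⟩ := claim2 N
    have ht : Tendsto (fun n : ℕ => 3 * C * (2 / 3 : ℝ) ^ n) atTop (𝓝 0) := by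
      simpa using (tendsto_pow_atTop_nhds_zero_of_lt_one (r := (2 / 3 : ℝ)) (by norm_num)
        (by norm_num)).const_mul (3 * C)
    obtain ⟨n₀, hn₀⟩ := eventually_atTop.1 (hC'.and (ht.eventually_le_const hε))
    refine ⟨n₀, fun n hn k => ?_⟩
    have key : ∀ k, HasBoundedLift m N (ball c r) (H (n + k) - H n)
        (3 * C * (2 / 3) ^ n - 3 * C * (2 / 3) ^ (n + k)) := by
      intro k
      induction k with
      | zero =>
        refine ⟨0, contDiffOn_const, fun i _ y _ => ?_, fun y _ => by simp⟩
        simp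
      | succ k ih =>
        have h1 := ih.add isOpen_ball (hn₀ (n + k) (by omega)).1
        rw [sub_add_sub_cancel'] at h1
        refine h1.mono le_rfl subset_rfl (le_of_eq ?_)
        rw [← add_assoc, pow_succ]
        ring
    refine (key k).mono le_rfl subset_rfl ?_
    have h2 := (hn₀ n hn).2
    have : 0 < 3 * C * (2 / 3 : ℝ) ^ (n + k) := by positivity
    linarith
  -- The threshold in `claim3` depends on the order. A subsequence `φ` is chosen whose `j`-th
  -- increment is small to order `j + 1`, as smoothness of the sum demands.
  choose n₁ hn₁ using fun j : ℕ => claim3 (0 + 1 + j) ((1 : ℝ) / 2 / 2 ^ j) (by positivity)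
  let φ : ℕ → ℕ := fun j => ∑ i ∈ Finset.range (j + 1), (n₁ i + 1)
  have hφs : ∀ j, φ (j + 1) = φ j + (n₁ (j + 1) + 1) := fun j => Finset.sum_range_succ _ _
  have hφ1 : ∀ j, n₁ j ≤ φ j := fun j => by
    have := Finset.single_le_sum (f := fun i => n₁ i + 1) (fun i _ => Nat.zero_le _)
      (Finset.self_mem_range_succ j)
    exact (Nat.le_succ _).trans this
  have hφt : Tendsto φ atTop atTop :=
    (strictMono_nat_of_lt_succ fun j => by rw [hφs]; omega).tendsto_atTop
  choose b hb hbb hbF using fun j => hn₁ j (φ j) (hφ1 j) (n₁ (j + 1) + 1)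
  have hu : HasSum (fun k : ℕ => (1 : ℝ) / 2 / 2 ^ k) 1 := hasSum_geometric_two' 1
  obtain ⟨A, hA, -, hAs⟩ := exists_hasSum_of_jetBound (N := 0) (isOpen_ball (x := c) (ε := r))
    (convex_ball c r).isPreconnected hb hu.summable hbb
  -- The telescoping sum gives D − H(φ 0); the initial term has smooth coefficients, with no bound
  -- needed.
  obtain ⟨a₀, ha₀, ha₀F⟩ := h.exists_eq (s (φ 0))
  refine ⟨A + (2 : ℝ) ^ φ 0 • a₀, hA.add ((ha₀.mono (ball_subset_ball hr.le)).const_smul _),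
    fun y hy => ?_⟩
  have hyR := ball_subset_ball hr.le hy
  have hsum : ∀ k, ∑ j ∈ Finset.range k, m y (b j y) = H (φ k) y - H (φ 0) y := by
    intro k
    rw [← Finset.sum_range_sub (fun j => H (φ j) y)]
    refine Finset.sum_congr rfl fun j _ => ?_
    rw [← hbF j y hy, hφs]
    rfl
  have hlim1 : Tendsto (fun k => H (φ k) y - H (φ 0) y) atTop (𝓝 (D y - H (φ 0) y)) :=
    ((hD y hyR).comp hφt).sub_const _
  have hlim2 := ((hAs y hy).map (m y) (m y).continuous).tendsto_sum_nat
  have := tendsto_nhds_unique hlim1 (hlim2.congr hsum)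
  rw [Pi.add_apply, Pi.smul_apply, map_add, map_smul, ← ha₀F y hyR, ← this, smul_eq_mul]
  exact (sub_add_cancel _ _).symm

end IsLocalCocycle

end Cocycle

/-! ### Estimates for the action on smooth functions -/

section ActionEstimates

variable {P : Type*} [NormedAddCommGroup P] [NormedSpace ℝ P]
  {E : Type*} [NormedAddCommGroup E] [NormedSpace ℝ E]
  {V : Type*} [NormedAddCommGroup V] [NormedSpace ℝ V]
  {W : Type*} [NormedAddCommGroup W] [NormedSpace ℝ W]

theorem JetBound.of_isCompact {s K : Set E} (hs : IsOpen s) {f : E → W} (hf : ContDiffOn ℝ ∞ f s)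
    (hK : IsCompact K) (hKs : K ⊆ s) (n : ℕ) : ∃ B ≥ 1, JetBound n K f B := by
  have h : ∀ i : ℕ, ∃ B, ∀ y ∈ K, ‖iteratedFDeriv ℝ i f y‖ ≤ B := by
    intro i
    have h := hf.continuousOn_iteratedFDerivWithin (m := i)
      (by exact_mod_cast le_top) hs.uniqueDiffOn
    obtain ⟨B, hB⟩ := hK.exists_bound_of_continuousOn (h.mono hKs)
    exact ⟨B, fun y hy => by
      rw [← iteratedFDerivWithin_of_isOpen i hs (hKs hy)]; exact hB y hy⟩
  choose B hB using h
  -- The summand 1 gives a bound at least 1, whose powers are then monotone in the exponent.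
  refine ⟨1 + ∑ i ∈ Finset.range (n + 1), |B i|, ?_, fun i hi y hy => ?_⟩
  · exact le_add_of_nonneg_right (Finset.sum_nonneg fun i _ => abs_nonneg _)
  · have h1 := Finset.single_le_sum (f := fun i => |B i|) (fun i _ => abs_nonneg _)
      (Finset.mem_range.2 (Nat.lt_succ_of_le hi))
    have h2 := (hB i y hy).trans (le_abs_self _)
    linarith

/-- The derivatives of `p ↦ Λ p (a (Ψ p))` are controlled by those of `a`. -/
theorem JetBound.clm_apply_comp {s K : Set P} (hs : IsOpen s) (hK : IsCompact K) (hKs : K ⊆ s)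
    {t : Set E} (ht : IsOpen t) {Λ : P → V →L[ℝ] W} (hΛ : ContDiffOn ℝ ∞ Λ s) {Ψ : P → E}
    (hΨ : ContDiffOn ℝ ∞ Ψ s) (hst : MapsTo Ψ s t) (n : ℕ) :
    ∃ C > 0, ∀ a, ContDiffOn ℝ ∞ a t → ∀ M ≥ 0, JetBound n t a M →
      JetBound n K (fun p => Λ p (a (Ψ p))) (C * M) := by
  obtain ⟨B, hB, hB'⟩ := JetBound.of_isCompact hs hΛ hK hKs n
  obtain ⟨D, hD, hD'⟩ := JetBound.of_isCompact hs hΨ hK hKs n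
  refine ⟨∑ j ∈ Finset.range (n + 1), 2 ^ n * B * (n.factorial * D ^ n), ?_,
    fun a ha M hM hab i hi p hp => ?_⟩
  · refine Finset.sum_pos (fun j _ => ?_) ⟨0, by simp⟩
    positivity
  have hcomp : ContDiffOn ℝ ∞ (a ∘ Ψ) s := ha.comp hΨ hst
  rw [← iteratedFDerivWithin_of_isOpen i hs (hKs hp)]
  have key : ∀ j ≤ n, ‖iteratedFDerivWithin ℝ j (a ∘ Ψ) s p‖ ≤ n.factorial * D ^ n * M := by
    intro j hj
    have h1 := norm_iteratedFDerivWithin_comp_le (n := j) ha hΨ (by exact_mod_cast le_top)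
      ht.uniqueDiffOn hs.uniqueDiffOn hst (hKs hp) (C := M) (D := D)
      (fun k hk => by
        rw [iteratedFDerivWithin_of_isOpen k ht (hst (hKs hp))]
        exact hab k (hk.trans hj) _ (hst (hKs hp)))
      (fun k hk hk' => by
        rw [iteratedFDerivWithin_of_isOpen k hs (hKs hp)]
        exact (hD' k (hk'.trans hj) p hp).trans (le_self_pow₀ hD (by omega)))
    refine h1.trans ?_
    have h2 : (j.factorial : ℝ) ≤ n.factorial := by exact_mod_cast Nat.factorial_le hj
    have h3 : D ^ j ≤ D ^ n := pow_le_pow_right₀ hD hj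
    calc (j.factorial : ℝ) * M * D ^ j ≤ n.factorial * M * D ^ n := by gcongr
      _ = n.factorial * D ^ n * M := by ring
  refine (norm_iteratedFDerivWithin_clm_apply hΛ hcomp hs.uniqueDiffOn (hKs hp)
    (by exact_mod_cast le_top)).trans ?_
  rw [Finset.sum_mul]
  refine (Finset.sum_le_sum fun j hj => ?_).trans (Finset.sum_le_sum_of_subset_of_nonneg
    (Finset.range_subset_range.2 (by omega : i + 1 ≤ n + 1)) fun j _ _ => by positivity)
  have hj' : j ≤ i := Nat.lt_succ_iff.1 (Finset.mem_range.1 hj)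
  have h1 : (i.choose j : ℝ) ≤ 2 ^ n := by
    refine le_trans ?_ (pow_le_pow_right₀ one_le_two hi)
    exact_mod_cast Nat.choose_le_two_pow i j
  have h2 : ‖iteratedFDerivWithin ℝ j Λ s p‖ ≤ B := by
    rw [iteratedFDerivWithin_of_isOpen j hs (hKs hp)]
    exact hB' j (hj'.trans hi) p hp
  calc (i.choose j : ℝ) * ‖iteratedFDerivWithin ℝ j Λ s p‖ *
        ‖iteratedFDerivWithin ℝ (i - j) (a ∘ Ψ) s p‖
      ≤ 2 ^ n * B * (n.factorial * D ^ n * M) := by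
        gcongr
        exact key (i - j) (by omega)
    _ = 2 ^ n * B * (n.factorial * D ^ n) * M := by ring

theorem iteratedFDeriv_slice {s : Set (P × E)} (hs : IsOpen s) {A : P × E → W}
    (hA : ContDiffOn ℝ ∞ A s) {u : P} {y : E} (h : (u, y) ∈ s) (i : ℕ) :
    iteratedFDeriv ℝ i (fun z => A (u, z)) y =
      (iteratedFDeriv ℝ i A (u, y)).compContinuousLinearMap
        fun _ => ContinuousLinearMap.inr ℝ P E := by
  have e : ∀ z : E, (ContinuousLinearMap.inr ℝ P E z) + (u, 0) = (u, z) := fun z => by simp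
  have hcont : Continuous fun q : P × E => q + (u, 0) := by fun_prop
  have hs' : IsOpen ((fun q : P × E => q + (u, 0)) ⁻¹' s) := hs.preimage hcont
  have hB : ContDiffOn ℝ ∞ (fun q => A (q + (u, 0))) ((fun q : P × E => q + (u, 0)) ⁻¹' s) :=
    hA.comp (by fun_prop) fun q hq => hq
  have hs'' := hs'.preimage (ContinuousLinearMap.inr ℝ P E).continuous
  have hy : ContinuousLinearMap.inr ℝ P E y ∈ (fun q : P × E => q + (u, 0)) ⁻¹' s := by
    rw [mem_preimage, e]; exact h
  have h1 := (ContinuousLinearMap.inr ℝ P E).iteratedFDerivWithin_comp_right hB hs'.uniqueDiffOn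
    hs''.uniqueDiffOn hy (i := i) (by exact_mod_cast le_top)
  rw [iteratedFDerivWithin_of_isOpen i hs'' hy, iteratedFDerivWithin_of_isOpen i hs' hy,
    iteratedFDeriv_comp_add_right, e] at h1
  have h2 : (fun z => A (u, z)) =
      (fun q : P × E => A (q + (u, 0))) ∘ (ContinuousLinearMap.inr ℝ P E) := by
    funext z
    rw [Function.comp_apply, e]
  rw [h2, h1]

theorem norm_compContinuousLinearMap_inr_le {i : ℕ} (f : (P × E) [×i]→L[ℝ] W) :
    ‖f.compContinuousLinearMap fun _ => ContinuousLinearMap.inr ℝ P E‖ ≤ ‖f‖ := by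
  refine (f.norm_compContinuousLinearMap_le _).trans (mul_le_of_le_one_right (norm_nonneg _) ?_)
  exact Finset.prod_le_one (fun _ _ => norm_nonneg _)
    fun _ _ => ContinuousLinearMap.norm_inr_le_one ℝ P E

theorem JetBound.slice {s t : Set (P × E)} (hs : IsOpen s) {A : P × E → W}
    (hA : ContDiffOn ℝ ∞ A s) (hts : t ⊆ s) {n : ℕ} {K : ℝ} (h : JetBound n t A K) {r : Set E}
    {u : P} (hu : ∀ y ∈ r, (u, y) ∈ t) : JetBound n r (fun y => A (u, y)) K := by
  intro i hi y hy
  rw [iteratedFDeriv_slice hs hA (hts (hu y hy))]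
  exact (norm_compContinuousLinearMap_inr_le _).trans (h i hi _ (hu y hy))

theorem contDiffOn_slice {s : Set (P × E)} {A : P × E → W}
    (hA : ContDiffOn ℝ ∞ A s) {r : Set E} {u : P} (hu : ∀ y ∈ r, (u, y) ∈ s) :
    ContDiffOn ℝ ∞ (fun y => A (u, y)) r :=
  hA.comp (by fun_prop : ContDiff ℝ ∞ fun y : E => (u, y)).contDiffOn hu

/-- Mean value inequality in the parameter, applied to each derivative of `A`: Lipschitz dependence
costs one order. -/
theorem JetBound.slice_sub {s : Set (P × E)} (hs : IsOpen s) {A : P × E → W}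
    (hA : ContDiffOn ℝ ∞ A s) {t : Set P} (ht : Convex ℝ t) {r : Set E} (hts : t ×ˢ r ⊆ s) {n : ℕ}
    {K : ℝ} (h : JetBound (n + 1) (t ×ˢ r) A K) {u u₀ : P} (hu : u ∈ t) (hu₀ : u₀ ∈ t) :
    JetBound n r (fun y => A (u, y) - A (u₀, y)) (K * ‖u - u₀‖) := by
  intro i hi y hy
  have hdiff : ∀ v ∈ t, DifferentiableAt ℝ (iteratedFDeriv ℝ i A) (v, y) := fun v hv =>
    (hA.contDiffAt (hs.mem_nhds (hts ⟨hv, hy⟩))).differentiableAt_iteratedFDeriv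
        (by exact_mod_cast ENat.natCast_lt_top i)
  have hsl : ∀ v ∈ t, ContDiffAt ℝ i (fun y => A (v, y)) y := fun v hv =>
    ((hA.contDiffAt (hs.mem_nhds (hts ⟨hv, hy⟩))).comp y
      (by fun_prop : ContDiff ℝ ∞ fun y : E => (v, y)).contDiffAt).of_le (by exact_mod_cast le_top)
  have hpair : ∀ v, HasFDerivAt (fun v : P => (v, y)) (ContinuousLinearMap.inl ℝ P E) v :=
    fun v => hasFDerivAt_prodMk_left v y
  have hmv : ‖iteratedFDeriv ℝ i A (u, y) - iteratedFDeriv ℝ i A (u₀, y)‖ ≤ K * ‖u - u₀‖ := by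
    refine ht.norm_image_sub_le_of_norm_fderiv_le
      (𝕜 := ℝ) (f := fun v => iteratedFDeriv ℝ i A (v, y))
      (fun v hv => ((hdiff v hv).hasFDerivAt.comp v (hpair v)).differentiableAt)
      (fun v hv => ?_) hu₀ hu
    have h1 := (hdiff v hv).hasFDerivAt.comp v (hpair v)
    refine (congrArg norm h1.fderiv).le.trans ?_
    refine (ContinuousLinearMap.opNorm_comp_le _ _).trans ?_
    refine (mul_le_of_le_one_right (norm_nonneg _)
      (ContinuousLinearMap.norm_inl_le_one ℝ P E)).trans ?_
    rw [norm_fderiv_iteratedFDeriv]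
    exact h (i + 1) (by omega) _ ⟨hv, hy⟩
  have e : (fun y => A (u, y) - A (u₀, y)) = (fun y => A (u, y)) - fun y => A (u₀, y) := rfl
  rw [e, iteratedFDeriv_sub_apply (hsl u hu) (hsl u₀ hu₀),
    iteratedFDeriv_slice hs hA (hts ⟨hu, hy⟩), iteratedFDeriv_slice hs hA (hts ⟨hu₀, hy⟩)]
  refine le_trans (le_of_eq_of_le ?_ (norm_compContinuousLinearMap_inr_le
    (iteratedFDeriv ℝ i A (u, y) - iteratedFDeriv ℝ i A (u₀, y)))) hmv
  rfl

/-- Estimates for the operators `a ↦ Λ u (a (Ψ (u, ·)))` with `u` near `u₀`. -/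
theorem exists_ball_action_estimates [FiniteDimensional ℝ P] [FiniteDimensional ℝ E]
    {s : Set (P × E)} (hs : IsOpen s) {Λ : P → V →L[ℝ] W}
    (hΛ : ContDiffOn ℝ ∞ (fun p : P × E => Λ p.1) s) {Ψ : P × E → E} (hΨ : ContDiffOn ℝ ∞ Ψ s)
    {c : E} {r r' : ℝ} (hst : MapsTo Ψ s (ball c r')) {u₀ : P}
    (hu₀ : ∀ y ∈ closedBall c r, (u₀, y) ∈ s) :
    ∃ ε > 0, (∀ u ∈ ball u₀ ε, ∀ y ∈ ball c r, (u, y) ∈ s) ∧ ∀ n, ∃ C > 0, ∀ a,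
      ContDiffOn ℝ ∞ a (ball c r') → ∀ u ∈ ball u₀ ε,
        ContDiffOn ℝ ∞ (fun y => Λ u (a (Ψ (u, y)))) (ball c r) ∧ ∀ K ≥ 0,
        (JetBound n (ball c r') a K →
          JetBound n (ball c r) (fun y => Λ u (a (Ψ (u, y)))) (C * K)) ∧
        (JetBound (n + 1) (ball c r') a K → JetBound n (ball c r)
          (fun y => Λ u (a (Ψ (u, y))) - Λ u₀ (a (Ψ (u₀, y)))) (C * K * ‖u - u₀‖)) := by
  have : ProperSpace E := FiniteDimensional.proper_real E
  have : ProperSpace P := FiniteDimensional.proper_real P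
  -- The tube lemma makes the parameter neighbourhood uniform in `y`, and compactness of the product
  -- of closed balls gives the constants.
  obtain ⟨U, Y, hU, -, hU₀, hY, hUY⟩ := generalized_tube_lemma (isCompact_singleton (x := u₀))
    (isCompact_closedBall c r) hs (fun p hp => by
      obtain ⟨u, y⟩ := p
      obtain ⟨h1, h2⟩ := hp
      have h1 : u = u₀ := h1
      rw [h1]
      exact hu₀ y h2)
  obtain ⟨ε, hε, hεU⟩ := nhds_basis_closedBall.mem_iff.1 (hU.mem_nhds (hU₀ rfl))
  have hK : closedBall u₀ ε ×ˢ closedBall c r ⊆ s :=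
    fun p hp => hUY ⟨hεU hp.1, hY hp.2⟩
  have hK' : ball u₀ ε ×ˢ ball c r ⊆ closedBall u₀ ε ×ˢ closedBall c r :=
    prod_mono ball_subset_closedBall ball_subset_closedBall
  refine ⟨ε, hε, fun u hu y hy => hK (hK' ⟨hu, hy⟩), fun n => ?_⟩
  obtain ⟨C, hC, hC'⟩ := JetBound.clm_apply_comp hs
    ((isCompact_closedBall u₀ ε).prod (isCompact_closedBall c r)) hK isOpen_ball hΛ hΨ hst (n + 1)
  obtain ⟨D, hD, hD'⟩ := JetBound.clm_apply_comp hs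
    ((isCompact_closedBall u₀ ε).prod (isCompact_closedBall c r)) hK isOpen_ball hΛ hΨ hst n
  refine ⟨C + D, by positivity, fun a ha u hu => ?_⟩
  have hA : ContDiffOn ℝ ∞ (fun p : P × E => Λ p.1 (a (Ψ p))) s := hΛ.clm_apply (ha.comp hΨ hst)
  refine ⟨contDiffOn_slice hA fun y hy => hK (hK' ⟨hu, hy⟩), fun K hKn => ⟨fun h => ?_, fun h => ?_⟩⟩
  · refine (JetBound.slice hs hA hK (hD' a ha K hKn h)
      fun y hy => hK' ⟨hu, hy⟩).mono le_rfl subset_rfl ?_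
    nlinarith
  · refine (JetBound.slice_sub hs hA (convex_ball u₀ ε) (hK'.trans hK)
      ((hC' a ha K hKn h).mono le_rfl hK' le_rfl) hu (mem_ball_self hε)).mono
      le_rfl subset_rfl ?_
    gcongr
    linarith

end ActionEstimates

/-! ### Smooth partitions of unity on paracompact manifolds -/

section Gluing

variable {E : Type*} [NormedAddCommGroup E] [NormedSpace ℝ E] [FiniteDimensional ℝ E]
  {M : Type*} [TopologicalSpace M] [ChartedSpace E M] [IsManifold 𝓘(ℝ, E) ∞ M]
  [T2Space M]

/-- The building block of a partition of unity on a manifold that is paracompact but may have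
uncountably many components. A finite sum of bump functions suffices on a compact set. -/
theorem exists_contMDiff_pos_of_isCompact {K U : Set M} (hK : IsCompact K) (hU : IsOpen U)
    (hKU : K ⊆ U) : ∃ f : SmoothFun E M, (∀ x, 0 ≤ f x) ∧ (∀ x ∈ K, 0 < f x) ∧
      tsupport f ⊆ U := by
  classical
  have h : ∀ x : M, ∃ b : SmoothBumpFunction 𝓘(ℝ, E) x, x ∈ K → tsupport b ⊆ U := by
    intro x
    by_cases hx : x ∈ K
    · obtain ⟨b, -, hb⟩ := (SmoothBumpFunction.nhds_basis_tsupport (I := 𝓘(ℝ, E)) x).mem_iff.1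
        (hU.mem_nhds (hKU hx))
      exact ⟨b, fun _ => hb⟩
    · obtain ⟨b, -⟩ := (SmoothBumpFunction.nhds_basis_tsupport (I := 𝓘(ℝ, E)) x).ex_mem
      exact ⟨b, fun h => absurd h hx⟩
  choose b hb using h
  obtain ⟨t, htK, ht⟩ := hK.elim_nhds_subcover (fun x => Function.support (b x))
    fun x _ => (b x).support_mem_nhds
  refine ⟨⟨fun x => ∑ i ∈ t, b i x, ContMDiff.sum fun i _ => (b i).contMDiff⟩, fun x => ?_,
    fun x hx => ?_, ?_⟩
  · exact Finset.sum_nonneg fun i _ => (b i).nonneg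
  · obtain ⟨i, hi, hx'⟩ := mem_iUnion₂.1 (ht hx)
    exact Finset.sum_pos' (fun i _ => (b i).nonneg)
      ⟨i, hi, lt_of_le_of_ne (b i).nonneg (Ne.symm hx')⟩
  · have hcl : IsClosed (⋃ i ∈ t, tsupport (b i)) :=
      t.finite_toSet.isClosed_biUnion fun i _ => isClosed_tsupport _
    refine (closure_minimal (fun x hx => ?_) hcl).trans
      (iUnion₂_subset fun i hi => hb i (htK i hi))
    obtain ⟨i, hi, hx'⟩ := Finset.exists_ne_zero_of_sum_ne_zero hx
    exact mem_biUnion hi (subset_tsupport _ hx')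

/-- On a paracompact manifold, local smooth sections of a family of convex sets can be glued. -/
theorem exists_contMDiff_forall_mem_convex [ParacompactSpace M] {V : Type*} [NormedAddCommGroup V]
    [NormedSpace ℝ V] {t : M → Set V} (ht : ∀ x, Convex ℝ (t x))
    (hloc : ∀ x, ∃ U ∈ 𝓝 x, ∃ g : M → V, ContMDiffOn 𝓘(ℝ, E) 𝓘(ℝ, V) ∞ g U ∧ ∀ y ∈ U, g y ∈ t y) :
    ∃ g : M → V, ContMDiff 𝓘(ℝ, E) 𝓘(ℝ, V) ∞ g ∧ ∀ x, g x ∈ t x := by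
  have : LocallyCompactSpace M := Manifold.locallyCompact_of_finiteDimensional 𝓘(ℝ, E)
  choose U hU g hg hgt using hloc
  have hW : ∀ x, ∃ K : Set M, K ∈ 𝓝 x ∧ K ⊆ interior (U x) ∧ IsCompact K := fun x =>
    local_compact_nhds (interior_mem_nhds.2 (hU x))
  choose K hK hKU hKc using hW
  obtain ⟨u, huo, huU, huf, huK⟩ := precise_refinement (fun x => interior (K x))
    (fun x => isOpen_interior)
    (eq_univ_of_forall fun x => mem_iUnion.2 ⟨x, mem_interior_iff_mem_nhds.2 (hK x)⟩)
  -- The shrunk closed sets lie in the compact `K x`, hence are compact, and still cover.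
  obtain ⟨v, hvU, hvc, hvu⟩ := exists_iUnion_eq_closed_subset huo (fun x => huf.point_finite x) huU
  have hvK : ∀ x, IsCompact (v x) := fun x =>
    (hKc x).of_isClosed_subset (hvc x) ((hvu x).trans ((huK x).trans interior_subset))
  choose ψ hψ0 hψp hψs using fun x =>
    exists_contMDiff_pos_of_isCompact (E := E) (hvK x) (huo x) (hvu x)
  have hlf : LocallyFinite fun i => Function.support (ψ i) :=
    huf.subset fun i => (subset_tsupport _).trans (hψs i)
  have hfin : ∀ x, (Function.support fun i => ψ i x).Finite := fun x => hlf.point_finite x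
  have hSpos : ∀ x, 0 < ∑ᶠ i, ψ i x := by
    intro x
    obtain ⟨i, hi⟩ := iUnion_eq_univ_iff.1 hvU x
    exact finsum_pos (fun j => hψ0 j x) ⟨i, hψp i x hi⟩ (hfin x)
  have hS : ContMDiff 𝓘(ℝ, E) 𝓘(ℝ, ℝ) ∞ fun x => ∑ᶠ i, ψ i x :=
    contMDiff_finsum (fun i => (ψ i).contMDiff) hlf
  let ρ : SmoothPartitionOfUnity M 𝓘(ℝ, E) M univ :=
    { toFun := fun i => ⟨fun x => ψ i x / ∑ᶠ j, ψ j x,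
        (ψ i).contMDiff.div₀ hS fun x => (hSpos x).ne'⟩
      locallyFinite' := hlf.subset fun i x hx => by
        rw [Function.mem_support] at hx ⊢
        exact fun h => hx (by change ψ i x / _ = 0; rw [h, zero_div])
      nonneg' := fun i x => div_nonneg (hψ0 i x) (hSpos x).le
      sum_eq_one' := fun x _ => by
        change ∑ᶠ i, ψ i x / ∑ᶠ j, ψ j x = 1
        simp_rw [div_eq_mul_inv]
        rw [← finsum_mul' _ _ (hfin x), mul_inv_cancel₀ (hSpos x).ne']
      sum_le_one' := fun x => by
        change ∑ᶠ i, ψ i x / ∑ᶠ j, ψ j x ≤ 1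
        simp_rw [div_eq_mul_inv]
        rw [← finsum_mul' _ _ (hfin x), mul_inv_cancel₀ (hSpos x).ne'] }
  have hsupp : ∀ i, Function.support (ρ i) ⊆ Function.support (ψ i) := fun i x hx => by
    rw [Function.mem_support] at hx ⊢
    exact fun h => hx (by change ψ i x / _ = 0; rw [h, zero_div])
  have hsub : ∀ i, u i ⊆ interior (U i) := fun i =>
    (huK i).trans (interior_subset.trans (hKU i))
  refine ⟨fun x => ∑ᶠ i, ρ i x • g i x, ρ.contMDiff_finsum_smul fun i x hx => ?_,
    fun x => ρ.finsum_smul_mem_convex (mem_univ x) (fun i hi => hgt i x ?_) (ht x)⟩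
  · exact (hg i).contMDiffAt (mem_interior_iff_mem_nhds.1
      (hsub i (hψs i (closure_mono (hsupp i) hx))))
  · exact interior_subset (hsub i (hψs i (subset_tsupport _ (hsupp i hi))))

end Gluing

/-! ### Local one-parameter subgroups and the adjoint representation -/

section LieGroup

variable {EG : Type*} [NormedAddCommGroup EG] [NormedSpace ℝ EG]
  {G : Type*} [TopologicalSpace G] [ChartedSpace EG G] [Group G]

theorem mfderiv_eq_id_of_eq {f : G → G} (hf : f = id) :
    (mfderiv 𝓘(ℝ, EG) 𝓘(ℝ, EG) f 1 : EG →L[ℝ] EG) = ContinuousLinearMap.id ℝ EG := by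
  subst hf
  exact mfderiv_id

/-- The adjoint representation, as an endomorphism of the model space. -/
noncomputable def adjointCLM (g : G) : EG →L[ℝ] EG :=
  mfderiv 𝓘(ℝ, EG) 𝓘(ℝ, EG) (fun h : G => g * h * g⁻¹) 1

theorem adjointCLM_one : adjointCLM (1 : G) = ContinuousLinearMap.id ℝ EG := by
  exact mfderiv_eq_id_of_eq (funext fun h => by simp)

variable [LieGroup 𝓘(ℝ, EG) ∞ G]

theorem mfderiv_mul_left_mulInvariantVectorField (ξ : GroupLieAlgebra 𝓘(ℝ, EG) G) (g h : G) :
    mfderiv 𝓘(ℝ, EG) 𝓘(ℝ, EG) (g * ·) h (mulInvariantVectorField ξ h) =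
      mulInvariantVectorField ξ (g * h) := by
  have hd : ∀ a b : G, MDifferentiableAt 𝓘(ℝ, EG) 𝓘(ℝ, EG) (a * ·) b := fun a b =>
    (contMDiff_mul_left (I := 𝓘(ℝ, EG)) (n := ∞) (a := a)).mdifferentiableAt (by simp)
  have e : (g * h * ·) = (g * ·) ∘ (h * ·) := by
    funext x; exact mul_assoc g h x
  have h1 := mfderiv_comp (I' := 𝓘(ℝ, EG)) (1 : G) (hd g (h * 1)) (hd h 1)
  rw [← e] at h1
  have h2 := DFunLike.congr_fun h1 ξ
  rw [mul_one] at h2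
  exact h2.symm

/-- An integral curve through 1 of the left-invariant field of `ξ`. Both s ↦ γ(s + t) and s ↦
γ(t)γ(s) are integral curves starting at γ(t), so they agree. Doubling is all that is needed to
obtain iterated square roots. -/
theorem exists_local_oneParameter [FiniteDimensional ℝ EG] [T2Space G]
    (ξ : GroupLieAlgebra 𝓘(ℝ, EG) G) :
    ∃ γ : ℝ → G, γ 0 = 1 ∧ MDifferentiableAt 𝓘(ℝ, ℝ) 𝓘(ℝ, EG) γ 0 ∧
      (∀ φ : G → ℝ, MDifferentiableAt 𝓘(ℝ, EG) 𝓘(ℝ, ℝ) φ 1 →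
        HasDerivAt (φ ∘ γ) (mfderiv 𝓘(ℝ, EG) 𝓘(ℝ, ℝ) φ 1 ξ) 0) ∧
      ∀ᶠ t in 𝓝 (0 : ℝ), γ (t + t) = γ t * γ t := by
  have : CompleteSpace EG := FiniteDimensional.complete ℝ EG
  have : LieGroup 𝓘(ℝ, EG) (minSmoothness ℝ 3) G := by
    rw [minSmoothness_of_isRCLikeNormedField]
    exact LieGroup.of_le (n := ∞) (by norm_cast)
  have hv : ContMDiff 𝓘(ℝ, EG) 𝓘(ℝ, EG).tangent 1
      (fun g => (⟨g, mulInvariantVectorField ξ g⟩ : TangentBundle 𝓘(ℝ, EG) G)) := by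
    refine (contMDiff_mulInvariantVectorField ξ).of_le ?_
    rw [minSmoothness_of_isRCLikeNormedField]
    exact one_le_two
  obtain ⟨γ, hγ0, hγ⟩ := exists_isMIntegralCurveAt_of_contMDiffAt_boundaryless (t₀ := 0)
    (hv.contMDiffAt (x := (1 : G)))
  obtain ⟨ε, hε, hγε⟩ := isMIntegralCurveAt_iff'.1 hγ
  have hd := hγ.hasMFDerivAt
  refine ⟨γ, hγ0, hd.mdifferentiableAt, fun φ hφ => ?_, ?_⟩
  · have h1 : HasMFDerivAt 𝓘(ℝ, EG) 𝓘(ℝ, ℝ) φ (γ 0) (mfderiv 𝓘(ℝ, EG) 𝓘(ℝ, ℝ) φ (γ 0)) := by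
      rw [hγ0]; exact hφ.hasMFDerivAt
    let D : EG →L[ℝ] ℝ := mfderiv 𝓘(ℝ, EG) 𝓘(ℝ, ℝ) φ (γ 0)
    let w : EG := mulInvariantVectorField ξ (γ 0)
    have h2 : HasFDerivAt (φ ∘ γ) (D.comp ((1 : ℝ →L[ℝ] ℝ).smulRight w)) 0 :=
      (h1.comp (0 : ℝ) hd).hasFDerivAt
    have h2' := h2.hasDerivAt
    have h3 : mulInvariantVectorField ξ (1 : G) = ξ :=
      DFunLike.congr_fun (mfderiv_eq_id_of_eq (funext fun x => one_mul x)) ξ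
    have h4 : ∀ g : G, g = 1 → (mfderiv 𝓘(ℝ, EG) 𝓘(ℝ, ℝ) φ 1 ξ : ℝ) =
        mfderiv 𝓘(ℝ, EG) 𝓘(ℝ, ℝ) φ g (mulInvariantVectorField ξ g) := by
      rintro _ rfl; rw [h3]
    have h5 : (D.comp ((1 : ℝ →L[ℝ] ℝ).smulRight w)) 1 = D w := by simp
    rw [h5] at h2'
    exact (h4 _ hγ0) ▸ h2'
  · filter_upwards [Metric.ball_mem_nhds (0 : ℝ) (half_pos hε)] with t ht
    rw [Metric.mem_ball, dist_zero_right, Real.norm_eq_abs, abs_lt] at ht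
    have hsub : ∀ s ∈ Ioo (-(ε / 2)) (ε / 2), s ∈ ball (0 : ℝ) ε ∧ s + t ∈ ball (0 : ℝ) ε := by
      intro s hs
      simp only [Metric.mem_ball, dist_zero_right, Real.norm_eq_abs, abs_lt]
      exact ⟨⟨by linarith [hs.1], by linarith [hs.2]⟩, by linarith [hs.1], by linarith [hs.2]⟩
    have c1 : IsMIntegralCurveOn (γ ∘ (· + t)) (mulInvariantVectorField ξ)
        (Ioo (-(ε / 2)) (ε / 2)) :=
      (hγε.comp_add t).mono fun s hs => (hsub s hs).2
    have c2 : IsMIntegralCurveOn (fun s => γ t * γ s) (mulInvariantVectorField ξ)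
        (Ioo (-(ε / 2)) (ε / 2)) := by
      intro s hs
      have h1 := (hγε.mono fun s hs => (hsub s hs).1) s hs
      have h2 := ((contMDiff_mul_left (I := 𝓘(ℝ, EG)) (n := ∞) (a := γ t)).mdifferentiableAt
        (x := γ s) (by simp)).hasMFDerivAt
      have h3 := h2.comp_hasMFDerivWithinAt s h1
      refine h3.congr_mfderiv ?_
      ext
      change (mfderiv 𝓘(ℝ, EG) 𝓘(ℝ, EG) (γ t * ·) (γ s)) ((1 : ℝ) • _) = (1 : ℝ) • _
      rw [one_smul, one_smul, mfderiv_mul_left_mulInvariantVectorField]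
    have h0 : (0 : ℝ) ∈ Ioo (-(ε / 2)) (ε / 2) := ⟨by linarith, by linarith⟩
    have := isMIntegralCurveOn_Ioo_eqOn_of_contMDiff_boundaryless h0 hv c1 c2
      (by simp [hγ0])
    exact this (show t ∈ _ from ht)

/-- Every conjugation fixes 1, so the coordinate changes in the tangent bundle are trivial there,
and the parametrised derivative, smooth in coordinates, is the adjoint map itself. The same argument
serves for `contDiff_rightLogDeriv`. -/
theorem contMDiff_adjointCLM :
    ContMDiff 𝓘(ℝ, EG) 𝓘(ℝ, EG →L[ℝ] EG) ∞ (adjointCLM : G → EG →L[ℝ] EG) := by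
  intro g₀
  have hF : ContMDiff (𝓘(ℝ, EG).prod 𝓘(ℝ, EG)) 𝓘(ℝ, EG) ∞
      (Function.uncurry fun g h : G => g * h * g⁻¹) :=
    (contMDiff_fst.mul contMDiff_snd).mul contMDiff_fst.inv
  have h := ContMDiffAt.mfderiv (m := ∞) (n := ∞) (x₀ := g₀)
    (fun g h : G => g * h * g⁻¹) (fun _ => (1 : G)) (hF _) contMDiffAt_const (by simp)
  refine h.congr_of_eventuallyEq (Filter.Eventually.of_forall fun g => ?_)
  have h1 : ∀ p q : G, p = 1 → q = 1 → ∀ v : EG,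
      (tangentBundleCore 𝓘(ℝ, EG) G).coordChange (achart EG p) (achart EG q) p v = v := by
    rintro _ _ rfl rfl v
    exact (tangentBundleCore 𝓘(ℝ, EG) G).coordChange_self _ _ (mem_chart_source _ _) v
  have e : ∀ g : G, g * 1 * g⁻¹ = 1 := fun g => by simp
  have h3 : ∀ D : G → EG →L[ℝ] EG, inTangentCoordinates 𝓘(ℝ, EG) 𝓘(ℝ, EG) (fun _ : G => (1 : G))
      (fun g : G => g * 1 * g⁻¹) D g₀ g = D g := fun D => by
    rw [inTangentCoordinates_eq (I := 𝓘(ℝ, EG)) (I' := 𝓘(ℝ, EG)) (fun _ : G => (1 : G))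
      (fun g : G => g * 1 * g⁻¹) D (mem_chart_source _ _)
      (by rw [e, e]; exact mem_chart_source _ _)]
    ext v
    exact (h1 _ _ (e g) (e g₀) _).trans (congrArg (D g) (h1 1 1 rfl rfl v))
  exact (h3 fun g => adjointCLM g).symm

end LieGroup

theorem JetBound.congr {E : Type*} [NormedAddCommGroup E] [NormedSpace ℝ E]
    {V : Type*} [NormedAddCommGroup V] [NormedSpace ℝ V] {n : ℕ} {s : Set E} (hs : IsOpen s)
    {a b : E → V} {K : ℝ} (h : JetBound n s a K) (hab : EqOn a b s) : JetBound n s b K := by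
  intro i hi y hy
  have e : a =ᶠ[𝓝 y] b := Filter.eventuallyEq_of_mem (hs.mem_nhds hy) hab
  rw [← (Filter.EventuallyEq.iteratedFDeriv (𝕜 := ℝ) e i).eq_of_nhds]
  exact h i hi y hy

/-! ### The group action read in charts -/

section LocalAction

variable {EG : Type*} [NormedAddCommGroup EG] [NormedSpace ℝ EG]
  {G : Type*} [TopologicalSpace G] [ChartedSpace EG G] [Group G] [LieGroup 𝓘(ℝ, EG) ∞ G]
  {E : Type*} [NormedAddCommGroup E] [NormedSpace ℝ E]
  {M : Type*} [TopologicalSpace M] [ChartedSpace E M] [IsManifold 𝓘(ℝ, E) ∞ M]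
  [MulAction G M]

variable (E) in
/-- The action of `g⁻¹` in the chart at `x₀`. -/
noncomputable def chartAction (x₀ : M) (g : G) (y : E) : E :=
  extChartAt 𝓘(ℝ, E) x₀ (g⁻¹ • (extChartAt 𝓘(ℝ, E) x₀).symm y)

variable [ContMDiffSMul 𝓘(ℝ, EG) 𝓘(ℝ, E) ∞ G M]

theorem contMDiffOn_smul_chart (x₀ : M) :
    ContMDiffOn 𝓘(ℝ, EG × E) 𝓘(ℝ, E) ∞
      (fun p : EG × E => ((extChartAt 𝓘(ℝ, EG) (1 : G)).symm p.1)⁻¹ •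
        (extChartAt 𝓘(ℝ, E) x₀).symm p.2)
      ((extChartAt 𝓘(ℝ, EG) (1 : G)).target ×ˢ (extChartAt 𝓘(ℝ, E) x₀).target) := by
  have h1 : ContMDiffOn 𝓘(ℝ, EG × E) 𝓘(ℝ, EG) ∞
      (fun p : EG × E => (extChartAt 𝓘(ℝ, EG) (1 : G)).symm p.1)
      ((extChartAt 𝓘(ℝ, EG) (1 : G)).target ×ˢ (extChartAt 𝓘(ℝ, E) x₀).target) :=
    (contMDiffOn_extChartAt_symm (I := 𝓘(ℝ, EG)) (n := ∞) (1 : G)).comp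
      contDiff_fst.contMDiff.contMDiffOn fun p hp => hp.1
  have h2 : ContMDiffOn 𝓘(ℝ, EG × E) 𝓘(ℝ, E) ∞
      (fun p : EG × E => (extChartAt 𝓘(ℝ, E) x₀).symm p.2)
      ((extChartAt 𝓘(ℝ, EG) (1 : G)).target ×ˢ (extChartAt 𝓘(ℝ, E) x₀).target) :=
    (contMDiffOn_extChartAt_symm (I := 𝓘(ℝ, E)) (n := ∞) x₀).comp
      contDiff_snd.contMDiff.contMDiffOn fun p hp => hp.2
  exact (contMDiff_smul (I := 𝓘(ℝ, EG)) (I' := 𝓘(ℝ, E)) (n := ∞) (G := G)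
    (M := M)).comp_contMDiffOn (h1.inv.prodMk h2)

/-- Estimates for the action on coefficient functions in a chart. -/
theorem exists_chart_action_estimates [FiniteDimensional ℝ EG] [FiniteDimensional ℝ E] (x₀ : M)
    {r r' : ℝ} (hr : r < r')
    (hr' : ball (extChartAt 𝓘(ℝ, E) x₀ x₀) r' ⊆ (extChartAt 𝓘(ℝ, E) x₀).target) :
    ∃ ε > 0, ∀ n, ∃ C > 0, ∀ g ∈ (extChartAt 𝓘(ℝ, EG) (1 : G)).source,
      extChartAt 𝓘(ℝ, EG) (1 : G) g ∈ ball (extChartAt 𝓘(ℝ, EG) (1 : G) 1) ε →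
      (∀ y ∈ ball (extChartAt 𝓘(ℝ, E) x₀ x₀) r,
        g⁻¹ • (extChartAt 𝓘(ℝ, E) x₀).symm y ∈ (extChartAt 𝓘(ℝ, E) x₀).source ∧
        chartAction E x₀ g y ∈ ball (extChartAt 𝓘(ℝ, E) x₀ x₀) r') ∧
      ∀ a : E → EG, ContDiffOn ℝ ∞ a (ball (extChartAt 𝓘(ℝ, E) x₀ x₀) r') →
        ContDiffOn ℝ ∞ (fun y => adjointCLM g (a (chartAction E x₀ g y)))
          (ball (extChartAt 𝓘(ℝ, E) x₀ x₀) r) ∧ ∀ K ≥ 0,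
        (JetBound n (ball (extChartAt 𝓘(ℝ, E) x₀ x₀) r') a K →
          JetBound n (ball (extChartAt 𝓘(ℝ, E) x₀ x₀) r)
            (fun y => adjointCLM g (a (chartAction E x₀ g y))) (C * K)) ∧
        (JetBound (n + 1) (ball (extChartAt 𝓘(ℝ, E) x₀ x₀) r') a K →
          JetBound n (ball (extChartAt 𝓘(ℝ, E) x₀ x₀) r)
            ((fun y => adjointCLM g (a (chartAction E x₀ g y))) - a)
            (C * K * ‖extChartAt 𝓘(ℝ, EG) (1 : G) g - extChartAt 𝓘(ℝ, EG) (1 : G) 1‖)) := by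
  set c := extChartAt 𝓘(ℝ, E) x₀ with hc
  set κ := extChartAt 𝓘(ℝ, EG) (1 : G) with hκ
  have hκ1 : κ.symm (κ 1) = 1 := κ.left_inv (mem_extChartAt_source (1 : G))
  let q : EG × E → M := fun p => (κ.symm p.1)⁻¹ • c.symm p.2
  have hq : ContMDiffOn 𝓘(ℝ, EG × E) 𝓘(ℝ, E) ∞ q (κ.target ×ˢ c.target) :=
    contMDiffOn_smul_chart x₀
  have ho : IsOpen (κ.target ×ˢ c.target) :=
    (isOpen_extChartAt_target (1 : G)).prod (isOpen_extChartAt_target x₀)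
  have ho' : IsOpen (c.source ∩ c ⁻¹' ball (c x₀) r') :=
    (continuousOn_extChartAt x₀).isOpen_inter_preimage (isOpen_extChartAt_source x₀) isOpen_ball
  -- The pairs for which the moved point stays in the chart at `x₀` and lands in the ball of radius
  -- `r'`.
  let s : Set (EG × E) := κ.target ×ˢ c.target ∩ q ⁻¹' (c.source ∩ c ⁻¹' ball (c x₀) r')
  have hs : IsOpen s := hq.continuousOn.isOpen_inter_preimage ho ho'
  have hΨ : ContDiffOn ℝ ∞ (fun p => c (q p)) s := by
    refine contMDiffOn_iff_contDiffOn.1 ?_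
    exact (contMDiffOn_extChartAt (I := 𝓘(ℝ, E)) (n := ∞) (x := x₀)).comp
      (hq.mono inter_subset_left) fun p hp => by
        have := hp.2.1
        rwa [hc, extChartAt_source] at this
  have hΛ : ContDiffOn ℝ ∞ (fun p : EG × E => (adjointCLM (κ.symm p.1) : EG →L[ℝ] EG)) s := by
    refine contMDiffOn_iff_contDiffOn.1 ?_
    have h1 : ContMDiffOn 𝓘(ℝ, EG × E) 𝓘(ℝ, EG) ∞ (fun p : EG × E => κ.symm p.1) s :=
      (contMDiffOn_extChartAt_symm (I := 𝓘(ℝ, EG)) (n := ∞) (1 : G)).comp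
        contDiff_fst.contMDiff.contMDiffOn fun p hp => hp.1.1
    exact contMDiff_adjointCLM.comp_contMDiffOn h1
  have hu₀ : ∀ y ∈ closedBall (c x₀) r, (κ 1, y) ∈ s := by
    intro y hy
    have hy' : y ∈ ball (c x₀) r' := closedBall_subset_ball hr hy
    have hq1 : q (κ 1, y) = c.symm y := by
      simp only [q, hκ1, inv_one, one_smul]
    refine ⟨⟨mem_extChartAt_target (1 : G), hr' hy'⟩, ?_⟩
    rw [mem_preimage, hq1]
    refine ⟨c.map_target (hr' hy'), ?_⟩
    rw [mem_preimage, c.right_inv (hr' hy')]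
    exact hy'
  obtain ⟨ε, hε, hεs, hest⟩ := exists_ball_action_estimates
    (Λ := fun u => (adjointCLM (κ.symm u) : EG →L[ℝ] EG)) (Ψ := fun p => c (q p)) hs hΛ hΨ
    (c := c x₀) (r := r) (r' := r') (fun p hp => hp.2.2) hu₀
  refine ⟨ε, hε, fun n => ?_⟩
  obtain ⟨C, hC, hC'⟩ := hest n
  refine ⟨C, hC, fun g hg hgε => ?_⟩
  have hgs : κ.symm (κ g) = g := κ.left_inv hg
  have hact : ∀ y, c (q (κ g, y)) = chartAction E x₀ g y := fun y => by
    simp only [q, hgs, chartAction, hc]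
  refine ⟨fun y hy => ?_, fun a ha => ?_⟩
  · have h1 := (hεs _ hgε y hy).2
    refine ⟨?_, (hact y) ▸ h1.2⟩
    have h2 := h1.1
    simp only [q, hgs] at h2
    exact h2
  · obtain ⟨h1, h2⟩ := hC' a ha _ hgε
    simp only [hact, hgs] at h1 h2
    refine ⟨h1, fun K hK => ⟨(h2 K hK).1, fun h => ?_⟩⟩
    refine ((h2 K hK).2 h).congr isOpen_ball fun y hy => ?_
    have hy' := hr' (ball_subset_ball hr.le hy)
    -- At the parameter `κ 1` the operator is the identity, so the general difference estimate
    -- compares with `a` itself.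
    simp only [q, hκ1, inv_one, one_smul, Pi.sub_apply]
    rw [c.right_inv hy', adjointCLM_one]
    rfl

end LocalAction

/-! ### The momentum ideal: global invariance implies infinitesimal invariance -/

theorem firstCountableTopology_of_chartedSpace (H : Type*) [TopologicalSpace H]
    [FirstCountableTopology H] (X : Type*) [TopologicalSpace X] [ChartedSpace H X] :
    FirstCountableTopology X :=
  ⟨fun x => by
    have h := (chartAt H x).symm.map_nhds_eq
      ((chartAt H x).map_source (mem_chart_source H x))
    rw [(chartAt H x).left_inv (mem_chart_source H x)] at h
    rw [← h]
    infer_instance⟩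

section Momentum

variable {EG : Type*} [NormedAddCommGroup EG] [NormedSpace ℝ EG] [FiniteDimensional ℝ EG]
  {G : Type*} [TopologicalSpace G] [ChartedSpace EG G] [Group G] [LieGroup 𝓘(ℝ, EG) ∞ G]
  {E : Type*} [NormedAddCommGroup E] [NormedSpace ℝ E]
  {M : Type*} [TopologicalSpace M] [ChartedSpace E M] [IsManifold 𝓘(ℝ, E) ∞ M]
  [MulAction G M] [ContMDiffSMul 𝓘(ℝ, EG) 𝓘(ℝ, E) ∞ G M]
  {Ω : SymplecticForm E M} (μ : MomentMap EG G Ω)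

namespace MomentMap

/-- The value of the moment map at a point, as a continuous linear form on the model space. -/
noncomputable def pairing (x : M) : EG →L[ℝ] ℝ :=
  LinearMap.toContinuousLinearMap (show EG →ₗ[ℝ] ℝ from μ.toFun x)

/-- Equivariance in the form that lifts the action from functions ⟨μ, a⟩ to coefficients: `a` is
moved along the action and twisted by Ad_g. -/
theorem pairing_inv_smul (g : G) (x : M) (v : EG) :
    μ.pairing (g⁻¹ • x) v = μ.pairing x (adjointCLM g v) := by
  refine (μ.equivariant g⁻¹ x v).trans ?_
  rw [inv_inv]
  rfl

/-- The momenta are linear in ξ, so those of a basis of the finite-dimensional Lie algebra generate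
the ideal, and the components of `a` are the multipliers. -/
theorem mem_momentumIdeal_iff {f : SmoothFun E M} :
    f ∈ μ.momentumIdeal ↔ ∃ a : M → EG, ContMDiff 𝓘(ℝ, E) 𝓘(ℝ, EG) ∞ a ∧
      ∀ x, f x = μ.pairing x (a x) := by
  constructor
  · intro hf
    induction hf using Submodule.span_induction with
    | mem f hf =>
      obtain ⟨ξ, rfl⟩ := hf
      exact ⟨fun _ => ξ, contMDiff_const, fun x => rfl⟩
    | zero => exact ⟨0, contMDiff_const, fun x => (map_zero _).symm⟩
    | add f h _ _ hf hh =>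
      obtain ⟨a, ha, haf⟩ := hf
      obtain ⟨b, hb, hbh⟩ := hh
      refine ⟨a + b, ha.add hb, fun x => ?_⟩
      rw [Pi.add_apply, map_add, ← haf, ← hbh]
      rfl
    | smul k f _ hf =>
      obtain ⟨a, ha, haf⟩ := hf
      refine ⟨fun x => k x • a x, k.contMDiff.smul ha, fun x => ?_⟩
      rw [map_smul, ← haf]
      rfl
  · rintro ⟨a, ha, haf⟩
    let b := Module.finBasis ℝ EG
    let k : Fin (Module.finrank ℝ EG) → SmoothFun E M := fun i =>
      ⟨fun x => LinearMap.toContinuousLinearMap (b.coord i) (a x),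
        (LinearMap.toContinuousLinearMap (b.coord i)).contDiff.contMDiff.comp ha⟩
    have e : f = ∑ i, k i * μ.momentum (b i) := by
      ext x
      rw [haf]
      conv_lhs => rw [← b.sum_repr (a x), map_sum]
      have h : ∀ t : Finset (Fin (Module.finrank ℝ EG)),
          (∑ i ∈ t, k i * μ.momentum (b i) : SmoothFun E M) x =
          ∑ i ∈ t, k i x * μ.momentum (b i) x := by
        classical
        intro t
        induction t using Finset.induction with
        | empty => rfl
        | insert i t hi ih => rw [Finset.sum_insert hi, Finset.sum_insert hi, ← ih]; rfl
      rw [h]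
      refine Finset.sum_congr rfl fun i _ => ?_
      rw [map_smul]
      rfl
    rw [e]
    exact Submodule.sum_mem _ fun i _ => Ideal.mul_mem_left _ _ (Ideal.subset_span ⟨_, rfl⟩)

/-- The admissible values of `a` at a point form an affine, hence convex, set, so local coefficients
glue. -/
theorem mem_momentumIdeal_of_local [FiniteDimensional ℝ E] [T2Space M] [ParacompactSpace M]
    {f : SmoothFun E M}
    (h : ∀ x, ∃ U ∈ 𝓝 x, ∃ a : M → EG, ContMDiffOn 𝓘(ℝ, E) 𝓘(ℝ, EG) ∞ a U ∧
      ∀ y ∈ U, f y = μ.pairing y (a y)) : f ∈ μ.momentumIdeal := by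
  obtain ⟨a, ha, haf⟩ := exists_contMDiff_forall_mem_convex (E := E)
    (t := fun y => {v | f y = μ.pairing y v})
    (fun y v hv w hw s t hs ht hst => by
      change f y = _
      rw [map_add, map_smul, map_smul, ← show f y = _ from hv, ← show f y = _ from hw,
        ← add_smul, hst, one_smul]) h
  exact μ.mem_momentumIdeal_iff.2 ⟨a, ha, haf⟩

/-- Here F_g = g·h − h in the chart at `x₀`. The cocycle identity is formal; the chart estimates
ensure that a point moved by g near 1 stays in the chart. -/
theorem isLocalCocycle [FiniteDimensional ℝ E] {h : SmoothFun E M}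
    (hh : ∀ g : G, translate EG g h - h ∈ μ.momentumIdeal) (x₀ : M) {R : ℝ}
    (hR : ball (extChartAt 𝓘(ℝ, E) x₀ x₀) R ⊆ (extChartAt 𝓘(ℝ, E) x₀).target) :
    IsLocalCocycle (extChartAt 𝓘(ℝ, E) x₀ x₀) R
      (fun y => μ.pairing ((extChartAt 𝓘(ℝ, E) x₀).symm y)) (chartAction E x₀)
      (fun (g : G) a y => adjointCLM g (a (chartAction E x₀ g y)))
      (fun g y => h (g⁻¹ • (extChartAt 𝓘(ℝ, E) x₀).symm y) -
        h ((extChartAt 𝓘(ℝ, E) x₀).symm y)) := by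
  have hWmem : ∀ ε > 0, {g : G | g ∈ (extChartAt 𝓘(ℝ, EG) (1 : G)).source ∧
      extChartAt 𝓘(ℝ, EG) (1 : G) g ∈ ball (extChartAt 𝓘(ℝ, EG) (1 : G) 1) ε} ∈ 𝓝 (1 : G) :=
    fun ε hε => inter_mem (extChartAt_source_mem_nhds (1 : G))
      ((continuousAt_extChartAt (1 : G)) (ball_mem_nhds _ hε))
  refine ⟨fun y _ => by simp, fun y _ => ?_, fun g => ?_, fun r r' hr hr' => ?_,
    fun r r' hr hr' => ?_⟩
  · have := topologicalGroup_of_lieGroup 𝓘(ℝ, EG) ∞ (G := G)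
    have h1 := (contMDiff_orbit (EG := EG) (G := G) h
      ((extChartAt 𝓘(ℝ, E) x₀).symm y)).continuous
    exact (h1.comp continuous_inv).sub continuous_const
  · obtain ⟨a, ha, haf⟩ := μ.mem_momentumIdeal_iff.1 (hh g)
    refine ⟨fun y => a ((extChartAt 𝓘(ℝ, E) x₀).symm y), ?_, fun y _ => haf _⟩
    refine contMDiffOn_iff_contDiffOn.1 ?_
    exact ha.comp_contMDiffOn ((contMDiffOn_extChartAt_symm x₀).mono hR)
  · obtain ⟨ε, hε, hest⟩ := exists_chart_action_estimates (EG := EG) (G := G) x₀ hr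
      ((ball_subset_ball hr').trans hR)
    obtain ⟨C, -, hC⟩ := hest 0
    filter_upwards [hWmem ε hε] with g hg y hy
    obtain ⟨h1, h2⟩ := (hC g hg.1 hg.2).1 y hy
    have h3 : (extChartAt 𝓘(ℝ, E) x₀).symm (chartAction E x₀ g y) =
        g⁻¹ • (extChartAt 𝓘(ℝ, E) x₀).symm y := (extChartAt 𝓘(ℝ, E) x₀).left_inv h1
    refine ⟨h2, fun k => ?_, fun a => ?_⟩
    · rw [h3, mul_inv_rev, mul_smul]
      ring
    · rw [h3, pairing_inv_smul]
  · obtain ⟨ε, hε, hest⟩ := exists_chart_action_estimates (EG := EG) (G := G) x₀ hr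
      ((ball_subset_ball hr').trans hR)
    refine ⟨_, hWmem ε hε, fun n => ?_⟩
    obtain ⟨C, hC, hC'⟩ := hest n
    refine ⟨C, hC, fun g hg a ha => ?_⟩
    obtain ⟨h1, h2⟩ := (hC' g hg.1 hg.2).2 a ha
    exact ⟨h1, fun K hK => (h2 K hK).1⟩

/-- If the class of `h` modulo the momentum ideal is invariant under the group, then it is
invariant under the Lie algebra. -/
theorem fundamentalVF_mem_momentumIdeal [T2Space G] [FiniteDimensional ℝ E] [T2Space M]
    [ParacompactSpace M] {h : SmoothFun E M}
    (hh : ∀ g : G, translate EG g h - h ∈ μ.momentumIdeal)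
    (ξ : GroupLieAlgebra 𝓘(ℝ, EG) G) : fundamentalVF ξ h ∈ μ.momentumIdeal := by
  have := topologicalGroup_of_lieGroup 𝓘(ℝ, EG) ∞ (G := G)
  have : LocallyCompactSpace G := Manifold.locallyCompact_of_finiteDimensional 𝓘(ℝ, EG)
  have : FirstCountableTopology G := firstCountableTopology_of_chartedSpace EG G
  obtain ⟨γ, hγ0, hγd, hγφ, hγsq⟩ := exists_local_oneParameter ξ
  obtain ⟨τ, hτ, hτsq⟩ : ∃ τ > 0, ∀ t, |t| ≤ τ → γ (t + t) = γ t * γ t := by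
    obtain ⟨τ, hτ, h1⟩ := nhds_basis_closedBall.eventually_iff.1 hγsq
    exact ⟨τ, hτ, fun t ht => h1 (by simpa using ht)⟩
  let t : ℕ → ℝ := fun n => τ * (1 / 2) ^ n
  have htpos : ∀ n, 0 < t n := fun n => by positivity
  have ht0 : Tendsto t atTop (𝓝 0) := by
    have h1 := (tendsto_pow_atTop_nhds_zero_of_lt_one (r := (1 / 2 : ℝ)) (by norm_num)
      (by norm_num)).const_mul τ
    rwa [mul_zero] at h1
  have htle : ∀ n, |t n| ≤ τ := fun n => by
    rw [abs_of_pos (htpos n)]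
    exact mul_le_of_le_one_right hτ.le (pow_le_one₀ (by norm_num) (by norm_num))
  -- Inverses, because `translate` and the chart action evaluate at g⁻¹x.
  let s : ℕ → G := fun n => (γ (t n))⁻¹
  have hs : ∀ n, s (n + 1) * s (n + 1) = s n := fun n => by
    have h1 : t (n + 1) + t (n + 1) = t n := by simp only [t, pow_succ]; ring
    simp only [s]
    rw [← mul_inv_rev, ← hτsq _ (htle _), h1]
  have hs1 : Tendsto s atTop (𝓝 1) := by
    have := (hγd.continuousAt.tendsto.comp ht0).inv
    rwa [hγ0, inv_one] at this
  set κ := extChartAt 𝓘(ℝ, EG) (1 : G) with hκ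
  have hlip : ∃ B > 0, ∀ᶠ n in atTop, ‖κ (s n) - κ 1‖ ≤ B * (1 / 2) ^ n := by
    have h1 : MDifferentiableAt 𝓘(ℝ, ℝ) 𝓘(ℝ, EG) (fun u : ℝ => κ (γ u)⁻¹) 0 := by
      have h2 : MDifferentiableAt 𝓘(ℝ, EG) 𝓘(ℝ, EG) (fun g : G => κ g⁻¹) (γ 0) := by
        have h3 : MDifferentiableAt 𝓘(ℝ, EG) 𝓘(ℝ, EG) κ (γ 0)⁻¹ := by
          rw [hγ0, inv_one]
          exact mdifferentiableAt_extChartAt (mem_chart_source EG (1 : G))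
        exact h3.comp (γ 0) ((contMDiff_inv 𝓘(ℝ, EG) ∞).mdifferentiableAt (by simp))
      exact h2.comp (0 : ℝ) hγd
    obtain ⟨B, hB, hB'⟩ := h1.differentiableAt.isBigO_sub.exists_pos
    refine ⟨B * τ, by positivity, ?_⟩
    filter_upwards [ht0.eventually hB'.bound] with n hn
    rw [hγ0, inv_one, sub_zero, Real.norm_eq_abs, abs_of_pos (htpos n)] at hn
    exact hn.trans (le_of_eq (by simp only [t]; ring))
  obtain ⟨B, hB, hlip⟩ := hlip
  -- The factor 2^n is τ / t_n, and the fundamental field carries a minus sign; hence the limit −τ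
  -- ξ_M h.
  have hlim : ∀ x : M, Tendsto (fun n => 2 ^ n * (h ((s n)⁻¹ • x) - h x)) atTop
      (𝓝 (-τ * fundamentalVF ξ h x)) := by
    intro x
    let d : ℝ := mfderiv 𝓘(ℝ, EG) 𝓘(ℝ, ℝ) (fun g : G => h (g • x)) 1 ξ
    have h1 : HasDerivAt (fun u => h (γ u • x)) d 0 :=
      hγφ (fun g => h (g • x)) (mdifferentiableAt_orbit h x 1)
    have h2 := (hasDerivAt_iff_tendsto_slope_zero.1 h1).comp
      (tendsto_nhdsWithin_iff.2 ⟨ht0, Filter.Eventually.of_forall fun n => (htpos n).ne'⟩)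
    have h3 := h2.const_mul τ
    have h4 : τ * d = -τ * fundamentalVF ξ h x := by
      rw [fundamentalVF_apply]
      exact (neg_mul_neg τ d).symm
    refine (h4 ▸ h3).congr fun n => ?_
    simp only [Function.comp_apply, s, zero_add, inv_inv, hγ0, one_smul, smul_eq_mul]
    rw [← mul_assoc]
    congr 1
    simp only [t, one_div, inv_pow]
    field_simp
  refine μ.mem_momentumIdeal_of_local fun x₀ => ?_
  set c := extChartAt 𝓘(ℝ, E) x₀ with hc
  obtain ⟨R, hR, hRc⟩ := nhds_basis_ball.mem_iff.1
    ((isOpen_extChartAt_target (I := 𝓘(ℝ, E)) x₀).mem_nhds (mem_extChartAt_target x₀))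
  have hcoc := μ.isLocalCocycle hh x₀ hRc
  have hsε : ∀ ε > 0, ∀ᶠ n in atTop, s n ∈ κ.source ∧ κ (s n) ∈ ball (κ 1) ε := fun ε hε =>
    hs1.eventually (inter_mem (extChartAt_source_mem_nhds (1 : G))
      ((continuousAt_extChartAt (1 : G)) (ball_mem_nhds _ hε)))
  obtain ⟨a, ha, haD⟩ := hcoc.exists_derivative_eq hs hs1
    (fun r r' hr hr' N => by
      obtain ⟨ε, hε, hest⟩ := exists_chart_action_estimates (EG := EG) (G := G) x₀ hr
        ((ball_subset_ball hr').trans hRc)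
      obtain ⟨C, hC, hC'⟩ := hest N
      refine ⟨C * B, by positivity, ?_⟩
      filter_upwards [hsε ε hε, hlip] with n hn hnl b hb K hK hbK
      obtain ⟨h1, h2⟩ := (hC' _ hn.1 hn.2).2 b hb
      refine ⟨h1.sub (hb.mono (ball_subset_ball hr.le)),
        ((h2 K hK).2 hbK).mono le_rfl subset_rfl ?_⟩
      calc C * K * ‖κ (s n) - κ 1‖ ≤ C * K * (B * (1 / 2) ^ n) := by gcongr
        _ = C * B * (1 / 2) ^ n * K := by ring)
    (D := fun y => -τ * fundamentalVF ξ h (c.symm y)) (fun y _ => hlim _) (half_lt_self hR)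
  refine ⟨c.source ∩ c ⁻¹' ball (c x₀) (R / 2), ?_, fun x => (-τ)⁻¹ • a (c x), ?_, ?_⟩
  · exact inter_mem (extChartAt_source_mem_nhds x₀)
      ((continuousAt_extChartAt x₀) (ball_mem_nhds _ (half_pos hR)))
  · refine (contDiff_const_smul (𝕜 := ℝ) (n := ∞) (F := EG) (-τ)⁻¹).contMDiff.comp_contMDiffOn ?_
    refine (contMDiffOn_iff_contDiffOn.2 ha).comp ((contMDiffOn_extChartAt (x := x₀)).mono
      fun x hx => ?_) fun x hx => hx.2
    have := hx.1
    rwa [hc, extChartAt_source] at this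
  · rintro x ⟨hx, hx'⟩
    have h1 := haD (c x) hx'
    rw [← hc, c.left_inv hx] at h1
    rw [map_smul, ← h1, smul_eq_mul, inv_mul_cancel_left₀ (neg_ne_zero.2 hτ.ne')]

end MomentMap

end Momentum

end ObservableReduction

namespace ObservableReduction

open Set Filter Topology Metric MeasureTheory

/-! ### The momentum ideal: infinitesimal invariance implies global invariance -/

/-- The integral is the convolution of the constant 1 with t ↦ A(p, −t), evaluated at 0; the
reflection turns the support [0, 1] into [−1, 0]. -/
theorem contDiffOn_integral_of_support {E V : Type*} [NormedAddCommGroup E] [NormedSpace ℝ E]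
    [NormedAddCommGroup V] [NormedSpace ℝ V] [CompleteSpace V] {A : E → ℝ → V} {s : Set E}
    (hs : IsOpen s) (hA : ContDiffOn ℝ ∞ (Function.uncurry A) (s ×ˢ univ))
    (h0 : ∀ p ∈ s, ∀ t ∉ Icc (0 : ℝ) 1, A p t = 0) :
    ContDiffOn ℝ ∞ (fun p => ∫ t, A p t) s := by
  have h := contDiffOn_convolution_right_with_param (μ := volume) (f := fun _ : ℝ => (1 : ℝ))
    (n := ⊤) (ContinuousLinearMap.lsmul ℝ ℝ) (g := fun p t => A p (-t)) (s := s)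
    (k := Icc (-1 : ℝ) 0) hs isCompact_Icc
    (fun p x hp hx => h0 p hp _ fun hx' => hx ⟨by linarith [hx'.2], by linarith [hx'.1]⟩)
    (locallyIntegrable_const _)
    (by
      refine hA.comp (g := Function.uncurry A) (f := fun q : E × ℝ => (q.1, -q.2)) ?_ ?_
      · exact (contDiff_fst.prodMk contDiff_snd.neg).contDiffOn
      · exact fun q hq => ⟨hq.1, mem_univ _⟩)
  have h2 := h.comp (f := fun p : E => (p, (0 : ℝ))) (s := s)
    (contDiff_id.prodMk contDiff_const).contDiffOn (fun p hp => ⟨hp, mem_univ _⟩)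
  refine h2.congr fun p _ => ?_
  simp [convolution]

/-! ### Smooth paths in a Lie group and the derivative of a function along an orbit -/

section Paths

variable {EG : Type*} [NormedAddCommGroup EG] [NormedSpace ℝ EG]
  {G : Type*} [TopologicalSpace G] [ChartedSpace EG G] [Group G]

variable (EG) in
/-- The right logarithmic derivative of a path in a Lie group. -/
noncomputable def rightLogDeriv (γ : ℝ → G) (t : ℝ) : EG :=
  (mfderiv 𝓘(ℝ, ℝ) 𝓘(ℝ, EG) (fun s => γ s * (γ t)⁻¹) t : ℝ → EG) 1

theorem rightLogDeriv_eq_zero {γ : ℝ → G} {t : ℝ} {g : G} (h : γ =ᶠ[𝓝 t] fun _ => g) :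
    rightLogDeriv EG γ t = 0 := by
  have h1 : (fun s => γ s * (γ t)⁻¹) =ᶠ[𝓝 t] fun _ => g * (γ t)⁻¹ :=
    h.mono fun s hs => congrArg (· * (γ t)⁻¹) hs
  have h2 : (mfderiv 𝓘(ℝ, ℝ) 𝓘(ℝ, EG) (fun s => γ s * (γ t)⁻¹) t : ℝ →L[ℝ] EG) =
      mfderiv 𝓘(ℝ, ℝ) 𝓘(ℝ, EG) (fun _ : ℝ => g * (γ t)⁻¹) t := h1.mfderiv_eq
  rw [mfderiv_const] at h2
  exact DFunLike.congr_fun h2 1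

variable [LieGroup 𝓘(ℝ, EG) ∞ G]

theorem contDiff_rightLogDeriv {γ : ℝ → G} (hγ : ContMDiff 𝓘(ℝ, ℝ) 𝓘(ℝ, EG) ∞ γ) :
    ContDiff ℝ ∞ (rightLogDeriv EG γ) := by
  refine contMDiff_iff_contDiff.1 fun t₀ => ?_
  have hF : ContMDiff (𝓘(ℝ, ℝ).prod 𝓘(ℝ, ℝ)) 𝓘(ℝ, EG) ∞
      (Function.uncurry fun t s : ℝ => γ s * (γ t)⁻¹) :=
    (hγ.comp contMDiff_snd).mul (hγ.comp contMDiff_fst).inv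
  have h := ContMDiffAt.mfderiv (m := ∞) (n := ∞) (x₀ := t₀)
    (fun t s : ℝ => γ s * (γ t)⁻¹) (fun t => t) (hF _) contMDiffAt_id (by simp)
  have h' := h.clm_apply (contMDiffAt_const (c := (1 : ℝ)))
  refine h'.congr_of_eventuallyEq (Filter.Eventually.of_forall fun t => ?_)
  have h1 : ∀ p q : G, p = 1 → q = 1 → ∀ v : EG,
      (tangentBundleCore 𝓘(ℝ, EG) G).coordChange (achart EG p) (achart EG q) p v = v := by
    rintro _ _ rfl rfl v
    exact (tangentBundleCore 𝓘(ℝ, EG) G).coordChange_self _ _ (mem_chart_source _ _) v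
  have e : ∀ t : ℝ, γ t * (γ t)⁻¹ = 1 := fun t => mul_inv_cancel _
  have h3 : ∀ D : ℝ → ℝ →L[ℝ] EG, inTangentCoordinates 𝓘(ℝ, ℝ) 𝓘(ℝ, EG) (fun t : ℝ => t)
      (fun t : ℝ => γ t * (γ t)⁻¹) D t₀ t 1 = D t 1 := fun D => by
    rw [inTangentCoordinates_eq (I := 𝓘(ℝ, ℝ)) (I' := 𝓘(ℝ, EG)) (fun t : ℝ => t)
      (fun t : ℝ => γ t * (γ t)⁻¹) D (by rw [chartAt_self_eq]; trivial)
      (by rw [e, e]; exact mem_chart_source _ _),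
      ContinuousLinearMap.comp_apply, ContinuousLinearMap.comp_apply,
      tangentBundleCore_coordChange_model_space]
    exact h1 _ _ (e t) (e t₀) _
  exact (h3 fun t => mfderiv 𝓘(ℝ, ℝ) 𝓘(ℝ, EG) (fun s => γ s * (γ t)⁻¹) t).symm

/-- Points near the identity are joined to it by smooth paths that are constant outside the
unit interval. -/
theorem eventually_exists_smooth_path : ∀ᶠ g in 𝓝 (1 : G), ∃ γ : ℝ → G,
    ContMDiff 𝓘(ℝ, ℝ) 𝓘(ℝ, EG) ∞ γ ∧ (∀ t ≤ 0, γ t = 1) ∧ ∀ t, 1 ≤ t → γ t = g := by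
  set κ := extChartAt 𝓘(ℝ, EG) (1 : G) with hκ
  obtain ⟨ε, hε, hεκ⟩ := nhds_basis_ball.mem_iff.1
    ((isOpen_extChartAt_target (I := 𝓘(ℝ, EG)) (1 : G)).mem_nhds (mem_extChartAt_target (1 : G)))
  filter_upwards [extChartAt_source_mem_nhds (I := 𝓘(ℝ, EG)) (1 : G),
    (continuousAt_extChartAt (I := 𝓘(ℝ, EG)) (1 : G)) (ball_mem_nhds _ hε)] with g hg hg'
  -- A segment in the chart, reparametrised by a smooth step so that it is constant outside the unit
  -- interval.
  let p : ℝ → EG := fun t => κ 1 + Real.smoothTransition t • (κ g - κ 1)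
  have hp : ContDiff ℝ ∞ p :=
    contDiff_const.add (Real.smoothTransition.contDiff.smul contDiff_const)
  have hp' : ∀ t, p t ∈ κ.target := fun t => by
    refine hεκ ((convex_ball _ ε).add_smul_sub_mem (mem_ball_self hε) hg'
      ⟨Real.smoothTransition.nonneg t, Real.smoothTransition.le_one t⟩)
  refine ⟨fun t => κ.symm (p t), fun t => ?_, fun t ht => ?_, fun t ht => ?_⟩
  · exact ((contMDiffOn_extChartAt_symm (I := 𝓘(ℝ, EG)) (n := ∞) (1 : G)).comp_contMDiff
      hp.contMDiff hp') t
  · simp only [p, Real.smoothTransition.zero_of_nonpos ht, zero_smul, add_zero]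
    exact κ.left_inv (mem_extChartAt_source (1 : G))
  · simp only [p, Real.smoothTransition.one_of_one_le ht, one_smul, add_sub_cancel]
    exact κ.left_inv hg

variable {E : Type*} [NormedAddCommGroup E] [NormedSpace ℝ E]
  {M : Type*} [TopologicalSpace M] [ChartedSpace E M] [IsManifold 𝓘(ℝ, E) ∞ M]
  [MulAction G M] [ContMDiffSMul 𝓘(ℝ, EG) 𝓘(ℝ, E) ∞ G M]

/-- Write γ(s)x = (γ(s)γ(t)⁻¹)(γ(t)x), a path through 1 at s = t acting on a fixed point. The sign
comes from exp(−tξ) in the fundamental field. -/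
theorem hasDerivAt_path_smul {γ : ℝ → G} (hγ : ContMDiff 𝓘(ℝ, ℝ) 𝓘(ℝ, EG) ∞ γ)
    (f : SmoothFun E M) (x : M) (t : ℝ) :
    HasDerivAt (fun s => f (γ s • x))
      (-fundamentalVF (EG := EG) (G := G) (rightLogDeriv EG γ t) f (γ t • x)) t := by
  have h1 : MDifferentiableAt 𝓘(ℝ, ℝ) 𝓘(ℝ, EG) (fun s => γ s * (γ t)⁻¹) t :=
    (hγ.mul contMDiff_const).mdifferentiableAt (by simp)
  have h2 : HasMFDerivAt 𝓘(ℝ, EG) 𝓘(ℝ, ℝ) (fun g : G => f (g • (γ t • x))) (γ t * (γ t)⁻¹)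
      (mfderiv 𝓘(ℝ, EG) 𝓘(ℝ, ℝ) (fun g : G => f (g • (γ t • x))) (γ t * (γ t)⁻¹)) :=
    (mdifferentiableAt_orbit (EG := EG) (G := G) f (γ t • x) _).hasMFDerivAt
  let D : EG →L[ℝ] ℝ :=
    mfderiv 𝓘(ℝ, EG) 𝓘(ℝ, ℝ) (fun g : G => f (g • (γ t • x))) (γ t * (γ t)⁻¹)
  let Z : ℝ →L[ℝ] EG := mfderiv 𝓘(ℝ, ℝ) 𝓘(ℝ, EG) (fun s => γ s * (γ t)⁻¹) t
  have h3 : HasFDerivAt (fun s => f ((γ s * (γ t)⁻¹) • (γ t • x))) (D.comp Z) t :=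
    (HasMFDerivAt.comp (f := fun s => γ s * (γ t)⁻¹) t h2 h1.hasMFDerivAt).hasFDerivAt
  have h4 : ∀ g : G, g = 1 → ∀ v : EG,
      (mfderiv 𝓘(ℝ, EG) 𝓘(ℝ, ℝ) (fun g : G => f (g • (γ t • x))) g : EG → ℝ) v =
        -fundamentalVF (EG := EG) (G := G) v f (γ t • x) := by
    rintro _ rfl v
    exact (neg_neg _).symm
  have h5 := h3.hasDerivAt
  rw [ContinuousLinearMap.comp_apply, show D (Z 1) = _ from h4 _ (mul_inv_cancel _) _] at h5
  refine h5.congr_of_eventuallyEq (Filter.Eventually.of_forall fun s => ?_)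
  change f (γ s • x) = f ((γ s * (γ t)⁻¹) • γ t • x)
  rw [smul_smul, inv_mul_cancel_right]

end Paths

/-! ### Integration of the coefficients along a path -/

section Momentum

variable {EG : Type*} [NormedAddCommGroup EG] [NormedSpace ℝ EG] [FiniteDimensional ℝ EG]
  {G : Type*} [TopologicalSpace G] [ChartedSpace EG G] [Group G] [LieGroup 𝓘(ℝ, EG) ∞ G]
  {E : Type*} [NormedAddCommGroup E] [NormedSpace ℝ E]
  {M : Type*} [TopologicalSpace M] [ChartedSpace E M] [IsManifold 𝓘(ℝ, E) ∞ M]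
  [MulAction G M] [ContMDiffSMul 𝓘(ℝ, EG) 𝓘(ℝ, E) ∞ G M]
  {Ω : SymplecticForm E M} (μ : MomentMap EG G Ω)

namespace MomentMap

/-- Coefficients chosen separately for each ξ need not depend linearly on it; they are chosen on a
basis and extended linearly. -/
theorem exists_fundamentalVF_eq_pairing {f : SmoothFun E M}
    (hf : ∀ ξ : GroupLieAlgebra 𝓘(ℝ, EG) G, fundamentalVF ξ f ∈ μ.momentumIdeal) :
    ∃ B : M → EG →L[ℝ] EG, ContMDiff 𝓘(ℝ, E) 𝓘(ℝ, EG →L[ℝ] EG) ∞ B ∧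
      ∀ x (ξ : EG), fundamentalVF (EG := EG) (G := G) ξ f x = μ.pairing x (B x ξ) := by
  choose a ha haf using fun ξ => μ.mem_momentumIdeal_iff.1 (hf ξ)
  let b := Module.finBasis ℝ EG
  let c : Fin (Module.finrank ℝ EG) → EG →L[ℝ] ℝ := fun i =>
    LinearMap.toContinuousLinearMap (b.coord i)
  refine ⟨fun x => ∑ i, (c i).smulRight (a (b i) x), ?_, fun x ξ => ?_⟩
  · refine contMDiff_finsetSum fun i _ => ?_
    exact (ContinuousLinearMap.smulRightL ℝ EG EG (c i)).contDiff.contMDiff.comp (ha (b i))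
  · let D : EG →L[ℝ] ℝ := mfderiv 𝓘(ℝ, EG) 𝓘(ℝ, ℝ) (fun g : G => f (g • x)) 1
    have h1 : ∀ v : EG, fundamentalVF (EG := EG) (G := G) v f x = (-D) v := fun v => rfl
    rw [h1]
    conv_lhs => rw [← b.sum_repr ξ]
    rw [map_sum, sum_apply, map_sum]
    refine Finset.sum_congr rfl fun i _ => ?_
    rw [map_smul, ContinuousLinearMap.smulRight_apply, map_smul]
    exact congrArg (b.repr ξ i • ·) ((h1 (b i)).symm.trans (haf (b i) x))

/-- The fundamental theorem of calculus along t ↦ f(γ(t)x). The integrand is a pairing with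
μ(γ(t)x); equivariance makes it a pairing with μ(x), which no longer depends on t. -/
theorem translate_inv_sub_mem_of_path [FiniteDimensional ℝ E] [T2Space M] [ParacompactSpace M]
    {f : SmoothFun E M}
    (hf : ∀ ξ : GroupLieAlgebra 𝓘(ℝ, EG) G, fundamentalVF ξ f ∈ μ.momentumIdeal)
    {γ : ℝ → G} (hγ : ContMDiff 𝓘(ℝ, ℝ) 𝓘(ℝ, EG) ∞ γ) {g : G} (h0 : ∀ t ≤ 0, γ t = 1)
    (h1 : ∀ t, 1 ≤ t → γ t = g) : translate EG g⁻¹ f - f ∈ μ.momentumIdeal := by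
  obtain ⟨B, hB, hBf⟩ := μ.exists_fundamentalVF_eq_pairing hf
  let A : M → ℝ → EG := fun x t =>
    adjointCLM (γ t)⁻¹ (B (γ t • x) (rightLogDeriv EG γ t))
  -- The path is constant outside [0, 1], so the integral can run over the whole line with compactly
  -- supported integrand.
  have hA0 : ∀ x, ∀ t ∉ Icc (0 : ℝ) 1, A x t = 0 := by
    intro x t ht
    have : rightLogDeriv EG γ t = 0 := by
      rw [mem_Icc, not_and_or, not_le, not_le] at ht
      rcases ht with ht | ht
      · exact rightLogDeriv_eq_zero ((eventually_lt_nhds ht).mono fun s hs => h0 s hs.le)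
      · exact rightLogDeriv_eq_zero ((eventually_gt_nhds ht).mono fun s hs => h1 s hs.le)
    simp only [A, this, map_zero]
  have hA : ∀ (s : Set E) (p : E → M),
      ContMDiffOn 𝓘(ℝ, E) 𝓘(ℝ, E) ∞ p s →
      ContDiffOn ℝ ∞ (Function.uncurry fun y => A (p y)) (s ×ˢ univ) := by
    intro s p hp
    refine contMDiffOn_iff_contDiffOn.1 ?_
    have c1 : ContMDiffOn 𝓘(ℝ, E × ℝ) 𝓘(ℝ, EG) ∞ (fun q : E × ℝ => γ q.2) (s ×ˢ univ) :=
      (hγ.comp contDiff_snd.contMDiff).contMDiffOn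
    have c2 : ContMDiffOn 𝓘(ℝ, E × ℝ) 𝓘(ℝ, E) ∞ (fun q : E × ℝ => p q.1) (s ×ˢ univ) :=
      hp.comp contDiff_fst.contMDiff.contMDiffOn fun q hq => hq.1
    have c3 : ContMDiffOn 𝓘(ℝ, E × ℝ) 𝓘(ℝ, E) ∞ (fun q : E × ℝ => γ q.2 • p q.1) (s ×ˢ univ) :=
      (contMDiff_smul (I := 𝓘(ℝ, EG)) (I' := 𝓘(ℝ, E)) (n := ∞) (G := G)
        (M := M)).comp_contMDiffOn (c1.prodMk c2)
    have c4 : ContMDiffOn 𝓘(ℝ, E × ℝ) 𝓘(ℝ, EG) ∞ (fun q : E × ℝ => rightLogDeriv EG γ q.2)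
        (s ×ˢ univ) :=
      ((contDiff_rightLogDeriv hγ).comp contDiff_snd).contMDiff.contMDiffOn
    exact ((contMDiff_adjointCLM (EG := EG) (G := G)).comp_contMDiffOn c1.inv).clm_apply
      ((hB.comp_contMDiffOn c3).clm_apply c4)
  have hcont : ∀ x, Continuous (A x) := fun x => by
    have h2 := (hA univ (fun _ => x) contMDiffOn_const).continuousOn
    rw [univ_prod_univ, continuousOn_univ] at h2
    exact h2.comp (Continuous.prodMk_right 0)
  have hint : ∀ x, f (g • x) - f x = μ.pairing x (-∫ t, A x t) := by
    intro x
    have h2 : ∀ t ∈ uIcc (0 : ℝ) 1, HasDerivAt (fun s => f (γ s • x)) (-μ.pairing x (A x t)) t := by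
      intro t _
      have h3 := hasDerivAt_path_smul hγ f x t
      rw [hBf] at h3
      have h4 := μ.pairing_inv_smul (γ t)⁻¹ x (B (γ t • x) (rightLogDeriv EG γ t))
      rw [inv_inv] at h4
      rwa [h4] at h3
    have h3 := intervalIntegral.integral_eq_sub_of_hasDerivAt h2
      (((μ.pairing x).continuous.comp (hcont x)).neg.intervalIntegrable 0 1)
    rw [h1 1 le_rfl, h0 0 le_rfl, one_smul] at h3
    rw [← h3, intervalIntegral.integral_neg, map_neg,
      ContinuousLinearMap.intervalIntegral_comp_comm _ ((hcont x).intervalIntegrable 0 1),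
      intervalIntegral.integral_of_le zero_le_one, ← integral_Icc_eq_integral_Ioc,
      setIntegral_eq_integral_of_forall_compl_eq_zero fun t ht => hA0 x t ht]
  refine μ.mem_momentumIdeal_of_local fun x₀ => ?_
  set c := extChartAt 𝓘(ℝ, E) x₀ with hc
  refine ⟨c.source, extChartAt_source_mem_nhds x₀, fun x => -∫ t, A x t, ?_, fun x _ => ?_⟩
  · have h2 := contDiffOn_integral_of_support (A := fun y => A (c.symm y))
      (isOpen_extChartAt_target (I := 𝓘(ℝ, E)) x₀)
      (hA _ c.symm (contMDiffOn_extChartAt_symm x₀)) fun y _ => hA0 (c.symm y)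
    have h3 := (contMDiffOn_iff_contDiffOn.2 h2.neg).comp
      ((contMDiffOn_extChartAt (I := 𝓘(ℝ, E)) (n := ∞) (x := x₀)).mono
      fun x hx => by rwa [hc, extChartAt_source] at hx) fun x hx => c.map_source hx
    refine h3.congr fun x hx => ?_
    simp only [Function.comp_apply]
    rw [← hc, c.left_inv hx]
  · rw [← hint]
    change translate EG g⁻¹ f x - f x = _
    rw [translate_apply, inv_inv]

/-- If `f` is invariant modulo the momentum ideal under the Lie algebra of a connected group, then
it is so under the group. -/
theorem translate_sub_mem_momentumIdeal [FiniteDimensional ℝ E] [T2Space M] [ParacompactSpace M]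
    [ConnectedSpace G] {f : SmoothFun E M}
    (hf : ∀ ξ : GroupLieAlgebra 𝓘(ℝ, EG) G, fundamentalVF ξ f ∈ μ.momentumIdeal) (g : G) :
    translate EG g f - f ∈ μ.momentumIdeal := by
  have := topologicalGroup_of_lieGroup 𝓘(ℝ, EG) ∞ (G := G)
  have hmul : ∀ g h : G, translate EG (g * h) f = translate EG g (translate EG h f) := by
    intro g h
    ext x
    simp only [translate_apply, mul_inv_rev, mul_smul]
  have hone : translate EG (1 : G) f = f := by
    ext x
    rw [translate_apply, inv_one, one_smul]
  -- The elements fixing the class of `f` form a subgroup containing a neighbourhood of 1, hence a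
  -- clopen one, and `G` is connected.
  let H : Subgroup G :=
    { carrier := {g | translate EG g f - f ∈ μ.momentumIdeal}
      one_mem' := by
        change translate EG (1 : G) f - f ∈ μ.momentumIdeal
        rw [hone, sub_self]
        exact Submodule.zero_mem _
      mul_mem' := by
        intro g h hg hh
        change translate EG (g * h) f - f ∈ μ.momentumIdeal
        have h1 : translate EG g (translate EG h f - f) ∈ μ.momentumIdeal :=
          μ.momentumIdeal_le_comap g hh
        have h2 := Submodule.add_mem _ h1 hg
        rwa [map_sub, sub_add_sub_cancel, ← hmul] at h2
      inv_mem' := by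
        intro g hg
        change translate EG g⁻¹ f - f ∈ μ.momentumIdeal
        have h1 : translate EG g⁻¹ (translate EG g f - f) ∈ μ.momentumIdeal :=
          μ.momentumIdeal_le_comap g⁻¹ hg
        rw [map_sub, ← hmul, inv_mul_cancel, hone] at h1
        have h2 := Submodule.neg_mem _ h1
        rwa [neg_sub] at h2 }
  have hH : (H : Set G) ∈ 𝓝 (1 : G) := by
    filter_upwards [eventually_exists_smooth_path (EG := EG) (G := G)] with g hg
    obtain ⟨γ, hγ, h0, h1⟩ := hg
    have h2 : g⁻¹ ∈ H := μ.translate_inv_sub_mem_of_path hf hγ h0 h1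
    exact (Subgroup.inv_mem_iff H).1 h2
  have hopen : IsOpen (H : Set G) := H.isOpen_of_mem_nhds hH
  have htop : (H : Set G) = univ :=
    IsClopen.eq_univ ⟨H.isClosed_of_isOpen hopen, hopen⟩ ⟨1, H.one_mem⟩
  exact (htop.symm.subset (mem_univ g) :)

end MomentMap

end Momentum

end ObservableReduction

namespace ObservableReduction

/-! ### Reduction of Poisson algebras -/

section Reduction

variable {A B C : Type*} [CommRing A] [Algebra ℝ A] [CommRing B] [Algebra ℝ B]
  [CommRing C] [Algebra ℝ C]

theorem PoissonBracket.skew (β : PoissonBracket A) (a b : A) :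
    β.bracket a b = -β.bracket b a := by
  have h := β.self_eq_zero (a + b)
  simp only [map_add, LinearMap.add_apply, β.self_eq_zero, zero_add, add_zero] at h
  exact eq_neg_of_add_eq_zero_right h

/-- The Poisson bracket induced on a quotient of a Poisson subalgebra. -/
theorem PoissonBracket.exists_reduced (β : PoissonBracket A) (S : Subalgebra ℝ A)
    (hS : ∀ f ∈ S, ∀ h ∈ S, β.bracket f h ∈ S) (π : S →ₐ[ℝ] B) (hπ : Function.Surjective π)
    (hK : ∀ f k : S, π k = 0 → π ⟨β.bracket f k, hS _ f.2 _ k.2⟩ = 0) :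
    ∃ P : PoissonBracket B, ∀ f h : S, ∃ hk : β.bracket f h ∈ S,
      P.bracket (π f) (π h) = π ⟨β.bracket f h, hk⟩ := by
  let b : S →ₗ[ℝ] S →ₗ[ℝ] S := LinearMap.mk₂ ℝ
    (fun f h => ⟨β.bracket f h, hS _ f.2 _ h.2⟩)
    (fun f f' h => Subtype.ext (by simp)) (fun c f h => Subtype.ext (by simp))
    (fun f h h' => Subtype.ext (by simp)) (fun c f h => Subtype.ext (by simp))
  have hskew : ∀ f h, b f h = -b h f := fun f h => Subtype.ext (β.skew f h)
  have hK' : ∀ f k : S, π k = 0 → π (b f k) = 0 := hK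
  -- By skew symmetry the kernel condition in one argument gives independence of representatives in
  -- both.
  have hwd : ∀ f f' h h' : S, π f = π f' → π h = π h' → π (b f h) = π (b f' h') := by
    intro f f' h h' hf hh
    have h1 := hK' f (h - h') (by rw [map_sub, hh, sub_self])
    have h2 := hK' h' (f - f') (by rw [map_sub, hf, sub_self])
    rw [map_sub, map_sub, sub_eq_zero] at h1 h2
    rw [h1, hskew f, hskew f', map_neg, map_neg, h2]
  -- This section is not linear; bilinearity of the reduced bracket comes from `hwd`.
  let σ := Function.surjInv hπ
  have hσ : ∀ a, π (σ a) = a := Function.surjInv_eq hπ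
  have hb : ∀ f h, π (b (σ (π f)) (σ (π h))) = π (b f h) := fun f h =>
    hwd _ _ _ _ (hσ _) (hσ _)
  let p : B →ₗ[ℝ] B →ₗ[ℝ] B := LinearMap.mk₂ ℝ (fun x y => π (b (σ x) (σ y)))
    (fun x x' y => by
      rw [← map_add π, ← LinearMap.add_apply, ← map_add b]
      exact hwd _ _ _ _ (by rw [map_add, hσ, hσ, hσ]) rfl)
    (fun c x y => by
      rw [← map_smul π, ← LinearMap.smul_apply, ← map_smul b]
      exact hwd _ _ _ _ (by rw [map_smul, hσ, hσ]) rfl)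
    (fun x y y' => by
      rw [← map_add π, ← map_add (b (σ x))]
      exact hwd _ _ _ _ rfl (by rw [map_add, hσ, hσ, hσ]))
    (fun c x y => by
      rw [← map_smul π, ← map_smul (b (σ x))]
      exact hwd _ _ _ _ rfl (by rw [map_smul, hσ, hσ]))
  have hp : ∀ f h, p (π f) (π h) = π (b f h) := hb
  refine ⟨⟨p, fun x => ?_, fun x y z => ?_, fun x y z => ?_⟩,
    fun f h => ⟨hS _ f.2 _ h.2, hp f h⟩⟩
  · obtain ⟨f, rfl⟩ := hπ x
    rw [hp, show b f f = 0 from Subtype.ext (β.self_eq_zero f), map_zero]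
  · obtain ⟨f, rfl⟩ := hπ x
    obtain ⟨h, rfl⟩ := hπ y
    obtain ⟨k, rfl⟩ := hπ z
    simp only [hp]
    rw [← map_add, ← map_add, show b f (b h k) + b h (b k f) + b k (b f h) = 0 from
      Subtype.ext (β.jacobi f h k), map_zero]
  · obtain ⟨f, rfl⟩ := hπ x
    obtain ⟨h, rfl⟩ := hπ y
    obtain ⟨k, rfl⟩ := hπ z
    rw [← map_mul, hp, hp, hp, ← map_mul, ← map_mul, ← map_add]
    exact congrArg π (Subtype.ext (β.leibniz f h k))

/-- Comparison of two reductions of a Poisson algebra. -/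
theorem exists_poissonMorphism_of_le {β : PoissonBracket A} {S T : Subalgebra ℝ A}
    {π : S →ₐ[ℝ] B} (hπ : Function.Surjective π) {ρ : T →ₐ[ℝ] C}
    {P : PoissonBracket B} {Q : PoissonBracket C}
    (hP : ∀ f h : S, ∃ hk : β.bracket f h ∈ S, P.bracket (π f) (π h) = π ⟨_, hk⟩)
    (hQ : ∀ f h : T, ∃ hk : β.bracket f h ∈ T, Q.bracket (ρ f) (ρ h) = ρ ⟨_, hk⟩)
    (hST : S ≤ T) (hker : ∀ f : S, π f = 0 → ρ (Subalgebra.inclusion hST f) = 0) :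
    ∃ Φ : B →ₐ[ℝ] C, IsPoissonMorphism P Q Φ ∧
      ∀ f : S, Φ (π f) = ρ (Subalgebra.inclusion hST f) := by
  let l : S ⧸ RingHom.ker π →ₐ[ℝ] C := Ideal.Quotient.liftₐ (RingHom.ker π)
    (ρ.comp (Subalgebra.inclusion hST)) fun f hf => hker f hf
  let Φ : B →ₐ[ℝ] C := l.comp (Ideal.quotientKerAlgEquivOfSurjective hπ).symm.toAlgHom
  have hΦ : ∀ f : S, Φ (π f) = ρ (Subalgebra.inclusion hST f) := fun f => by
    have h : (Ideal.quotientKerAlgEquivOfSurjective hπ).symm (π f) =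
        Ideal.Quotient.mk (RingHom.ker π) f := by
      rw [AlgEquiv.symm_apply_eq]
      rfl
    change l ((Ideal.quotientKerAlgEquivOfSurjective hπ).symm (π f)) = _
    rw [h]
    rfl
  refine ⟨Φ, fun x y => ?_, hΦ⟩
  obtain ⟨f, rfl⟩ := hπ x
  obtain ⟨h, rfl⟩ := hπ y
  obtain ⟨h1, h2⟩ := hP f h
  obtain ⟨h3, h4⟩ := hQ (Subalgebra.inclusion hST f) (Subalgebra.inclusion hST h)
  rw [h2, hΦ, hΦ, hΦ, h4]
  rfl

theorem PoissonBracket.exists_reduced_quotient (β : PoissonBracket A) (S : Subalgebra ℝ A)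
    (hS : ∀ f ∈ S, ∀ h ∈ S, β.bracket f h ∈ S) (K : Ideal S)
    (hK : ∀ f : S, ∀ k ∈ K, ⟨β.bracket f k, hS _ f.2 _ k.2⟩ ∈ K) :
    ∃ P : PoissonBracket (S ⧸ K), ∀ f h : S, ∃ hk : β.bracket f h ∈ S,
      P.bracket (Ideal.Quotient.mk K f) (Ideal.Quotient.mk K h) = Ideal.Quotient.mk K ⟨_, hk⟩ :=
  β.exists_reduced S hS (Ideal.Quotient.mkₐ ℝ K) Ideal.Quotient.mk_surjective fun f k hk =>
    Ideal.Quotient.eq_zero_iff_mem.2 (hK f k (Ideal.Quotient.eq_zero_iff_mem.1 hk))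

theorem exists_poissonMorphism_to_quotient {β : PoissonBracket A} {S T : Subalgebra ℝ A}
    {π : S →ₐ[ℝ] B} (hπ : Function.Surjective π) {K : Ideal T}
    {P : PoissonBracket B} {Q : PoissonBracket (T ⧸ K)}
    (hP : ∀ f h : S, ∃ hk : β.bracket f h ∈ S, P.bracket (π f) (π h) = π ⟨_, hk⟩)
    (hQ : ∀ f h : T, ∃ hk : β.bracket f h ∈ T,
      Q.bracket (Ideal.Quotient.mk K f) (Ideal.Quotient.mk K h) = Ideal.Quotient.mk K ⟨_, hk⟩)
    (hST : S ≤ T) (hker : ∀ f : S, π f = 0 → Subalgebra.inclusion hST f ∈ K) :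
    ∃ Φ : B →ₐ[ℝ] T ⧸ K, IsPoissonMorphism P Q Φ ∧
      ∀ f : S, Φ (π f) = Ideal.Quotient.mk K (Subalgebra.inclusion hST f) :=
  exists_poissonMorphism_of_le hπ (ρ := Ideal.Quotient.mkₐ ℝ K) hP hQ hST fun f hf =>
    Ideal.Quotient.eq_zero_iff_mem.2 (hker f hf)

theorem exists_poissonMorphism_from_quotient {β : PoissonBracket A} {S T : Subalgebra ℝ A}
    {K : Ideal S} {ρ : T →ₐ[ℝ] C} {P : PoissonBracket (S ⧸ K)} {Q : PoissonBracket C}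
    (hP : ∀ f h : S, ∃ hk : β.bracket f h ∈ S,
      P.bracket (Ideal.Quotient.mk K f) (Ideal.Quotient.mk K h) = Ideal.Quotient.mk K ⟨_, hk⟩)
    (hQ : ∀ f h : T, ∃ hk : β.bracket f h ∈ T, Q.bracket (ρ f) (ρ h) = ρ ⟨_, hk⟩)
    (hST : S ≤ T) (hker : ∀ f ∈ K, ρ (Subalgebra.inclusion hST f) = 0) :
    ∃ Φ : S ⧸ K →ₐ[ℝ] C, IsPoissonMorphism P Q Φ ∧
      ∀ f : S, Φ (Ideal.Quotient.mk K f) = ρ (Subalgebra.inclusion hST f) :=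
  exists_poissonMorphism_of_le (π := Ideal.Quotient.mkₐ ℝ K) Ideal.Quotient.mk_surjective hP hQ
    hST fun f hf => hker f (Ideal.Quotient.eq_zero_iff_mem.1 hf)

end Reduction

/-! ### The Poisson algebra of a symplectic manifold -/

section

variable {E : Type*} [NormedAddCommGroup E] [NormedSpace ℝ E]
  {M : Type*} [TopologicalSpace M] [ChartedSpace E M]

theorem VField.lie_lie (X Y Z : VField E M) : ⁅⁅X, Y⁆, Z⁆ = ⁅X, ⁅Y, Z⁆⁆ - ⁅Y, ⁅X, Z⁆⁆ :=
  _root_.lie_lie X Y Z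

end

namespace SymplecticForm

variable {E : Type*} [NormedAddCommGroup E] [NormedSpace ℝ E]
  {M : Type*} [TopologicalSpace M] [ChartedSpace E M] (Ω : SymplecticForm E M)

theorem form_skew (X Y : VField E M) : Ω.form X Y = -Ω.form Y X := by
  have h := Ω.alternating (X + Y)
  simp only [map_add, LinearMap.add_apply, Ω.alternating, zero_add, add_zero] at h
  exact eq_neg_of_add_eq_zero_right h

theorem bracket_eq (f h : SmoothFun E M) : Ω.bracket f h = Ω.hamVF f h := by
  rw [bracket, form_skew, form_hamVF_apply, neg_neg]

theorem bracket_skew (f h : SmoothFun E M) : Ω.bracket f h = -Ω.bracket h f :=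
  Ω.form_skew _ _

theorem hamVF_smul_real (c : ℝ) (f : SmoothFun E M) : Ω.hamVF (c • f) = c • Ω.hamVF f := by
  rw [Algebra.smul_def, hamVF_mul, hamVF_algebraMap, smul_zero, add_zero]
  ext1 k
  rw [Derivation.smul_apply, Derivation.smul_apply, smul_eq_mul, ← Algebra.smul_def]

theorem hamVF_sub (f h : SmoothFun E M) : Ω.hamVF (f - h) = Ω.hamVF f - Ω.hamVF h := by
  rw [eq_sub_iff_add_eq, ← hamVF_add, sub_add_cancel]

theorem hamVF_zero : Ω.hamVF 0 = 0 := by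
  rw [← sub_self (0 : SmoothFun E M), hamVF_sub, sub_self]

theorem hamVF_neg (f : SmoothFun E M) : Ω.hamVF (-f) = -Ω.hamVF f := by
  rw [eq_neg_iff_add_eq_zero, ← hamVF_add, neg_add_cancel, hamVF_zero]

/-- Closedness of Ω on (v_f, v_h, Y). Every term except Ω([v_f, v_h], Y) has a Hamiltonian field as
an argument and reduces to derivatives of f and h. This identity yields the Jacobi identity. -/
theorem hamVF_bracket (f h : SmoothFun E M) :
    Ω.hamVF (Ω.bracket f h) = ⁅Ω.hamVF f, Ω.hamVF h⁆ := by
  refine (Ω.eq_hamVF fun Y => ?_).symm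
  have h1 := Ω.closed (Ω.hamVF f) (Ω.hamVF h) Y
  have h2 := Ω.bracket_skew f h
  rw [bracket_eq, bracket_eq] at h2
  rw [form_skew Ω Y, form_skew Ω ⁅Ω.hamVF h, Y⁆, form_skew Ω ⁅Y, Ω.hamVF f⁆] at h1
  simp only [form_hamVF_apply, Derivation.commutator_apply, neg_neg, map_neg] at h1
  rw [bracket_eq]
  rw [h2, map_neg] at h1 ⊢
  linear_combination -h1

/-- The Poisson algebra `C^∞(M, Ω)`. -/
noncomputable def poisson : PoissonBracket (SmoothFun E M) where
  bracket := LinearMap.mk₂ ℝ Ω.bracket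
    (fun f f' h => by simp only [bracket_eq, hamVF_add, Derivation.add_apply])
    (fun c f h => by simp only [bracket_eq, hamVF_smul_real, Derivation.smul_apply])
    (fun f h h' => by simp only [bracket_eq, map_add])
    (fun c f h => by simp only [bracket_eq, Derivation.map_smul])
  self_eq_zero f := Ω.alternating _
  jacobi a b c := by
    change Ω.bracket a (Ω.bracket b c) + Ω.bracket b (Ω.bracket c a) +
      Ω.bracket c (Ω.bracket a b) = 0
    rw [Ω.bracket_skew c (Ω.bracket a b), Ω.bracket_skew c a]
    simp only [bracket_eq _ _ c, hamVF_bracket, Derivation.commutator_apply]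
    rw [bracket_eq, bracket_eq, map_neg]
    ring
  leibniz a b c := by
    change Ω.bracket a (b * c) = Ω.bracket a b * c + b * Ω.bracket a c
    simp only [bracket_eq, Derivation.leibniz, smul_eq_mul]
    ring

theorem poisson_bracket (f h : SmoothFun E M) : Ω.poisson.bracket f h = Ω.bracket f h := rfl

end SymplecticForm

section Action

variable {EG : Type*} [NormedAddCommGroup EG] [NormedSpace ℝ EG]
  {G : Type*} [TopologicalSpace G] [ChartedSpace EG G] [Group G] [LieGroup 𝓘(ℝ, EG) ∞ G]
  {E : Type*} [NormedAddCommGroup E] [NormedSpace ℝ E]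
  {M : Type*} [TopologicalSpace M] [ChartedSpace E M] [IsManifold 𝓘(ℝ, E) ∞ M]
  [MulAction G M] [ContMDiffSMul 𝓘(ℝ, EG) 𝓘(ℝ, E) ∞ G M] {Ω : SymplecticForm E M}

/-! ### The `L_∞`-reduction is a Poisson algebra -/

variable (EG G Ω) in
theorem linftyClass_surjective (N : Set M) :
    Function.Surjective (linftyClass (EG := EG) (G := G) (Ω := Ω) (N := N)) :=
  Ideal.Quotient.mk_surjective

theorem linftyClass_eq_zero_iff {N : Set M} (f : reducibleObservables EG G Ω N) :
    linftyClass f = 0 ↔ f ∈ vanishingObservables EG G Ω N :=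
  Ideal.Quotient.eq_zero_iff_mem

/-- On generators this is the hypothesis, and a multiple aY contributes the extra vertical term
X(a)Y. Brackets with fields vanishing on N vanish on N because X preserves I_N. -/
theorem lie_mem_verticalVF {N : Set M} {X : VField E M}
    (hX : ∀ h ∈ constraintIdeal (E := E) N, X h ∈ constraintIdeal (E := E) N)
    (hXξ : ∀ ξ : GroupLieAlgebra 𝓘(ℝ, EG) G, ⁅X, (fundamentalVF ξ : VField E M)⁆ ∈ verticalVF EG G N)
    {Y : VField E M} (hY : Y ∈ verticalVF EG G N) : ⁅X, Y⁆ ∈ verticalVF EG G N := by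
  have hadd : ∀ Y Z : VField E M, ⁅X, Y + Z⁆ = ⁅X, Y⁆ + ⁅X, Z⁆ := fun Y Z => lie_add X Y Z
  obtain ⟨Y, hY', Z, hZ, rfl⟩ := Submodule.mem_sup.1 hY
  clear hY
  rw [hadd]
  refine Submodule.add_mem _ ?_ (Submodule.mem_sup_right fun k => ?_)
  · induction hY' using Submodule.span_induction with
    | mem Y hY =>
      obtain ⟨ξ, rfl⟩ := hY
      exact hXξ ξ
    | zero =>
      rw [show ⁅X, (0 : VField E M)⁆ = 0 from lie_zero X]
      exact Submodule.zero_mem _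
    | add Y Y' _ _ h h' =>
      rw [hadd]
      exact Submodule.add_mem _ h h'
    | smul a Y hY h =>
      have e : ⁅X, a • Y⁆ = X a • Y + a • ⁅X, Y⁆ := by
        ext1 k
        simp only [Derivation.commutator_apply, Derivation.smul_apply, Derivation.add_apply,
          smul_eq_mul, Derivation.leibniz]
        ring
      rw [e]
      exact Submodule.add_mem _ (Submodule.smul_mem _ _ (Submodule.mem_sup_left hY))
        (Submodule.smul_mem _ _ h)
  · rw [Derivation.commutator_apply]
    exact Submodule.sub_mem _ (hX _ (hZ k)) (hZ _)

theorem lie_hamVF_mem_verticalVF {N : Set M} {f : SmoothFun E M}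
    (hf : f ∈ reducibleObservables EG G Ω N) {Y : VField E M} (hY : Y ∈ verticalVF EG G N) :
    ⁅Ω.hamVF f, Y⁆ ∈ verticalVF EG G N :=
  lie_mem_verticalVF hf.2.1 hf.2.2 hY

namespace MomentMap

variable (μ : MomentMap EG G Ω)

theorem hamVF_momentum (ξ : GroupLieAlgebra 𝓘(ℝ, EG) G) :
    Ω.hamVF (μ.momentum ξ) = fundamentalVF ξ := by
  refine (Ω.eq_hamVF fun Y => ?_).symm
  rw [show Y (μ.momentum ξ) = _ from μ.differential_eq ξ Y, neg_neg]

theorem fundamentalVF_eq_bracket (ξ : GroupLieAlgebra 𝓘(ℝ, EG) G) (f : SmoothFun E M) :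
    fundamentalVF ξ f = Ω.bracket (μ.momentum ξ) f := by
  rw [Ω.bracket_eq, hamVF_momentum]

/-- ξ_M acts as {μ_ξ, ·}, so this is the Jacobi identity. -/
theorem fundamentalVF_bracket (μ : MomentMap EG G Ω) (ξ : GroupLieAlgebra 𝓘(ℝ, EG) G) (f h : SmoothFun E M) :
    fundamentalVF ξ (Ω.bracket f h) =
      Ω.bracket f (fundamentalVF ξ h) - Ω.bracket h (fundamentalVF ξ f) := by
  have h1 := Ω.poisson.jacobi (μ.momentum ξ) f h
  simp only [Ω.poisson_bracket] at h1
  rw [Ω.bracket_skew h, Ω.bracket_eq f (-_), map_neg, ← Ω.bracket_eq] at h1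
  simp only [μ.fundamentalVF_eq_bracket]
  linear_combination h1

theorem bracket_mem_reducibleObservables (μ : MomentMap EG G Ω) {N : Set M} {f h : SmoothFun E M}
    (hf : f ∈ reducibleObservables EG G Ω N) (hh : h ∈ reducibleObservables EG G Ω N) :
    Ω.bracket f h ∈ reducibleObservables EG G Ω N := by
  refine ⟨fun ξ => ?_, fun k hk => ?_, fun ξ => ?_⟩
  · rw [μ.fundamentalVF_bracket, Ω.bracket_eq, Ω.bracket_eq]
    exact Submodule.sub_mem _ (hf.2.1 _ (hh.1 ξ)) (hh.2.1 _ (hf.1 ξ))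
  · rw [Ω.hamVF_bracket, Derivation.commutator_apply]
    exact Submodule.sub_mem _ (hf.2.1 _ (hh.2.1 k hk)) (hh.2.1 _ (hf.2.1 k hk))
  · rw [Ω.hamVF_bracket, VField.lie_lie]
    exact Submodule.sub_mem _ (lie_hamVF_mem_verticalVF hf (hh.2.2 ξ))
      (lie_hamVF_mem_verticalVF hh (hf.2.2 ξ))

theorem exists_linftyBracket (μ : MomentMap EG G Ω) (N : Set M) :
    ∃ Q : PoissonBracket (LinftyReduction EG G Ω N), IsLinftyBracket Q := by
  obtain ⟨Q, hQ⟩ := Ω.poisson.exists_reduced_quotient (reducibleObservables EG G Ω N)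
    (fun f hf h hh => μ.bracket_mem_reducibleObservables hf hh) (vanishingObservables EG G Ω N)
    (fun f k hk => by
      refine ⟨?_, ?_⟩
      · change Ω.bracket f k ∈ _
        rw [Ω.bracket_eq]
        exact f.2.2.1 _ hk.1
      · change Ω.hamVF (Ω.bracket f k) ∈ _
        rw [Ω.hamVF_bracket]
        exact lie_hamVF_mem_verticalVF f.2 hk.2)
  exact ⟨Q, hQ⟩

/-! ### The momentum ideal and the vertical vector fields -/

theorem momentumIdeal_le_constraintIdeal : μ.momentumIdeal ≤ constraintIdeal μ.zeroLevel := by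
  refine Ideal.span_le.2 ?_
  rintro _ ⟨ξ, rfl⟩ x hx
  exact DFunLike.congr_fun (show μ.toFun x = 0 from hx) ξ

/-- In v_{ai} = a v_i + i v_a the second term vanishes on N when i ∈ I_μ, and v_{μ_ξ} = ξ_M. -/
theorem hamVF_mem_verticalVF {f : SmoothFun E M} (hf : f ∈ μ.momentumIdeal) :
    Ω.hamVF f ∈ verticalVF EG G μ.zeroLevel := by
  induction hf using Submodule.span_induction with
  | mem f hf =>
    obtain ⟨ξ, rfl⟩ := hf
    rw [hamVF_momentum]
    exact Submodule.mem_sup_left (Submodule.subset_span ⟨ξ, rfl⟩)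
  | zero =>
    rw [Ω.hamVF_zero]
    exact Submodule.zero_mem _
  | add f h _ _ hf hh =>
    rw [Ω.hamVF_add]
    exact Submodule.add_mem _ hf hh
  | smul a f hf h =>
    rw [smul_eq_mul, Ω.hamVF_mul]
    exact Submodule.add_mem _ (Submodule.smul_mem _ _ h) (Submodule.mem_sup_right fun k =>
      Ideal.mul_mem_right _ _ (μ.momentumIdeal_le_constraintIdeal hf))

/-- Converse to `hamVF_mem_verticalVF`: modulo fields vanishing on N, Σ a_j ξ_j is the Hamiltonian
field of Σ a_j μ_{ξ_j}. -/
theorem exists_sub_hamVF_mem_vanishingVF {X : VField E M}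
    (hX : X ∈ verticalVF EG G μ.zeroLevel) :
    ∃ i ∈ μ.momentumIdeal, X - Ω.hamVF i ∈ vanishingVF μ.zeroLevel := by
  obtain ⟨Y, hY, Z, hZ, rfl⟩ := Submodule.mem_sup.1 hX
  suffices h : ∃ i ∈ μ.momentumIdeal, Y - Ω.hamVF i ∈ vanishingVF μ.zeroLevel by
    obtain ⟨i, hi, h⟩ := h
    refine ⟨i, hi, ?_⟩
    rw [add_sub_right_comm]
    exact Submodule.add_mem _ h hZ
  clear hX
  induction hY using Submodule.span_induction with
  | mem Y hY =>
    obtain ⟨ξ, rfl⟩ := hY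
    refine ⟨μ.momentum ξ, Ideal.subset_span ⟨ξ, rfl⟩, ?_⟩
    rw [hamVF_momentum, sub_self]
    exact Submodule.zero_mem _
  | zero =>
    refine ⟨0, Submodule.zero_mem _, ?_⟩
    rw [Ω.hamVF_zero, sub_zero]
    exact Submodule.zero_mem _
  | add Y Y' _ _ h h' =>
    obtain ⟨i, hi, h⟩ := h
    obtain ⟨j, hj, h'⟩ := h'
    refine ⟨i + j, Submodule.add_mem _ hi hj, ?_⟩
    rw [Ω.hamVF_add, add_sub_add_comm]
    exact Submodule.add_mem _ h h'
  | smul a Y _ h =>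
    obtain ⟨i, hi, h⟩ := h
    refine ⟨a * i, Ideal.mul_mem_left _ _ hi, ?_⟩
    rw [Ω.hamVF_mul, ← sub_sub, ← smul_sub]
    exact Submodule.sub_mem _ (Submodule.smul_mem _ _ h) fun k =>
      Ideal.mul_mem_right _ _ (μ.momentumIdeal_le_constraintIdeal hi)

/-- Subtracting a suitable i ∈ I_μ leaves a function in I_N whose Hamiltonian field vanishes on N,
that is, an element of I_N ∩ 𝒬. -/
theorem mem_momentumIdeal_of_hamVF_mem_verticalVF
    (hQ : (constraintIdeal (E := E) μ.zeroLevel : Set (SmoothFun E M)) ∩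
      casimir Ω μ.zeroLevel ⊆ (μ.momentumIdeal : Set (SmoothFun E M)))
    {f : SmoothFun E M} (hf : f ∈ constraintIdeal (E := E) μ.zeroLevel)
    (hv : Ω.hamVF f ∈ verticalVF EG G μ.zeroLevel) : f ∈ μ.momentumIdeal := by
  obtain ⟨i, hi, h⟩ := μ.exists_sub_hamVF_mem_vanishingVF hv
  rw [← Ω.hamVF_sub] at h
  have h1 : f - i ∈ μ.momentumIdeal :=
    hQ ⟨Submodule.sub_mem _ hf (μ.momentumIdeal_le_constraintIdeal hi), fun k => by
      rw [Ω.bracket_eq]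
      exact h k⟩
  have h2 := Submodule.add_mem _ h1 hi
  rwa [sub_add_cancel] at h2

/-! ### The Śniatycki–Weinstein reduction is a Poisson algebra -/

theorem bracket_mem_momentumIdeal {f : SmoothFun E M}
    (hf : ∀ ξ : GroupLieAlgebra 𝓘(ℝ, EG) G, fundamentalVF ξ f ∈ μ.momentumIdeal)
    {i : SmoothFun E M} (hi : i ∈ μ.momentumIdeal) : Ω.bracket f i ∈ μ.momentumIdeal := by
  induction hi using Submodule.span_induction with
  | mem i hi =>
    obtain ⟨ξ, rfl⟩ := hi
    rw [Ω.bracket_skew, ← fundamentalVF_eq_bracket]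
    exact Submodule.neg_mem _ (hf ξ)
  | zero =>
    rw [Ω.bracket_eq, map_zero]
    exact Submodule.zero_mem _
  | add i j _ _ hi hj =>
    rw [Ω.bracket_eq, map_add, ← Ω.bracket_eq, ← Ω.bracket_eq]
    exact Submodule.add_mem _ hi hj
  | smul a i hi h =>
    rw [Ω.bracket_eq, smul_eq_mul, Derivation.leibniz, ← Ω.bracket_eq, ← Ω.bracket_eq]
    exact Submodule.add_mem _ (Ideal.mul_mem_left _ _ h) (Ideal.mul_mem_right _ _ hi)

theorem swClass_mem_iff_translate {f : SmoothFun E M} :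
    μ.swClass f ∈ μ.swReduction ↔ ∀ g : G, translate EG g f - f ∈ μ.momentumIdeal :=
  forall_congr' fun _ => Ideal.Quotient.eq

/-- The point where the analysis enters; afterwards invariance is handled through brackets with
momenta. -/
theorem swClass_mem_iff [FiniteDimensional ℝ EG] [T2Space G] [ConnectedSpace G]
    [FiniteDimensional ℝ E] [T2Space M] [ParacompactSpace M] {f : SmoothFun E M} :
    μ.swClass f ∈ μ.swReduction ↔
      ∀ ξ : GroupLieAlgebra 𝓘(ℝ, EG) G, fundamentalVF ξ f ∈ μ.momentumIdeal := by
  rw [swClass_mem_iff_translate]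
  exact ⟨fun h => μ.fundamentalVF_mem_momentumIdeal h, fun h => μ.translate_sub_mem_momentumIdeal h⟩

/-- The smooth functions with invariant class modulo the momentum ideal. -/
noncomputable def invariantClasses : Subalgebra ℝ (SmoothFun E M) :=
  μ.swReduction.comap (Ideal.Quotient.mkₐ ℝ μ.momentumIdeal)

/-- The projection of the functions with invariant class to the Śniatycki–Weinstein reduction. -/
noncomputable def toSWReduction : μ.invariantClasses →ₐ[ℝ] μ.swReduction :=
  ((Ideal.Quotient.mkₐ ℝ μ.momentumIdeal).comp μ.invariantClasses.val).codRestrict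
    μ.swReduction fun f => f.2

theorem toSWReduction_surjective : Function.Surjective μ.toSWReduction := by
  rintro ⟨q, hq⟩
  obtain ⟨f, rfl⟩ := Ideal.Quotient.mk_surjective q
  exact ⟨⟨f, hq⟩, rfl⟩

theorem toSWReduction_eq_zero_iff {f : μ.invariantClasses} :
    μ.toSWReduction f = 0 ↔ (f : SmoothFun E M) ∈ μ.momentumIdeal :=
  Subtype.ext_iff.trans Ideal.Quotient.eq_zero_iff_mem

variable [FiniteDimensional ℝ EG] [T2Space G] [ConnectedSpace G]
  [FiniteDimensional ℝ E] [T2Space M] [ParacompactSpace M]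

theorem bracket_mem_invariantClasses {f h : SmoothFun E M} (hf : f ∈ μ.invariantClasses)
    (hh : h ∈ μ.invariantClasses) : Ω.bracket f h ∈ μ.invariantClasses := by
  have hf' := μ.swClass_mem_iff.1 hf
  have hh' := μ.swClass_mem_iff.1 hh
  refine μ.swClass_mem_iff.2 fun ξ => ?_
  rw [μ.fundamentalVF_bracket]
  exact Submodule.sub_mem _ (μ.bracket_mem_momentumIdeal hf' (hh' ξ))
    (μ.bracket_mem_momentumIdeal hh' (hf' ξ))

theorem exists_swBracket : ∃ P : PoissonBracket μ.swReduction, μ.IsSWBracket P := by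
  obtain ⟨P, hP⟩ := Ω.poisson.exists_reduced μ.invariantClasses
    (fun f hf h hh => μ.bracket_mem_invariantClasses hf hh) μ.toSWReduction
    μ.toSWReduction_surjective
    (fun f k hk => μ.toSWReduction_eq_zero_iff.2
      (μ.bracket_mem_momentumIdeal (μ.swClass_mem_iff.1 f.2) (μ.toSWReduction_eq_zero_iff.1 hk)))
  refine ⟨P, fun f h hf hh => ?_⟩
  obtain ⟨hk, e⟩ := hP ⟨f, hf⟩ ⟨h, hh⟩
  exact congrArg Subtype.val e

theorem IsSWBracket.bracket_toSWReduction {P : PoissonBracket μ.swReduction}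
    (hP : μ.IsSWBracket P) (f h : μ.invariantClasses) :
    ∃ hk : Ω.poisson.bracket (f : SmoothFun E M) h ∈ μ.invariantClasses,
      P.bracket (μ.toSWReduction f) (μ.toSWReduction h) = μ.toSWReduction ⟨_, hk⟩ :=
  ⟨μ.bracket_mem_invariantClasses f.2 h.2, Subtype.ext (hP f h f.2 h.2)⟩

/-! ### Comparison of the reductions -/

/-- An invariant class has f ∈ 𝒩(I_μ), so the hypothesis gives tangency to N. The bracket condition
holds because [v_f, ξ_M] = −v_{ξ_M f} with ξ_M f ∈ I_μ. -/
theorem invariantClasses_le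
    (h : Ω.normalizer (μ.momentumIdeal : Set (SmoothFun E M)) ⊆ firstClass Ω μ.zeroLevel) :
    μ.invariantClasses ≤ reducibleObservables EG G Ω μ.zeroLevel := by
  intro f hf
  have hf' := μ.swClass_mem_iff.1 hf
  refine ⟨fun ξ => μ.momentumIdeal_le_constraintIdeal (hf' ξ), fun k hk => ?_, fun ξ => ?_⟩
  · rw [← Ω.bracket_eq]
    exact h (fun i hi => μ.bracket_mem_momentumIdeal hf' hi) k hk
  · rw [← hamVF_momentum μ, ← Ω.hamVF_bracket, Ω.bracket_skew, ← fundamentalVF_eq_bracket,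
      Ω.hamVF_neg]
    exact Submodule.neg_mem _ (μ.hamVF_mem_verticalVF (hf' ξ))

/-- For reducible f, the function ξ_M f vanishes on N and has vertical Hamiltonian field −[v_f,
ξ_M], so it lies in I_μ. -/
theorem le_invariantClasses
    (h : (constraintIdeal (E := E) μ.zeroLevel : Set (SmoothFun E M)) ∩
      casimir Ω μ.zeroLevel ⊆ (μ.momentumIdeal : Set (SmoothFun E M))) :
    reducibleObservables EG G Ω μ.zeroLevel ≤ μ.invariantClasses := by
  intro f hf
  refine μ.swClass_mem_iff.2 fun ξ =>
    μ.mem_momentumIdeal_of_hamVF_mem_verticalVF h (hf.1 ξ) ?_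
  rw [fundamentalVF_eq_bracket, Ω.bracket_skew, Ω.hamVF_neg, Ω.hamVF_bracket, μ.hamVF_momentum]
  exact Submodule.neg_mem _ (hf.2.2 ξ)

theorem exists_swReduction_to_linftyReduction {P : PoissonBracket μ.swReduction}
    {Q : PoissonBracket (LinftyReduction EG G Ω μ.zeroLevel)} (hP : μ.IsSWBracket P)
    (hQ : IsLinftyBracket Q)
    (h : Ω.normalizer (μ.momentumIdeal : Set (SmoothFun E M)) ⊆ firstClass Ω μ.zeroLevel) :
    ∃ Φ : μ.swReduction →ₐ[ℝ] LinftyReduction EG G Ω μ.zeroLevel,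
      IsPoissonMorphism P Q Φ ∧
      ∀ f : μ.invariantClasses,
        Φ (μ.toSWReduction f) =
          linftyClass (Subalgebra.inclusion (μ.invariantClasses_le h) f) := by
  exact exists_poissonMorphism_to_quotient (β := Ω.poisson) μ.toSWReduction_surjective
    (hP.bracket_toSWReduction μ) hQ (μ.invariantClasses_le h) fun f hf => by
      have hf' := μ.toSWReduction_eq_zero_iff.1 hf
      exact ⟨μ.momentumIdeal_le_constraintIdeal hf', μ.hamVF_mem_verticalVF hf'⟩

theorem exists_linftyReduction_to_swReduction {P : PoissonBracket μ.swReduction}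
    {Q : PoissonBracket (LinftyReduction EG G Ω μ.zeroLevel)} (hP : μ.IsSWBracket P)
    (hQ : IsLinftyBracket Q)
    (h : (constraintIdeal (E := E) μ.zeroLevel : Set (SmoothFun E M)) ∩
      casimir Ω μ.zeroLevel ⊆ (μ.momentumIdeal : Set (SmoothFun E M))) :
    ∃ Ψ : LinftyReduction EG G Ω μ.zeroLevel →ₐ[ℝ] μ.swReduction,
      IsPoissonMorphism Q P Ψ ∧
      ∀ f : reducibleObservables EG G Ω μ.zeroLevel,
        Ψ (linftyClass f) =
          μ.toSWReduction (Subalgebra.inclusion (μ.le_invariantClasses h) f) := by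
  exact exists_poissonMorphism_from_quotient (β := Ω.poisson) hQ (hP.bracket_toSWReduction μ)
    (μ.le_invariantClasses h) fun f hf =>
      μ.toSWReduction_eq_zero_iff.2 (μ.mem_momentumIdeal_of_hamVF_mem_verticalVF h hf.1 hf.2)

end MomentMap

end Action

end ObservableReduction
-- The comparison theorem
theorem mainTheorem7
    {EG : Type*} [NormedAddCommGroup EG] [NormedSpace ℝ EG] [FiniteDimensional ℝ EG]
    {G : Type*} [TopologicalSpace G] [ChartedSpace EG G] [Group G] [LieGroup 𝓘(ℝ, EG) ∞ G]
    [T2Space G] [ConnectedSpace G]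
    {E : Type*} [NormedAddCommGroup E] [NormedSpace ℝ E] [FiniteDimensional ℝ E]
    {M : Type*} [TopologicalSpace M] [ChartedSpace E M] [IsManifold 𝓘(ℝ, E) ∞ M]
    [T2Space M] [ParacompactSpace M]
    [MulAction G M] [ContMDiffSMul 𝓘(ℝ, EG) 𝓘(ℝ, E) ∞ G M]
    (Ω : SymplecticForm E M) (hG : IsSymplecticAction EG G Ω) (μ : MomentMap EG G Ω) :
    ∃ (P : PoissonBracket μ.swReduction)
      (Q : PoissonBracket (LinftyReduction EG G Ω μ.zeroLevel)),
      μ.IsSWBracket P ∧ IsLinftyBracket Q ∧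
      (Ω.normalizer (μ.momentumIdeal : Set (SmoothFun E M)) ⊆ firstClass Ω μ.zeroLevel →
        ∃ Φ : μ.swReduction →ₐ[ℝ] LinftyReduction EG G Ω μ.zeroLevel,
          IsPoissonMorphism P Q Φ ∧
          ∀ (f : SmoothFun E M) (hf : μ.swClass f ∈ μ.swReduction),
            ∃ hf' : f ∈ reducibleObservables EG G Ω μ.zeroLevel,
              Φ ⟨μ.swClass f, hf⟩ = linftyClass ⟨f, hf'⟩) ∧
      ((constraintIdeal (E := E) μ.zeroLevel : Set (SmoothFun E M)) ∩
          casimir Ω μ.zeroLevel ⊆ (μ.momentumIdeal : Set (SmoothFun E M)) →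
        ∃ Ψ : LinftyReduction EG G Ω μ.zeroLevel →ₐ[ℝ] μ.swReduction,
          IsPoissonMorphism Q P Ψ ∧ Function.Injective Ψ ∧
          ∀ f : reducibleObservables EG G Ω μ.zeroLevel,
            (Ψ (linftyClass f) : SmoothFun E M ⧸ μ.momentumIdeal) =
              μ.swClass (f : SmoothFun E M)) ∧
      (μ.momentumIdeal = constraintIdeal μ.zeroLevel →
        ∃ Θ : μ.swReduction ≃ₐ[ℝ] LinftyReduction EG G Ω μ.zeroLevel,
          IsPoissonMorphism P Q Θ.toAlgHom ∧
          ∀ (f : SmoothFun E M) (hf : μ.swClass f ∈ μ.swReduction),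
            ∃ hf' : f ∈ reducibleObservables EG G Ω μ.zeroLevel,
              Θ ⟨μ.swClass f, hf⟩ = linftyClass ⟨f, hf'⟩) := by
  obtain ⟨P, hP⟩ := μ.exists_swBracket
  obtain ⟨Q, hQ⟩ := μ.exists_linftyBracket μ.zeroLevel
  have key1 := μ.exists_swReduction_to_linftyReduction hP hQ
  have key2 := μ.exists_linftyReduction_to_swReduction hP hQ
  refine ⟨P, Q, hP, hQ, fun h => ?_, fun h => ?_, fun h => ?_⟩
  · obtain ⟨Φ, hΦ, hΦf⟩ := key1 h
    exact ⟨Φ, hΦ, fun f hf => ⟨μ.invariantClasses_le h hf, hΦf ⟨f, hf⟩⟩⟩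
  · obtain ⟨Ψ, hΨ, hΨf⟩ := key2 h
    refine ⟨Ψ, hΨ, (injective_iff_map_eq_zero Ψ).2 fun q hq => ?_,
      fun f => congrArg Subtype.val (hΨf f)⟩
    obtain ⟨f, rfl⟩ := linftyClass_surjective EG G Ω μ.zeroLevel q
    -- A class killed by `Ψ` has its representative in I_μ, and such functions already lie in
    -- I_{L_∞}(N).
    have hf : (f : SmoothFun E M) ∈ μ.momentumIdeal :=
      μ.toSWReduction_eq_zero_iff.1 ((hΨf f).symm.trans hq)
    exact (linftyClass_eq_zero_iff _).2
      ⟨μ.momentumIdeal_le_constraintIdeal hf, μ.hamVF_mem_verticalVF hf⟩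
  -- When I_μ = I_N, the normalizer is F_N by definition and the condition on 𝒬 is trivial, so both
  -- inclusions of representatives hold.
  · have h1 : Ω.normalizer (μ.momentumIdeal : Set (SmoothFun E M)) ⊆
        firstClass Ω μ.zeroLevel := by
      rw [h]
      exact fun f hf => hf
    have h2 : (constraintIdeal (E := E) μ.zeroLevel : Set (SmoothFun E M)) ∩
        casimir Ω μ.zeroLevel ⊆ (μ.momentumIdeal : Set (SmoothFun E M)) := by
      rw [h]
      exact Set.inter_subset_left
    obtain ⟨Φ, hΦ, hΦf⟩ := key1 h1
    have hinj : Function.Injective Φ := (injective_iff_map_eq_zero Φ).2 fun q hq => by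
      obtain ⟨f, rfl⟩ := μ.toSWReduction_surjective q
      have hf := (linftyClass_eq_zero_iff _).1 ((hΦf f).symm.trans hq)
      -- Elements of I_{L_∞}(N) vanish on N, which here means that they are in I_μ.
      refine μ.toSWReduction_eq_zero_iff.2 ?_
      rw [h]
      exact hf.1
    have hsurj : Function.Surjective Φ := fun q => by
      obtain ⟨f, rfl⟩ := linftyClass_surjective EG G Ω μ.zeroLevel q
      exact ⟨_, hΦf ⟨f, μ.le_invariantClasses h2 f.2⟩⟩
    exact ⟨AlgEquiv.ofBijective Φ ⟨hinj, hsurj⟩, hΦ,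
      fun f hf => ⟨μ.invariantClasses_le h1 hf, hΦf ⟨f, hf⟩⟩⟩
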